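/- Let $B=B_R(x_0)\subset\mathbb{R}^n$ be an open ball, $n\ge 3$, $\kappa\in(0,\tfrac12)$, and let $v\in W^{1,2}(B)\cap C(B)$ be non-negative and $f\in L^2(\mathbb{R}^n)$. Suppose that there exist $M_1\ge 1$, $M_2>0$, $c_m>0$ and $k_0\ge 0$ such that for all $k\ge k_0$ and all $\eta\in C_c^1(B)$ with $\eta\ge 0$ $$\int_B |\nabla (v-k)_+|^2\eta^2\,dx\le c_m^2M_1^2\int_B (v-k)_+^2|\nabla\eta|^2\,dx+c_m^2M_2^2\int_{B\cap\{v>k\}}\eta^2|f|^2\,dx ,$$ where $s_+=\max\{s,0\}$ and $\nabla(v-k)_+$ is the weak gradient. Then there is a constant $c\in[1,\infty)$, depending only on $c_m$ and $n$ if $n\ge 4$ and only on $c_m$ and $\kappa$ if $n=3$, such that $$\|v_+\|_{L^\infty(\frac14 B)}\le k_0+c\,M_1^{1+\max\{\kappa,\frac{n-3}{2}\}}\Bigl(\frac1{|B|}\int_B (v-k_0)_+^2\,dx\Bigr)^{\frac12}+c\,M_1^{\max\{\kappa,\frac{n-3}{2}\}}M_2\,\|f\|_{L^{n,1}(B)}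 .$$ Here $\frac14 B=B_{R/4}(x_0)$ and $\|f\|_{L^{n,1}(B)}=\int_0^{|B|}t^{\frac1n}(f\chi_B)^*(t)\,\frac{dt}{t}\in[0,\infty]$, where $g^*(t)=\inf\{\sigma\in(0,\infty):|\{x\in\mathbb{R}^n:|g(x)|>\sigma\}|\le t\}$ is the non-increasing rearrangement of a measurable function $g:\mathbb{R}^n\to\mathbb{R}$. -/

import Mathlib

open MeasureTheory Set
open scoped ENNReal Gradient

noncomputable section

/-- `g` is the weak (distributional) gradient of `u` on the open set `Ω ⊆ ℝⁿ`: both are locally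
integrable on `Ω`, and `∫_Ω u ∂ᵢφ = -∫_Ω gᵢ φ` for all `φ ∈ C_c^∞(Ω)` and all `i`. -/
structure HasWeakGradient {n : ℕ} (Ω : Set (EuclideanSpace ℝ (Fin n)))
    (u : EuclideanSpace ℝ (Fin n) → ℝ)
    (g : EuclideanSpace ℝ (Fin n) → EuclideanSpace ℝ (Fin n)) : Prop where
  locallyIntegrableOn : LocallyIntegrableOn u Ω volume
  locallyIntegrableOn_gradient : LocallyIntegrableOn g Ω volume
  integral_eq : ∀ φ : EuclideanSpace ℝ (Fin n) → ℝ, ContDiff ℝ (⊤ : ℕ∞) φ →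
    HasCompactSupport φ → tsupport φ ⊆ Ω → ∀ i : Fin n,
      ∫ x in Ω, u x * (∇ φ x) i = -∫ x in Ω, g x i * φ x

/-- Membership in the Sobolev space `W^{1,2}(Ω)`: `u ∈ L²(Ω)` has a weak gradient in
`L²(Ω; ℝⁿ)`. -/
def MemW12 {n : ℕ} (Ω : Set (EuclideanSpace ℝ (Fin n)))
    (u : EuclideanSpace ℝ (Fin n) → ℝ) : Prop :=
  MemLp u 2 (volume.restrict Ω) ∧
    ∃ g : EuclideanSpace ℝ (Fin n) → EuclideanSpace ℝ (Fin n),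
      HasWeakGradient Ω u g ∧ MemLp g 2 (volume.restrict Ω)

/-- The non-increasing rearrangement
`f*(t) = inf {σ ∈ (0, ∞) : |{x : |f x| > σ}| ≤ t}`, with `inf ∅ = ∞`. -/
def rearrangement {n : ℕ} (f : EuclideanSpace ℝ (Fin n) → ℝ) (t : ℝ) : ℝ≥0∞ :=
  ⨅ (σ : ℝ) (_ : 0 < σ ∧ volume {x | σ < |f x|} ≤ ENNReal.ofReal t), ENNReal.ofReal σ

/-- The Lorentz norm `‖f‖_{L^{n,1}(Ω)} = ∫_0^{|Ω|} t^{1/n} (f χ_Ω)*(t) dt/t`, with values in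
`[0, ∞]`. -/
def lorentzNorm {n : ℕ} (Ω : Set (EuclideanSpace ℝ (Fin n)))
    (f : EuclideanSpace ℝ (Fin n) → ℝ) : ℝ≥0∞ :=
  ∫⁻ t in {t : ℝ | 0 < t ∧ ENNReal.ofReal t < volume Ω},
    ENNReal.ofReal (t ^ (1 / (n : ℝ)) / t) * rearrangement (Ω.indicator f) t

end

/-!
The proof is a De Giorgi iteration whose cutoff functions are chosen optimally for the solution at
each stage, which is what lowers the power of `M₁` from the exponent `n / 2` of the usual iteration
to `1 + max κ ((n - 3) / 2)`.

Write `m = n - 1`. For concentric cubes with half-sides `a < c` and levels `k < k + Δ`, the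
Caccioppoli inequality bounds the energy of `(v - k - Δ)₊` on the small cube by
`M₁² ∫ (v - k - Δ)₊² |∇η|²`, where `η` is any cutoff function between the cubes. Cutoffs that are
products of one-dimensional profiles have gradients concentrated near slices `{xᵢ = r}`, and the
position of the slices can be chosen: `∫ (v - k - Δ)₊² |∇η|²` is bounded by a moment of order
`δ < 1` of the slice integrals of `(v - k - Δ)₊²` (`exists_adapted_cutoff`). On a slice, which has
dimension `m` only, `(v - k - Δ)₊² ≤ Δ^(-2α) (v - k)₊^(2 + 2α)`, and the Sobolev inequality in
dimension `m` controls the right-hand side by the energy at level `k` to the power `1 + α` as soon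
as `1 / α ≥ (m - 2) / 2` (`slice_sobolev_weak`). With `δ = 1 / (1 + α)` this gives

  `J (k + Δ, a) ≤ C M₁² (c - a)^(-6 - 4α) Δ^(-2α) J (k, c)^(1 + α) + C M₂² ∫_{v > k + Δ} f²`

(`CaccioppoliOnCube.exists_step_const`), where `J` is the energy `truncEnergy`. Balancing the first
term against `J (k, c)` shows that the level increments `Δ` have to be proportional to `M₁^(1 / α)`
times the square root of the energy. Slices of a cube are flat, so no inequality on spheres is
needed; this is the reason for working with cubes, that is with balls of the sup norm on `Fin n → ℝ`.

The levels are chosen adaptively (`exists_deGiorgi_const`). By the Chebyshev inequality the sets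
`{v > k + Δ}` on the successive cubes have measure at most `θ^ν`, so the integrals of `f²` over them
are bounded through the values `f*(θ^j)` of the rearrangement (`exists_tail_sequence`). The sum of
the increments of the levels is then a dyadic version of the `L^{n,1}` norm
(`sum_rearrangement_le_lorentzNorm`). Since the energies tend to zero while the levels stay bounded,
`v` is bounded by the limit level at the centre of the cube (`exists_cube_const`).

Every point of the quarter ball is the centre of a cube of half-side `R / (2n)` inside the ball, and
all hypotheses are carried to the unit cube by an affine map
(`caccioppoliOnCube_of_hasWeakGradient`). The Caccioppoli inequality is assumed for every weak
gradient of `(v - k)₊`; that there is one, namely `1_{v > k} ∇v`, is `HasWeakGradient.posPart`.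
-/

/-! ### Weak derivatives and mollification -/

section WeakDerivatives

open Filter Function ContinuousLinearMap
open scoped Topology Convolution ContDiff

theorem integrable_mul_of_locallyIntegrableOn {E : Type*} [NormedAddCommGroup E]
    [MeasurableSpace E] [BorelSpace E] {μ : Measure E} {Ω : Set E} {u ψ : E → ℝ}
    (hu : LocallyIntegrableOn u Ω μ) (hψ : Continuous ψ) (hc : HasCompactSupport ψ)
    (hs : tsupport ψ ⊆ Ω) : Integrable (fun x => u x * ψ x) μ := by
  have h := (hu.integrableOn_compact_subset hs hc)
  have h2 := h.mul_continuousOn hψ.continuousOn hc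
  refine (integrableOn_iff_integrable_of_support_subset ?_).1 h2
  intro x hx
  apply subset_tsupport
  intro h0
  exact hx (by simp [h0])

variable {E : Type*} [NormedAddCommGroup E] [NormedSpace ℝ E]

theorem continuous_fderiv_dir {φ : E → ℝ} (hφ : ContDiff ℝ ∞ φ) (e : E) :
    Continuous fun x => fderiv ℝ φ x e :=
  (hφ.continuous_fderiv (by simp)).clm_apply continuous_const

theorem hasCompactSupport_fderiv_dir {φ : E → ℝ} (hφ : HasCompactSupport φ) (e : E) :
    HasCompactSupport fun x => fderiv ℝ φ x e :=
  hφ.fderiv_apply ℝ e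

theorem tsupport_fderiv_dir_subset (φ : E → ℝ) (e : E) :
    tsupport (fun x => fderiv ℝ φ x e) ⊆ tsupport φ :=
  tsupport_fderiv_apply_subset ℝ e

theorem exists_smooth_cutoff [FiniteDimensional ℝ E] {K Ω : Set E} (hK : IsCompact K)
    (hΩ : IsOpen Ω) (hKΩ : K ⊆ Ω) :
    ∃ χ : E → ℝ, ContDiff ℝ ∞ χ ∧ HasCompactSupport χ ∧ tsupport χ ⊆ Ω ∧
      (∀ᶠ x in 𝓝ˢ K, χ x = 1) ∧ ∀ x, χ x ∈ Icc (0 : ℝ) 1 := by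
  obtain ⟨t, ht, hKt, htΩ⟩ := exists_compact_between hK hΩ hKΩ
  obtain ⟨χ, h1, h0, h01⟩ := exists_contMDiffMap_one_nhds_of_subset_interior
    (modelWithCornersSelf ℝ E) (n := (⊤ : ℕ∞)) hK.isClosed hKt
  have hs : tsupport χ ⊆ t := closure_minimal (fun x hx => by
    by_contra hxt
    exact hx (h0 x hxt)) ht.isClosed
  exact ⟨χ, χ.contMDiff.contDiff, ht.of_isClosed_subset (isClosed_tsupport _) hs,
    hs.trans htΩ, h1, h01⟩

variable [MeasurableSpace E] [BorelSpace E] {μ : Measure E}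

/-- `U` is the weak derivative of `u` in the direction `e` on the open set `Ω`. Integrability of
`u` and `U` is not part of the definition. -/
def HasWeakDirDeriv (μ : Measure E) (Ω : Set E) (u U : E → ℝ) (e : E) : Prop :=
  ∀ φ : E → ℝ, ContDiff ℝ ∞ φ → HasCompactSupport φ → tsupport φ ⊆ Ω →
    ∫ x, u x * fderiv ℝ φ x e ∂μ = -∫ x, U x * φ x ∂μ

/-- The Leibniz rule for the product with a smooth function of compact support in `Ω`; the product,
extended by zero, has a weak derivative on the whole space. -/
theorem HasWeakDirDeriv.mul_cutoff {Ω : Set E} {u U χ : E → ℝ} {e : E}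
    (h : HasWeakDirDeriv μ Ω u U e)
    (hu : LocallyIntegrableOn u Ω μ) (hU : LocallyIntegrableOn U Ω μ)
    (hχ : ContDiff ℝ ∞ χ) (hc : HasCompactSupport χ) (hs : tsupport χ ⊆ Ω) :
    HasWeakDirDeriv μ univ (fun x => χ x * u x)
      (fun x => χ x * U x + fderiv ℝ χ x e * u x) e := by
  intro φ hφ hφc _
  have hd : ∀ x, fderiv ℝ (fun y => χ y * φ y) x e
      = χ x * fderiv ℝ φ x e + φ x * fderiv ℝ χ x e := by
    intro x
    rw [fderiv_fun_mul (hχ.differentiable (by simp) x) (hφ.differentiable (by simp) x)]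
    simp
  have key := h (fun y => χ y * φ y) (hχ.mul hφ) hc.mul_right
    ((tsupport_mul_subset_left).trans hs)
  have e1 := integrable_mul_of_locallyIntegrableOn hu
    (hχ.continuous.mul (continuous_fderiv_dir hφ e)) hc.mul_right
    ((tsupport_mul_subset_left).trans hs)
  have e2 := integrable_mul_of_locallyIntegrableOn hu
    (ψ := (fun x => fderiv ℝ χ x e) * φ)
    ((continuous_fderiv_dir hχ e).mul hφ.continuous) (hasCompactSupport_fderiv_dir hc e).mul_right
    ((tsupport_mul_subset_left).trans ((tsupport_fderiv_dir_subset _ _).trans hs))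
  have e3 := integrable_mul_of_locallyIntegrableOn hU
    (hχ.continuous.mul hφ.continuous) hc.mul_right
    ((tsupport_mul_subset_left).trans hs)
  have i1 : ∫ x, u x * fderiv ℝ (fun y => χ y * φ y) x e ∂μ
      = ∫ x, χ x * u x * fderiv ℝ φ x e ∂μ + ∫ x, fderiv ℝ χ x e * u x * φ x ∂μ := by
    rw [← integral_add (e1.congr (.of_forall fun x => by simp; ring))
      (e2.congr (.of_forall fun x => by simp; ring))]
    refine integral_congr_ae (.of_forall fun x => ?_)
    simp only [hd]; ring
  have i2 : ∫ x, (χ x * U x + fderiv ℝ χ x e * u x) * φ x ∂μ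
      = ∫ x, U x * (χ x * φ x) ∂μ + ∫ x, fderiv ℝ χ x e * u x * φ x ∂μ := by
    rw [← integral_add (e3.congr (.of_forall fun x => by simp))
      (e2.congr (.of_forall fun x => by simp; ring))]
    refine integral_congr_ae (.of_forall fun x => ?_)
    simp only; ring
  rw [i1] at key
  rw [i2]
  linarith

variable [FiniteDimensional ℝ E] [μ.IsAddHaarMeasure]

/-- Differentiation of a mollification falls on the weak derivative. -/
theorem HasWeakDirDeriv.fderiv_mollify {u U : E → ℝ} {e : E} (h : HasWeakDirDeriv μ univ u U e)
    (hu : LocallyIntegrable u μ) (φ : ContDiffBump (0 : E)) (x : E) :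
    fderiv ℝ (φ.normed μ ⋆[lsmul ℝ ℝ, μ] u) x e = (φ.normed μ ⋆[lsmul ℝ ℝ, μ] U) x := by
  have hφ : ContDiff ℝ ∞ (φ.normed μ) := φ.contDiff_normed
  have hφc : HasCompactSupport (φ.normed μ) := φ.hasCompactSupport_normed
  have h1 := hφc.hasFDerivAt_convolution_left (lsmul ℝ ℝ) (hφ.of_le (by simp)) hu x
  rw [h1.fderiv]
  have hex : ConvolutionExistsAt (fderiv ℝ (φ.normed μ)) u x ((lsmul ℝ ℝ).precompL E) μ :=
    (hφc.fderiv ℝ).convolutionExists_left _ (hφ.continuous_fderiv (by simp)) hu x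
  rw [convolution_def, ContinuousLinearMap.integral_apply hex, convolution_def]
  have h2 := h (fun y => φ.normed μ (x - y)) (hφ.comp (contDiff_const.sub contDiff_id))
    (hφc.comp_homeomorph (Homeomorph.subLeft x)) (subset_univ _)
  have hd : ∀ y, fderiv ℝ (fun y => φ.normed μ (x - y)) y e
      = - fderiv ℝ (φ.normed μ) (x - y) e := by
    intro y
    have := ((hφ.differentiable (by simp) (x - y)).hasFDerivAt.comp y
      ((hasFDerivAt_id y).const_sub x)).fderiv
    simp only [Function.comp_def] at this
    rw [this]; simp
  simp only [hd, mul_neg, integral_neg, neg_inj] at h2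
  calc ∫ t, ((lsmul ℝ ℝ).precompL E (fderiv ℝ (φ.normed μ) t) (u (x - t))) e ∂μ
      = ∫ t, (fun s => u s * fderiv ℝ (φ.normed μ) (x - s) e) (x - t) ∂μ := by
        refine integral_congr_ae (.of_forall fun t => ?_)
        simp [mul_comm]
    _ = ∫ s, u s * fderiv ℝ (φ.normed μ) (x - s) e ∂μ :=
        integral_sub_left_eq_self (fun s => u s * fderiv ℝ (φ.normed μ) (x - s) e) μ x
    _ = ∫ s, U s * φ.normed μ (x - s) ∂μ := h2
    _ = ∫ t, (fun s => U s * φ.normed μ (x - s)) (x - t) ∂μ :=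
        (integral_sub_left_eq_self (fun s => U s * φ.normed μ (x - s)) μ x).symm
    _ = _ := by
        refine integral_congr_ae (.of_forall fun t => ?_)
        simp [mul_comm]

/-- Mollification does not increase the `L²` norm. -/
theorem lintegral_mollify_sq_le {U : E → ℝ} (hU : AEStronglyMeasurable U μ)
    (φ : ContDiffBump (0 : E)) :
    ∫⁻ x, ‖(φ.normed μ ⋆[lsmul ℝ ℝ, μ] U) x‖ₑ ^ 2 ∂μ ≤ ∫⁻ x, ‖U x‖ₑ ^ 2 ∂μ := by
  have hφm : Measurable (φ.normed μ) := φ.continuous_normed.measurable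
  have h1 : ∫⁻ y, ENNReal.ofReal (φ.normed μ y) ∂μ = 1 := by
    rw [← ofReal_integral_eq_lintegral_ofReal φ.integrable_normed
      (.of_forall φ.nonneg_normed), φ.integral_normed]; simp
  have hUx : ∀ x, AEMeasurable (fun y => ‖U (x - y)‖ₑ) μ := fun x =>
    (hU.comp_quasiMeasurePreserving (quasiMeasurePreserving_sub_left μ x)).enorm
  have hpt : ∀ x, ‖(φ.normed μ ⋆[lsmul ℝ ℝ, μ] U) x‖ₑ ^ 2
      ≤ ∫⁻ y, ENNReal.ofReal (φ.normed μ y) * ‖U (x - y)‖ₑ ^ 2 ∂μ := by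
    intro x
    -- Cauchy–Schwarz for the probability density of the mollifier
    set a : E → ℝ≥0∞ := fun y => ENNReal.ofReal (φ.normed μ y) with ha
    have ham : Measurable a := hφm.ennreal_ofReal
    have hle : ‖(φ.normed μ ⋆[lsmul ℝ ℝ, μ] U) x‖ₑ ≤ ∫⁻ y, a y ^ (1/2:ℝ) *
        (a y ^ (1/2:ℝ) * ‖U (x - y)‖ₑ) ∂μ := by
      rw [convolution_def]
      refine (enorm_integral_le_lintegral_enorm _).trans (lintegral_mono fun y => ?_)
      rw [← mul_assoc, ← ENNReal.rpow_add_of_nonneg _ _ (by norm_num) (by norm_num)]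
      simp only [lsmul_apply, smul_eq_mul, enorm_mul, ha]
      rw [Real.enorm_eq_ofReal (φ.nonneg_normed y)]
      norm_num
    have hh := ENNReal.lintegral_mul_le_Lp_mul_Lq μ (p := 2) (q := 2)
      (by constructor <;> norm_num) (f := fun y => a y ^ (1/2:ℝ))
      (g := fun y => a y ^ (1/2:ℝ) * ‖U (x - y)‖ₑ)
      (ham.pow_const _).aemeasurable ((ham.pow_const _).aemeasurable.mul (hUx x))
    simp only [Pi.mul_apply] at hh
    have hsq : ∀ z : ℝ≥0∞, (z ^ (1/2:ℝ)) ^ (2:ℝ) = z := by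
      intro z; rw [← ENNReal.rpow_mul]; norm_num
    have hb : ∀ y, (a y ^ (1/2:ℝ) * ‖U (x - y)‖ₑ) ^ (2:ℝ) = a y * ‖U (x - y)‖ₑ ^ 2 := by
      intro y; rw [ENNReal.mul_rpow_of_nonneg _ _ (by norm_num), hsq]; norm_num
    simp only [hsq, hb] at hh
    rw [h1, ENNReal.one_rpow, one_mul] at hh
    calc _ ≤ ((∫⁻ y, a y * ‖U (x - y)‖ₑ ^ 2 ∂μ) ^ (1/2:ℝ)) ^ 2 := by
            gcongr; exact hle.trans hh
      _ = _ := by rw [← ENNReal.rpow_natCast]; exact hsq _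
  calc ∫⁻ x, ‖(φ.normed μ ⋆[lsmul ℝ ℝ, μ] U) x‖ₑ ^ 2 ∂μ
      ≤ ∫⁻ x, ∫⁻ y, ENNReal.ofReal (φ.normed μ y) * ‖U (x - y)‖ₑ ^ 2 ∂μ ∂μ := lintegral_mono hpt
    _ = ∫⁻ y, ∫⁻ x, ENNReal.ofReal (φ.normed μ y) * ‖U (x - y)‖ₑ ^ 2 ∂μ ∂μ := by
        rw [lintegral_lintegral_swap]
        have : AEMeasurable (fun p : E × E => ‖U (p.1 - p.2)‖ₑ) (μ.prod μ) :=
          (hU.comp_quasiMeasurePreserving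
            (quasiMeasurePreserving_sub_of_right_invariant μ μ)).enorm
        exact ((hφm.comp measurable_snd).ennreal_ofReal.aemeasurable).mul (this.pow_const 2)
    _ = ∫⁻ y, ENNReal.ofReal (φ.normed μ y) * ∫⁻ x, ‖U x‖ₑ ^ 2 ∂μ ∂μ := by
        refine lintegral_congr fun y => ?_
        rw [lintegral_const_mul' _ _ ENNReal.ofReal_ne_top,
          lintegral_sub_right_eq_self (fun x => ‖U x‖ₑ ^ 2) y]
    _ = _ := by rw [lintegral_mul_const'' _ hφm.ennreal_ofReal.aemeasurable, h1, one_mul]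

end WeakDerivatives

/-! ### The chain rule for weak derivatives -/

section ChainRule

open Filter Function ContinuousLinearMap
open scoped Topology Convolution ContDiff

theorem exists_seq_contDiffBump {E : Type*} [NormedAddCommGroup E] :
    ∃ β : ℕ → ContDiffBump (0 : E), (∀ k, (β k).rOut ≤ 1) ∧
      Tendsto (fun k => (β k).rOut) atTop (𝓝 0) := by
  refine ⟨fun k => ⟨1 / (2 * ((k : ℝ) + 1)), 1 / ((k : ℝ) + 1), by positivity, ?_⟩, ?_, ?_⟩
  · exact one_div_lt_one_div_of_lt (by positivity) (by nlinarith [(Nat.cast_nonneg k : (0:ℝ) ≤ k)])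
  · intro k
    exact (div_le_one (by positivity)).2 (by linarith [(Nat.cast_nonneg k : (0:ℝ) ≤ k)])
  · exact tendsto_one_div_add_atTop_nhds_zero_nat

variable {E : Type*} [NormedAddCommGroup E] [NormedSpace ℝ E] [FiniteDimensional ℝ E]
  [MeasurableSpace E] [BorelSpace E] {μ : Measure E} [μ.IsAddHaarMeasure]

theorem abs_mollify_le {u : E → ℝ} {M : ℝ} (hM : ∀ x, |u x| ≤ M) (φ : ContDiffBump (0 : E))
    (x : E) : |(φ.normed μ ⋆[lsmul ℝ ℝ, μ] u) x| ≤ M := by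
  have h : ‖∫ t, φ.normed μ t • u (x - t) ∂μ‖ ≤ ∫ t, φ.normed μ t * M ∂μ := by
    refine norm_integral_le_of_norm_le (φ.integrable_normed.mul_const M) (.of_forall fun t => ?_)
    rw [norm_smul, Real.norm_of_nonneg (φ.nonneg_normed t)]
    exact mul_le_mul_of_nonneg_left (hM _) (φ.nonneg_normed t)
  rw [integral_mul_const, φ.integral_normed, one_mul] at h
  exact h

/-- Since its kernel is even, mollification is a symmetric operator. -/
theorem integral_mollify_mul {U ψ : E → ℝ} (hU : Integrable U μ) (hψ : Integrable ψ μ)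
    (φ : ContDiffBump (0 : E)) :
    ∫ x, (φ.normed μ ⋆[lsmul ℝ ℝ, μ] U) x * ψ x ∂μ
      = ∫ y, U y * (φ.normed μ ⋆[lsmul ℝ ℝ, μ] ψ) y ∂μ := by
  have hc := φ.continuous_normed (μ := μ)
  obtain ⟨C, hC⟩ := φ.hasCompactSupport_normed.exists_bound_of_continuous hc
  have hint : Integrable (fun p : E × E => φ.normed μ (p.1 - p.2) * (ψ p.1 * U p.2))
      (μ.prod μ) :=
    (hψ.mul_prod hU).bdd_mul (c := C)
      ((hc.comp (continuous_fst.sub continuous_snd)).aestronglyMeasurable)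
      (.of_forall fun p => hC _)
  calc ∫ x, (φ.normed μ ⋆[lsmul ℝ ℝ, μ] U) x * ψ x ∂μ
      = ∫ x, ∫ y, φ.normed μ (x - y) * (ψ x * U y) ∂μ ∂μ := by
        refine integral_congr_ae (.of_forall fun x => ?_)
        simp only [convolution_eq_swap]
        rw [← integral_mul_const]
        refine integral_congr_ae (.of_forall fun y => ?_)
        simp; ring
    _ = ∫ y, ∫ x, φ.normed μ (x - y) * (ψ x * U y) ∂μ ∂μ := integral_integral_swap hint
    _ = _ := by
        refine integral_congr_ae (.of_forall fun y => ?_)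
        simp only [convolution_eq_swap]
        rw [← integral_const_mul]
        refine integral_congr_ae (.of_forall fun x => ?_)
        simp only [lsmul_apply, smul_eq_mul]
        rw [← φ.normed_neg (y - x), neg_sub]; ring

set_option maxHeartbeats 400000 in
/-- The chain rule `∇(F ∘ u) = F'(u) ∇u` for `F ∈ C¹` with bounded derivative and `u` continuous of
compact support. -/
theorem HasWeakDirDeriv.comp {u U : E → ℝ} {e : E} (h : HasWeakDirDeriv μ univ u U e)
    (hu : Continuous u) (huc : HasCompactSupport u) (hU : Integrable U μ)
    {F : ℝ → ℝ} (hF : ContDiff ℝ 1 F) {C : ℝ} (hC : ∀ t, |deriv F t| ≤ C) :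
    HasWeakDirDeriv μ univ (fun x => F (u x)) (fun x => deriv F (u x) * U x) e := by
  intro φ hφ hφc _
  obtain ⟨β, hβ1, hβ⟩ := exists_seq_contDiffBump (E := E)
  obtain ⟨M, hM⟩ := huc.exists_bound_of_continuous hu
  have hF' : Continuous (deriv F) := hF.continuous_deriv le_rfl
  have huli : LocallyIntegrable u μ := hu.locallyIntegrable
  obtain ⟨w, hw⟩ : ∃ w : ℕ → E → ℝ, ∀ k, w k = (β k).normed μ ⋆[lsmul ℝ ℝ, μ] u :=
    ⟨_, fun _ => rfl⟩
  have hwM : ∀ k x, |w k x| ≤ M := by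
    intro k x
    rw [hw]
    exact abs_mollify_le hM (β k) x
  have hws : ∀ k, ContDiff ℝ ∞ (w k) := by
    intro k
    rw [hw]
    exact (β k).hasCompactSupport_normed.contDiff_convolution_left _ (β k).contDiff_normed huli
  have hwlim : ∀ x, Tendsto (fun p : ℕ × E => w p.1 p.2) (atTop ×ˢ 𝓝 x) (𝓝 (u x)) := by
    intro x
    simp only [hw]
    exact ContDiffBump.convolution_tendsto_right (φ := fun p : ℕ × E => β p.1)
      (g := fun _ => u) (k := Prod.snd) (hβ.comp tendsto_fst)
      (.of_forall fun _ => hu.aestronglyMeasurable)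
      ((hu.tendsto x).comp tendsto_snd) tendsto_snd
  have hwlim' : ∀ x, Tendsto (fun k => w k x) atTop (𝓝 (u x)) := fun x =>
    (hwlim x).comp (tendsto_id.prodMk tendsto_const_nhds)
  obtain ⟨Cφ, hCφ⟩ := hφc.exists_bound_of_continuous hφ.continuous
  -- the identity for the mollified functions, with the mollifier moved to the test function
  have hk : ∀ k, ∫ x, F (w k x) * fderiv ℝ φ x e ∂μ
      = -∫ y, U y * ((β k).normed μ ⋆[lsmul ℝ ℝ, μ] (fun x => deriv F (w k x) * φ x)) y ∂μ := by
    intro k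
    have hFw : ContDiff ℝ 1 (fun x => F (w k x)) := hF.comp ((hws k).of_le (by simp))
    have hd : ∀ x, fderiv ℝ (fun x => F (w k x)) x e
        = deriv F (w k x) * ((β k).normed μ ⋆[lsmul ℝ ℝ, μ] U) x := by
      intro x
      have h1 := (hF.differentiable (by simp) (w k x)).hasDerivAt.comp_hasFDerivAt x
        ((hws k).differentiable (by simp) x).hasFDerivAt
      have h2 : fderiv ℝ (fun x => F (w k x)) x = _ := h1.fderiv
      rw [h2, ← h.fderiv_mollify huli]
      simp [hw]
    have hcd : Continuous fun x => fderiv ℝ (fun x => F (w k x)) x e :=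
      (hFw.continuous_fderiv (by simp)).clm_apply continuous_const
    rw [integral_mul_fderiv_eq_neg_fderiv_mul_of_integrable (f := fun x => F (w k x)) (g := φ)
      ((hcd.mul hφ.continuous).integrable_of_hasCompactSupport hφc.mul_left)
      ((hFw.continuous.mul (continuous_fderiv_dir hφ e)).integrable_of_hasCompactSupport
        (hasCompactSupport_fderiv_dir hφc e).mul_left)
      ((hFw.continuous.mul hφ.continuous).integrable_of_hasCompactSupport hφc.mul_left)
      (fun x _ => hFw.differentiable (by simp) x)
      (fun x _ => hφ.differentiable (by simp) x)]
    rw [← integral_mollify_mul hU]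
    · congr 1
      refine integral_congr_ae (.of_forall fun x => ?_)
      simp only [hd]; ring
    · exact ((hF'.comp (hws k).continuous).mul
        hφ.continuous).integrable_of_hasCompactSupport hφc.mul_left
  have hlim1 : Tendsto (fun k => ∫ x, F (w k x) * fderiv ℝ φ x e ∂μ) atTop
      (𝓝 (∫ x, F (u x) * fderiv ℝ φ x e ∂μ)) := by
    obtain ⟨D, hD⟩ := (isCompact_Icc (a := -M) (b := M)).exists_bound_of_continuousOn
      hF.continuous.continuousOn
    refine tendsto_integral_of_dominated_convergence (fun x => D * ‖fderiv ℝ φ x e‖) ?_ ?_ ?_ ?_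
    · intro k
      exact ((hF.continuous.comp (hws k).continuous).mul
        (continuous_fderiv_dir hφ e)).aestronglyMeasurable
    · exact (((continuous_fderiv_dir hφ e).integrable_of_hasCompactSupport
        (hasCompactSupport_fderiv_dir hφc e)).norm).const_mul D
    · intro k
      refine .of_forall fun x => ?_
      rw [norm_mul]
      exact mul_le_mul_of_nonneg_right (hD _ (abs_le.1 (hwM k x))) (norm_nonneg _)
    · exact .of_forall fun x => ((hF.continuous.tendsto _).comp (hwlim' x)).mul_const _
  have hlim2 : Tendsto (fun k => -∫ y, U y *
      ((β k).normed μ ⋆[lsmul ℝ ℝ, μ] (fun x => deriv F (w k x) * φ x)) y ∂μ) atTop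
      (𝓝 (-∫ x, U x * (deriv F (u x) * φ x) ∂μ)) := by
    have hψc : ∀ k, Continuous fun x => deriv F (w k x) * φ x := fun k =>
      (hF'.comp (hws k).continuous).mul hφ.continuous
    refine (tendsto_integral_of_dominated_convergence (fun y => ‖U y‖ * (C * Cφ))
      ?_ ?_ ?_ ?_).neg
    · intro k
      refine hU.aestronglyMeasurable.mul (Continuous.aestronglyMeasurable ?_)
      exact ((β k).hasCompactSupport_normed.contDiff_convolution_left (n := 0) (lsmul ℝ ℝ)
        (β k).contDiff_normed (hψc k).locallyIntegrable).continuous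
    · exact hU.norm.mul_const _
    · intro k
      refine .of_forall fun y => ?_
      rw [norm_mul]
      refine mul_le_mul_of_nonneg_left (abs_mollify_le (fun x => ?_) (β k) y) (norm_nonneg _)
      rw [abs_mul]
      exact mul_le_mul (hC _) (hCφ x) (abs_nonneg _) ((abs_nonneg _).trans (hC 0))
    · refine .of_forall fun y => Tendsto.const_mul _ ?_
      refine ContDiffBump.convolution_tendsto_right hβ
        (.of_forall fun k => (hψc k).aestronglyMeasurable) ?_ tendsto_const_nhds
      exact ((hF'.tendsto _).comp (hwlim y)).mul ((hφ.continuous.tendsto y).comp tendsto_snd)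
  have := tendsto_nhds_unique hlim1 (hlim2.congr fun k => (hk k).symm)
  rw [this]
  congr 1
  refine integral_congr_ae (.of_forall fun x => ?_)
  simp only; ring

end ChainRule

/-! ### Weak derivatives of truncations -/

section PositivePart

open Filter Function
open scoped Topology ContDiff

/-- The product is continuous on the whole space although `v` may behave badly outside `Ω`. -/
theorem continuous_mul_of_tsupport_subset {X : Type*} [TopologicalSpace X] {χ v : X → ℝ}
    {Ω : Set X} (hΩ : IsOpen Ω) (hχ : Continuous χ) (hs : tsupport χ ⊆ Ω)
    (hv : ContinuousOn v Ω) : Continuous fun x => χ x * v x := by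
  refine continuous_iff_continuousAt.2 fun x => ?_
  by_cases hx : x ∈ Ω
  · exact hχ.continuousAt.mul (hv.continuousAt (hΩ.mem_nhds hx))
  · have h0 : χ =ᶠ[𝓝 x] 0 := notMem_tsupport_iff_eventuallyEq.1 fun h => hx (hs h)
    refine (continuousAt_const (y := (0 : ℝ))).congr ?_
    filter_upwards [h0] with y hy
    simp [hy]

/-- A smooth function that vanishes for `t ≤ 0` and equals `t` for `t ≥ 1`. -/
noncomputable def smoothPosPart (t : ℝ) : ℝ := t * Real.smoothTransition t

theorem contDiff_smoothPosPart : ContDiff ℝ ∞ smoothPosPart :=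
  contDiff_id.mul Real.smoothTransition.contDiff

theorem deriv_smoothPosPart_of_nonpos {t : ℝ} (ht : t ≤ 0) : deriv smoothPosPart t = 0 := by
  have hc : Continuous (deriv smoothPosPart) := contDiff_smoothPosPart.continuous_deriv (by simp)
  have h1 : ∀ s ∈ Iio (0:ℝ), deriv smoothPosPart s = 0 := by
    intro s hs
    have : smoothPosPart =ᶠ[𝓝 s] fun _ => 0 := by
      filter_upwards [Iio_mem_nhds hs] with r hr
      simp [smoothPosPart, Real.smoothTransition.zero_of_nonpos (le_of_lt hr)]
    rw [this.deriv_eq]; simp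
  have h2 : closure (Iio (0:ℝ)) ⊆ {s | deriv smoothPosPart s = 0} :=
    closure_minimal h1 (isClosed_eq hc continuous_const)
  rw [closure_Iio] at h2
  exact h2 ht

theorem deriv_smoothPosPart_of_one_lt {t : ℝ} (ht : 1 < t) : deriv smoothPosPart t = 1 := by
  have : smoothPosPart =ᶠ[𝓝 t] fun s => s := by
    filter_upwards [Ioi_mem_nhds ht] with r hr
    simp [smoothPosPart, Real.smoothTransition.one_of_one_le (le_of_lt hr)]
  rw [this.deriv_eq]; simp

theorem exists_abs_deriv_smoothPosPart_le : ∃ C, ∀ t, |deriv smoothPosPart t| ≤ C := by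
  obtain ⟨D, hD⟩ := (isCompact_Icc (a := (0:ℝ)) (b := 1)).exists_bound_of_continuousOn
    (contDiff_smoothPosPart.continuous_deriv (by simp)).continuousOn
  refine ⟨max D 1, fun t => ?_⟩
  rcases le_or_gt t 0 with h | h
  · simp [deriv_smoothPosPart_of_nonpos h]
  · rcases le_or_gt t 1 with h' | h'
    · exact (hD t ⟨h.le, h'⟩).trans (le_max_left _ _)
    · simp [deriv_smoothPosPart_of_one_lt h']

/-- Rescalings of `smoothPosPart` that converge to `t ↦ (t - k)₊` as `j → ∞`. -/
noncomputable def approxPosPart (k : ℝ) (j : ℕ) (t : ℝ) : ℝ :=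
  smoothPosPart (((j : ℝ) + 1) * (t - k)) / ((j : ℝ) + 1)

theorem approxPosPart_eq (k : ℝ) (j : ℕ) (t : ℝ) :
    approxPosPart k j t = (t - k) * Real.smoothTransition (((j : ℝ) + 1) * (t - k)) := by
  have : (j : ℝ) + 1 ≠ 0 := by positivity
  unfold approxPosPart smoothPosPart
  field_simp

theorem contDiff_approxPosPart (k : ℝ) (j : ℕ) : ContDiff ℝ 1 (approxPosPart k j) :=
  ((contDiff_smoothPosPart.of_le (by simp)).comp
    (contDiff_const.mul (contDiff_id.sub contDiff_const))).div_const _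

theorem deriv_approxPosPart (k : ℝ) (j : ℕ) (t : ℝ) :
    deriv (approxPosPart k j) t = deriv smoothPosPart (((j : ℝ) + 1) * (t - k)) := by
  have hj : (j : ℝ) + 1 ≠ 0 := by positivity
  have h1 : HasDerivAt (fun t : ℝ => ((j : ℝ) + 1) * (t - k)) (((j : ℝ) + 1) * 1) t :=
    ((hasDerivAt_id t).sub_const k).const_mul _
  have h2 := ((contDiff_smoothPosPart.differentiable (by simp)
    (((j : ℝ) + 1) * (t - k))).hasDerivAt.comp t h1).div_const ((j : ℝ) + 1)
  refine h2.deriv.trans ?_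
  field_simp

theorem tendsto_succ_mul_atTop {a : ℝ} (ha : 0 < a) :
    Tendsto (fun j : ℕ => ((j : ℝ) + 1) * a) atTop atTop :=
  (tendsto_atTop_add_const_right _ 1 tendsto_natCast_atTop_atTop).atTop_mul_const ha

theorem tendsto_approxPosPart (k t : ℝ) :
    Tendsto (fun j => approxPosPart k j t) atTop (𝓝 (max (t - k) 0)) := by
  rcases le_or_gt t k with h | h
  · rw [max_eq_right (by linarith)]
    refine tendsto_const_nhds.congr fun j => ?_
    rw [approxPosPart_eq, Real.smoothTransition.zero_of_nonpos, mul_zero]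
    exact mul_nonpos_of_nonneg_of_nonpos (by positivity) (by linarith)
  · rw [max_eq_left (by linarith)]
    refine tendsto_const_nhds.congr' ?_
    filter_upwards [(tendsto_succ_mul_atTop (sub_pos.2 h)).eventually_ge_atTop 1] with j hj
    rw [approxPosPart_eq, Real.smoothTransition.one_of_one_le hj, mul_one]

theorem tendsto_deriv_approxPosPart (k t : ℝ) :
    Tendsto (fun j => deriv (approxPosPart k j) t) atTop (𝓝 (if k < t then 1 else 0)) := by
  simp only [deriv_approxPosPart]
  split_ifs with h
  · refine tendsto_const_nhds.congr' ?_
    filter_upwards [(tendsto_succ_mul_atTop (sub_pos.2 h)).eventually_gt_atTop 1] with j hj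
    rw [deriv_smoothPosPart_of_one_lt hj]
  · refine tendsto_const_nhds.congr fun j => ?_
    rw [deriv_smoothPosPart_of_nonpos]
    exact mul_nonpos_of_nonneg_of_nonpos (by positivity) (by linarith)

theorem abs_approxPosPart_le (k : ℝ) (j : ℕ) (t : ℝ) : |approxPosPart k j t| ≤ |t - k| := by
  rw [approxPosPart_eq, abs_mul]
  refine mul_le_of_le_one_right (abs_nonneg _) ?_
  rw [abs_of_nonneg (Real.smoothTransition.nonneg _)]
  exact Real.smoothTransition.le_one _

variable {E : Type*} [NormedAddCommGroup E] [NormedSpace ℝ E] [FiniteDimensional ℝ E]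
  [MeasurableSpace E] [BorelSpace E] {μ : Measure E} [μ.IsAddHaarMeasure]

theorem HasWeakDirDeriv.posPart_of_compactSupport {u U : E → ℝ} {e : E}
    (h : HasWeakDirDeriv μ univ u U e)
    (hu : Continuous u) (huc : HasCompactSupport u) (hU : Integrable U μ) (k : ℝ) :
    HasWeakDirDeriv μ univ (fun x => max (u x - k) 0) ({x | k < u x}.indicator U) e := by
  intro φ hφ hφc _
  obtain ⟨C, hC⟩ := exists_abs_deriv_smoothPosPart_le
  obtain ⟨Cφ, hCφ⟩ := hφc.exists_bound_of_continuous hφ.continuous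
  have hC' : ∀ j t, |deriv (approxPosPart k j) t| ≤ C := fun j t => by
    rw [deriv_approxPosPart]; exact hC _
  have hj := fun j => h.comp hu huc hU (contDiff_approxPosPart k j) (hC' j) φ hφ hφc
    (subset_univ _)
  have hlim1 : Tendsto (fun j => ∫ x, approxPosPart k j (u x) * fderiv ℝ φ x e ∂μ) atTop
      (𝓝 (∫ x, max (u x - k) 0 * fderiv ℝ φ x e ∂μ)) := by
    refine tendsto_integral_of_dominated_convergence
      (fun x => ‖(u x - k) * fderiv ℝ φ x e‖) ?_ ?_ ?_ ?_
    · intro j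
      exact (((contDiff_approxPosPart k j).continuous.comp hu).mul
        (continuous_fderiv_dir hφ e)).aestronglyMeasurable
    · exact (((hu.sub continuous_const).mul (continuous_fderiv_dir hφ
        e)).integrable_of_hasCompactSupport (hasCompactSupport_fderiv_dir hφc e).mul_left).norm
    · intro j
      refine .of_forall fun x => ?_
      rw [norm_mul, norm_mul]
      exact mul_le_mul_of_nonneg_right (abs_approxPosPart_le _ _ _) (norm_nonneg _)
    · exact .of_forall fun x => (tendsto_approxPosPart k (u x)).mul_const _
  have hlim2 : Tendsto (fun j => -∫ x, deriv (approxPosPart k j) (u x) * U x * φ x ∂μ) atTop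
      (𝓝 (-∫ x, {x | k < u x}.indicator U x * φ x ∂μ)) := by
    refine (tendsto_integral_of_dominated_convergence (fun x => C * ‖U x‖ * Cφ)
      ?_ ?_ ?_ ?_).neg
    · intro j
      exact ((((contDiff_approxPosPart k j).continuous_deriv le_rfl).comp
        hu).aestronglyMeasurable.mul hU.aestronglyMeasurable).mul
        hφ.continuous.aestronglyMeasurable
    · exact (hU.norm.const_mul _).mul_const _
    · intro j
      refine .of_forall fun x => ?_
      rw [norm_mul, norm_mul]
      have := (abs_nonneg _).trans (hC 0)
      exact mul_le_mul (mul_le_mul_of_nonneg_right (hC' _ _) (norm_nonneg _)) (hCφ x)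
        (norm_nonneg _) (by positivity)
    · refine .of_forall fun x => Tendsto.mul_const _ ?_
      have := (tendsto_deriv_approxPosPart k (u x)).mul_const (U x)
      convert this using 2
      by_cases hx : k < u x <;> simp [hx, indicator]
  exact tendsto_nhds_unique hlim1 (hlim2.congr fun j => (hj j).symm)

/-- The weak derivative of the truncation `(v - k)₊` of a continuous function. -/
theorem HasWeakDirDeriv.posPart {Ω : Set E} (hΩ : IsOpen Ω) {v V : E → ℝ} {e : E}
    (h : HasWeakDirDeriv μ Ω v V e) (hv : ContinuousOn v Ω) (hV : LocallyIntegrableOn V Ω μ)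
    (k : ℝ) :
    HasWeakDirDeriv μ Ω (fun x => max (v x - k) 0) ({x | k < v x}.indicator V) e := by
  intro φ hφ hφc hφs
  -- a cutoff function that is `1` near the support of `φ` reduces the claim to the whole space
  obtain ⟨χ, hχ, hχc, hχs, hχ1, -⟩ := exists_smooth_cutoff hφc hΩ hφs
  have hvi : LocallyIntegrableOn v Ω μ := hv.locallyIntegrableOn hΩ.measurableSet
  have hu := continuous_mul_of_tsupport_subset hΩ hχ.continuous hχs hv
  have hU : Integrable (fun x => χ x * V x + fderiv ℝ χ x e * v x) μ := by
    refine Integrable.add ?_ ?_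
    · exact (integrable_mul_of_locallyIntegrableOn hV hχ.continuous hχc hχs).congr
        (.of_forall fun x => mul_comm _ _)
    · exact (integrable_mul_of_locallyIntegrableOn hvi (continuous_fderiv_dir hχ e)
        (hasCompactSupport_fderiv_dir hχc e)
        ((tsupport_fderiv_dir_subset _ _).trans hχs)).congr (.of_forall fun x => mul_comm _ _)
  have key := (h.mul_cutoff hvi hV hχ hχc hχs).posPart_of_compactSupport hu hχc.mul_right hU k φ
    hφ hφc (subset_univ _)
  have hnear : ∀ x ∈ tsupport φ, χ x = 1 ∧ fderiv ℝ χ x e = 0 := by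
    intro x hx
    have h1 : χ =ᶠ[𝓝 x] fun _ => 1 := eventually_nhdsSet_iff_forall.1 hχ1 x hx
    exact ⟨h1.self_of_nhds, by rw [h1.fderiv_eq]; simp⟩
  convert key using 1
  · refine integral_congr_ae (.of_forall fun x => ?_)
    by_cases hx : x ∈ tsupport φ
    · simp [(hnear x hx).1]
    · have : fderiv ℝ φ x e = 0 := by
        by_contra h0
        exact hx (tsupport_fderiv_dir_subset φ e (subset_tsupport _ h0))
      simp [this]
  · congr 1
    refine integral_congr_ae (.of_forall fun x => ?_)
    by_cases hx : x ∈ tsupport φ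
    · simp [(hnear x hx).1, (hnear x hx).2, indicator]
    · simp [image_eq_zero_of_notMem_tsupport hx]

end PositivePart

/-! ### Sobolev inequalities on cubes and on slices -/

section Sobolev

open Filter Function Metric
open scoped Topology ContDiff NNReal Convolution

/-- The partial derivative in the `i`-th coordinate direction. -/
noncomputable abbrev partialDeriv {d : ℕ} (i : Fin d) (φ : (Fin d → ℝ) → ℝ) (x : Fin d → ℝ) : ℝ :=
  fderiv ℝ φ x (Pi.single i 1)

theorem enorm_clm_sq_le {d : ℕ} (A : (Fin d → ℝ) →L[ℝ] ℝ) :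
    ‖A‖ₑ ^ 2 ≤ d * ∑ i, ‖A (Pi.single i 1)‖ₑ ^ 2 := by
  have h1 : ‖A‖ ≤ ∑ i, ‖A (Pi.single i 1)‖ := by
    refine A.opNorm_le_bound (Finset.sum_nonneg fun i _ => norm_nonneg _) fun x => ?_
    have hx : A x = ∑ i, x i * A (Pi.single i 1) := by
      conv_lhs => rw [pi_eq_sum_univ' x]
      rw [map_sum]
      refine Finset.sum_congr rfl fun i _ => ?_
      rw [map_smul, smul_eq_mul]
    rw [hx, Finset.sum_mul]
    refine (norm_sum_le _ _).trans (Finset.sum_le_sum fun i _ => ?_)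
    rw [norm_mul, mul_comm]
    exact mul_le_mul_of_nonneg_left (norm_le_pi_norm x i) (norm_nonneg _)
  have h2 : ‖A‖ ^ 2 ≤ d * ∑ i, ‖A (Pi.single i 1)‖ ^ 2 := by
    refine (pow_le_pow_left₀ (norm_nonneg _) h1 2).trans ?_
    simpa using sq_sum_le_card_mul_sum_sq (s := Finset.univ)
      (f := fun i : Fin d => ‖A (Pi.single i 1)‖)
  have h3 := ENNReal.ofReal_le_ofReal h2
  rw [ENNReal.ofReal_pow (norm_nonneg _), ENNReal.ofReal_mul (by positivity),
    ENNReal.ofReal_sum_of_nonneg (fun i _ => by positivity)] at h3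
  simp only [ENNReal.ofReal_pow (norm_nonneg _), ofReal_norm, ENNReal.ofReal_natCast] at h3
  exact h3

/-- The Sobolev inequality `‖w‖_q² ≤ C ‖∇w‖₂²` on a bounded set of `ℝᵈ`, for subcritical or
critical `q`. The constant is used in dimension `n` and, on slices, in dimension `n - 1`. -/
theorem exists_sobolev_const {d : ℕ} (hd : 2 ≤ d) {q : ℝ} (hq : 2 ≤ q)
    (hqd : 1 / 2 - 1 / (d : ℝ) ≤ 1 / q) :
    ∃ C : ℝ≥0, ∀ w : (Fin d → ℝ) → ℝ, ContDiff ℝ 1 w → HasCompactSupport w →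
      support w ⊆ ball 0 2 →
      (∫⁻ x, ‖w x‖ₑ ^ q) ^ (2 / q) ≤ C * ∫⁻ x, ∑ i, ‖partialDeriv i w x‖ₑ ^ 2 := by
  have hd0 : (0:ℝ) < d := by positivity
  have hd2 : (2:ℝ) ≤ d := by exact_mod_cast hd
  have hq0 : 0 < q := by linarith
  -- the exponent `p ≤ 2` whose Sobolev conjugate is `q`
  set p : ℝ := (1 / q + 1 / d)⁻¹ with hp
  have hpinv : 1 / p = 1 / q + 1 / d := by simp [hp]
  have hp0 : 0 < p := by positivity
  have hp2 : p ≤ 2 := by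
    have : 1 / (2:ℝ) ≤ 1 / p := by rw [hpinv]; linarith
    exact (one_div_le_one_div (by norm_num) hp0).1 this
  have hp1 : 1 ≤ p := by
    have h1 : 1 / q ≤ 1 / 2 := one_div_le_one_div_of_le (by norm_num) hq
    have h2 : 1 / (d:ℝ) ≤ 1 / 2 := one_div_le_one_div_of_le (by norm_num) hd2
    have : 1 / p ≤ 1 / 1 := by rw [hpinv]; linarith
    exact (one_div_le_one_div hp0 one_pos).1 this
  set μ : Measure (Fin d → ℝ) := volume
  obtain ⟨P, hP⟩ : ∃ P : ℝ≥0, (P : ℝ) = p := ⟨⟨p, hp0.le⟩, rfl⟩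
  obtain ⟨Q, hQ⟩ : ∃ Q : ℝ≥0, (Q : ℝ) = q := ⟨⟨q, hq0.le⟩, rfl⟩
  have : Nonempty (Fin d) := ⟨⟨0, by omega⟩⟩
  set C₁ := SNormLESNormFDerivOfEqConst ℝ μ P with hC₁
  set A : ℝ≥0∞ := μ (ball 0 2) ^ (1 / p - 1 / 2) with hA
  have hAtop : A ≠ ⊤ := ENNReal.rpow_ne_top_of_nonneg
    (by have := one_div_le_one_div_of_le hp0 hp2; linarith) measure_ball_lt_top.ne
  refine ⟨(C₁ * A.toNNReal) ^ 2 * d, fun w hw hc hs => ?_⟩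
  have h1 := eLpNorm_le_eLpNorm_fderiv_of_eq (F := ℝ) μ hw hc (p := P)
    (p' := Q) (by rw [← hP] at hp1; exact_mod_cast hp1) (by simp; omega) (by
      simp only [NNReal.coe_inv, Module.finrank_fin_fun, hP, hQ]
      have := hpinv
      rw [one_div, one_div, one_div] at this
      linarith)
  have hfs : support (fderiv ℝ w) ⊆ closedBall 0 2 := by
    refine subset_closure.trans ((tsupport_fderiv_subset ℝ).trans ?_)
    exact closure_minimal (hs.trans ball_subset_closedBall) isClosed_closedBall
  have hball : μ (closedBall 0 2) = μ (ball 0 2) := Measure.addHaar_closedBall_eq_addHaar_ball _ _ _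
  have hgc : Continuous (fderiv ℝ w) := hw.continuous_fderiv (by simp)
  have h2 : eLpNorm (fderiv ℝ w) P μ
      ≤ eLpNorm (fderiv ℝ w) 2 μ * A := by
    rw [← eLpNorm_restrict_eq_of_support_subset (f := fderiv ℝ w) hfs]
    refine (eLpNorm_le_eLpNorm_mul_rpow_measure_univ (q := 2) ?_
      hgc.aestronglyMeasurable).trans ?_
    · rw [← hP] at hp2
      exact_mod_cast hp2
    · gcongr
      · exact Measure.restrict_le_self
      · rw [hA, Measure.restrict_apply_univ, hball]
        simp [hP]
  have h3 : eLpNorm w Q μ ≤ C₁ * A * eLpNorm (fderiv ℝ w) 2 μ := by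
    refine h1.trans ((mul_le_mul_right h2 _).trans (le_of_eq ?_))
    ring
  have hqne : (Q : ℝ≥0∞) ≠ 0 := by
    rw [← hQ] at hq0
    exact_mod_cast hq0.ne'
  rw [eLpNorm_eq_lintegral_rpow_enorm_toReal hqne ENNReal.coe_ne_top,
    eLpNorm_eq_lintegral_rpow_enorm_toReal (by simp) (by simp)] at h3
  simp only [ENNReal.coe_toReal, hQ, ENNReal.toReal_ofNat] at h3
  have h4 := pow_le_pow_left₀ zero_le h3 2
  rw [mul_pow, ← ENNReal.rpow_natCast ((∫⁻ x, _ ∂μ) ^ (1 / q)), ← ENNReal.rpow_mul,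
    ← ENNReal.rpow_natCast ((∫⁻ x, _ ∂μ) ^ (1 / (2:ℝ))), ← ENNReal.rpow_mul] at h4
  have e1 : 1 / q * ((2:ℕ) : ℝ) = 2 / q := by push_cast; ring
  have e2 : 1 / 2 * ((2:ℕ) : ℝ) = 1 := by norm_num
  rw [e1, e2, ENNReal.rpow_one] at h4
  refine h4.trans ?_
  have h5 : ∫⁻ x, ‖fderiv ℝ w x‖ₑ ^ (2:ℝ) ∂μ ≤ d * ∫⁻ x, ∑ i, ‖partialDeriv i w x‖ₑ ^ 2 := by
    rw [← lintegral_const_mul' _ _ (by simp)]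
    refine lintegral_mono fun x => ?_
    rw [ENNReal.rpow_two]
    exact enorm_clm_sq_le _
  refine (mul_le_mul_right h5 _).trans (le_of_eq ?_)
  push_cast
  rw [ENNReal.coe_toNNReal hAtop]
  ring

/-- Fubini's theorem: integration over the slices `{x i = r}`, followed by integration in `r`. -/
theorem lintegral_eq_lintegral_insertNth {m : ℕ} (i : Fin (m + 1)) {g : (Fin (m + 1) → ℝ) → ℝ≥0∞}
    (hg : Measurable g) :
    ∫⁻ x, g x = ∫⁻ r : ℝ, ∫⁻ y : Fin m → ℝ, g (i.insertNth r y) := by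
  have h := (volume_preserving_piFinSuccAbove (fun _ : Fin (m + 1) => ℝ) i).symm
  rw [← h.lintegral_comp hg, Measure.volume_eq_prod, lintegral_prod]
  · rfl
  · exact (hg.comp h.measurable).aemeasurable

theorem norm_le_norm_insertNth {m : ℕ} (i : Fin (m + 1)) (r : ℝ) (y : Fin m → ℝ) :
    ‖y‖ ≤ ‖(i.insertNth r y : Fin (m + 1) → ℝ)‖ := by
  refine (pi_norm_le_iff_of_nonneg (norm_nonneg _)).2 fun j => ?_
  have := norm_le_pi_norm (i.insertNth r y : Fin (m + 1) → ℝ) (i.succAbove j)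
  rwa [Fin.insertNth_apply_succAbove] at this

theorem hasFDerivAt_insertNth {m : ℕ} (i : Fin (m + 1)) (r : ℝ) (y : Fin m → ℝ) :
    HasFDerivAt (fun y : Fin m → ℝ => (i.insertNth r y : Fin (m + 1) → ℝ))
      (ContinuousLinearMap.pi fun j => i.insertNth (α := fun _ => (Fin m → ℝ) →L[ℝ] ℝ) 0
        (fun k => ContinuousLinearMap.proj k) j) y := by
  refine hasFDerivAt_pi.2 fun j => ?_
  refine i.succAboveCases ?_ (fun k => ?_) j
  · simpa only [Fin.insertNth_apply_same] using hasFDerivAt_const r y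
  · simpa only [Fin.insertNth_apply_succAbove] using hasFDerivAt_apply k y

theorem contDiff_insertNth {m : ℕ} (i : Fin (m + 1)) (r : ℝ) :
    ContDiff ℝ ∞ fun y : Fin m → ℝ => (i.insertNth r y : Fin (m + 1) → ℝ) := by
  rw [contDiff_pi]
  intro j
  refine i.succAboveCases ?_ (fun k => ?_) j
  · simpa only [Fin.insertNth_apply_same] using contDiff_const
  · simpa only [Fin.insertNth_apply_succAbove] using contDiff_apply ℝ ℝ k

theorem partialDeriv_insertNth {m : ℕ} (i : Fin (m + 1)) (r : ℝ) (y : Fin m → ℝ)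
    {w : (Fin (m + 1) → ℝ) → ℝ} (hw : Differentiable ℝ w) (j : Fin m) :
    partialDeriv j (fun y => w (i.insertNth r y)) y
      = partialDeriv (i.succAbove j) w (i.insertNth r y) := by
  have h := ((hw (i.insertNth r y)).hasFDerivAt.comp y (hasFDerivAt_insertNth i r y)).fderiv
  unfold partialDeriv
  refine (congrArg (fun A : (Fin m → ℝ) →L[ℝ] ℝ => A (Pi.single j 1)) h).trans ?_
  simp only [ContinuousLinearMap.comp_apply]
  congr 1
  ext l
  refine i.succAboveCases ?_ (fun k => ?_) l
  · simp
  · simp [Pi.single_apply]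

theorem slice_sobolev_smooth {m : ℕ} {q : ℝ} {C : ℝ≥0}
    (hC : ∀ w : (Fin m → ℝ) → ℝ, ContDiff ℝ 1 w → HasCompactSupport w →
      support w ⊆ ball 0 2 →
      (∫⁻ x, ‖w x‖ₑ ^ q) ^ (2 / q) ≤ C * ∫⁻ x, ∑ i, ‖partialDeriv i w x‖ₑ ^ 2)
    {w : (Fin (m + 1) → ℝ) → ℝ} (hw : ContDiff ℝ ∞ w)
    (hs : support w ⊆ ball 0 2) (i : Fin (m + 1)) :
    ∫⁻ r : ℝ, (∫⁻ y : Fin m → ℝ, ‖w (i.insertNth r y)‖ₑ ^ q) ^ (2 / q)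
      ≤ C * ∫⁻ x, ∑ i, ‖partialDeriv i w x‖ₑ ^ 2 := by
  have hm : Measurable fun x => ∑ i, ‖partialDeriv i w x‖ₑ ^ 2 :=
    Finset.measurable_sum _ fun i _ =>
      ((continuous_fderiv_dir hw _).measurable.enorm.pow_const 2)
  rw [lintegral_eq_lintegral_insertNth i hm, ← lintegral_const_mul' _ _ ENNReal.coe_ne_top]
  refine lintegral_mono fun r => ?_
  have hsl : support (fun y : Fin m → ℝ => w (i.insertNth r y)) ⊆ ball 0 2 := by
    intro y hy
    have := hs (show i.insertNth r y ∈ support w from hy)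
    rw [mem_ball_zero_iff] at this ⊢
    exact (norm_le_norm_insertNth i r y).trans_lt this
  refine (hC (fun y => w (i.insertNth r y)) ((hw.comp (contDiff_insertNth i r)).of_le (by simp))
    (HasCompactSupport.of_support_subset_isCompact (isCompact_closedBall 0 2)
      (hsl.trans ball_subset_closedBall)) hsl).trans ?_
  refine mul_le_mul_right (lintegral_mono fun y => ?_) _
  rw [Fin.sum_univ_succAbove _ i]
  simp only [partialDeriv_insertNth i r y (hw.differentiable (by simp))]
  exact le_add_self

/-- A compactly supported continuous function with weak derivatives in `L²` is a pointwise limit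
of smooth functions whose derivatives do not have larger `L²` norms. -/
theorem exists_smooth_approx {d : ℕ} {u : (Fin d → ℝ) → ℝ} {U : Fin d → (Fin d → ℝ) → ℝ}
    (hu : Continuous u) (hs : support u ⊆ ball 0 1) (hU : ∀ i, AEStronglyMeasurable (U i))
    (h : ∀ i, HasWeakDirDeriv volume univ u (U i) (Pi.single i 1)) :
    ∃ w : ℕ → (Fin d → ℝ) → ℝ, (∀ k, ContDiff ℝ ∞ (w k)) ∧ (∀ k, support (w k) ⊆ ball 0 2) ∧
      (∀ x, Tendsto (fun k => w k x) atTop (𝓝 (u x))) ∧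
      ∀ k, ∫⁻ x, ∑ i, ‖partialDeriv i (w k) x‖ₑ ^ 2 ≤ ∫⁻ x, ∑ i, ‖U i x‖ₑ ^ 2 := by
  obtain ⟨β, hβ1, hβ⟩ := exists_seq_contDiffBump (E := Fin d → ℝ)
  have hli : LocallyIntegrable u (volume : Measure (Fin d → ℝ)) := hu.locallyIntegrable
  have hsm : ∀ k, ContDiff ℝ ∞
      ((β k).normed volume ⋆[ContinuousLinearMap.lsmul ℝ ℝ, volume] u) := fun k =>
    (β k).hasCompactSupport_normed.contDiff_convolution_left _ (β k).contDiff_normed hli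
  refine ⟨fun k => (β k).normed volume ⋆[ContinuousLinearMap.lsmul ℝ ℝ, volume] u,
    hsm, fun k => ?_, fun x => ?_, fun k => ?_⟩
  · refine (support_convolution_subset _).trans ?_
    rw [(β k).support_normed_eq]
    rintro _ ⟨a, ha, b, hb, rfl⟩
    have hb' := hs hb
    rw [mem_ball_zero_iff] at ha hb' ⊢
    have := norm_add_le a b
    have := hβ1 k
    simp only at *
    linarith
  · exact ContDiffBump.convolution_tendsto_right_of_continuous hβ hu x
  · rw [lintegral_finsetSum, lintegral_finsetSum']
    · refine Finset.sum_le_sum fun i _ => ?_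
      refine le_trans (le_of_eq ?_) (lintegral_mollify_sq_le (hU i) (β k))
      refine lintegral_congr fun x => ?_
      rw [partialDeriv, (h i).fderiv_mollify hli]
    · exact fun i _ => (hU i).enorm.pow_const 2
    · exact fun i _ => ((continuous_fderiv_dir (hsm k) _).measurable.enorm.pow_const 2)

/-- The Sobolev inequality for continuous functions with weak derivatives. -/
theorem sobolev_weak {d : ℕ} {q : ℝ} (hq : 0 < q) {C : ℝ≥0}
    (hC : ∀ w : (Fin d → ℝ) → ℝ, ContDiff ℝ 1 w → HasCompactSupport w →
      support w ⊆ ball 0 2 →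
      (∫⁻ x, ‖w x‖ₑ ^ q) ^ (2 / q) ≤ C * ∫⁻ x, ∑ i, ‖partialDeriv i w x‖ₑ ^ 2)
    {u : (Fin d → ℝ) → ℝ} {U : Fin d → (Fin d → ℝ) → ℝ}
    (hu : Continuous u) (hs : support u ⊆ ball 0 1) (hU : ∀ i, AEStronglyMeasurable (U i))
    (h : ∀ i, HasWeakDirDeriv volume univ u (U i) (Pi.single i 1)) :
    (∫⁻ x, ‖u x‖ₑ ^ q) ^ (2 / q) ≤ C * ∫⁻ x, ∑ i, ‖U i x‖ₑ ^ 2 := by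
  obtain ⟨w, hw, hws, hlim, hle⟩ := exists_smooth_approx hu hs hU h
  set B := C * ∫⁻ x, ∑ i, ‖U i x‖ₑ ^ 2 with hB
  have hk : ∀ k, ∫⁻ x, ‖w k x‖ₑ ^ q ≤ B ^ (q / 2) := by
    intro k
    have := (hC (w k) ((hw k).of_le (by simp)) (HasCompactSupport.of_support_subset_isCompact
      (isCompact_closedBall 0 2) ((hws k).trans ball_subset_closedBall)) (hws k)).trans
      (mul_le_mul_right (hle k) _)
    have h2 := ENNReal.rpow_le_rpow this (z := q / 2) (by positivity)
    rwa [← ENNReal.rpow_mul, show 2 / q * (q / 2) = 1 by field_simp, ENNReal.rpow_one] at h2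
  have hF : ∫⁻ x, ‖u x‖ₑ ^ q ≤ B ^ (q / 2) := by
    calc ∫⁻ x, ‖u x‖ₑ ^ q = ∫⁻ x, liminf (fun k => ‖w k x‖ₑ ^ q) atTop := by
          refine lintegral_congr fun x => ?_
          exact (((ENNReal.continuous_rpow_const.tendsto _).comp
            ((continuous_enorm.tendsto _).comp (hlim x))).liminf_eq).symm
      _ ≤ liminf (fun k => ∫⁻ x, ‖w k x‖ₑ ^ q) atTop :=
          lintegral_liminf_le fun k => ((hw k).continuous.measurable.enorm.pow_const q)
      _ ≤ liminf (fun _ : ℕ => B ^ (q / 2)) atTop := liminf_le_liminf (.of_forall hk)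
      _ = _ := liminf_const _
  have h2 := ENNReal.rpow_le_rpow hF (z := 2 / q) (by positivity)
  rwa [← ENNReal.rpow_mul, show q / 2 * (2 / q) = 1 by field_simp, ENNReal.rpow_one] at h2

/-- The Sobolev inequality on the slices `{x i = r}`, integrated in `r`. -/
theorem slice_sobolev_weak {m : ℕ} {q : ℝ} (hq : 0 < q) {C : ℝ≥0}
    (hC : ∀ w : (Fin m → ℝ) → ℝ, ContDiff ℝ 1 w → HasCompactSupport w →
      support w ⊆ ball 0 2 →
      (∫⁻ x, ‖w x‖ₑ ^ q) ^ (2 / q) ≤ C * ∫⁻ x, ∑ i, ‖partialDeriv i w x‖ₑ ^ 2)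
    {u : (Fin (m + 1) → ℝ) → ℝ} {U : Fin (m + 1) → (Fin (m + 1) → ℝ) → ℝ}
    (hu : Continuous u) (hs : support u ⊆ ball 0 1) (hU : ∀ i, AEStronglyMeasurable (U i))
    (h : ∀ i, HasWeakDirDeriv volume univ u (U i) (Pi.single i 1)) (i : Fin (m + 1)) :
    ∫⁻ r : ℝ, (∫⁻ y : Fin m → ℝ, ‖u (i.insertNth r y)‖ₑ ^ q) ^ (2 / q)
      ≤ C * ∫⁻ x, ∑ i, ‖U i x‖ₑ ^ 2 := by
  obtain ⟨w, hw, hws, hlim, hle⟩ := exists_smooth_approx hu hs hU h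
  have hins : Measurable fun p : ℝ × (Fin m → ℝ) => (i.insertNth p.1 p.2 : Fin (m + 1) → ℝ) :=
    (continuous_fst.finInsertNth i continuous_snd).measurable
  have hmeas : ∀ k, Measurable fun r : ℝ =>
      (∫⁻ y : Fin m → ℝ, ‖w k (i.insertNth r y)‖ₑ ^ q) ^ (2 / q) := by
    intro k
    refine Measurable.pow_const ?_ _
    exact Measurable.lintegral_prod_right'
      (f := fun p : ℝ × (Fin m → ℝ) => ‖w k (i.insertNth p.1 p.2)‖ₑ ^ q)
      (((hw k).continuous.measurable.comp hins).enorm.pow_const q)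
  calc ∫⁻ r : ℝ, (∫⁻ y : Fin m → ℝ, ‖u (i.insertNth r y)‖ₑ ^ q) ^ (2 / q)
      ≤ ∫⁻ r : ℝ, liminf (fun k => (∫⁻ y, ‖w k (i.insertNth r y)‖ₑ ^ q) ^ (2 / q)) atTop := by
        refine lintegral_mono fun r => ?_
        have hpos : 0 < 2 / q := by positivity
        have h1 : ∫⁻ y : Fin m → ℝ, ‖u (i.insertNth r y)‖ₑ ^ q
            ≤ liminf (fun k => ∫⁻ y, ‖w k (i.insertNth r y)‖ₑ ^ q) atTop := by
          calc ∫⁻ y : Fin m → ℝ, ‖u (i.insertNth r y)‖ₑ ^ q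
              = ∫⁻ y, liminf (fun k => ‖w k (i.insertNth r y)‖ₑ ^ q) atTop := by
                refine lintegral_congr fun y => ?_
                exact (((ENNReal.continuous_rpow_const.tendsto _).comp
                  ((continuous_enorm.tendsto _).comp (hlim _))).liminf_eq).symm
            _ ≤ _ := lintegral_liminf_le fun k =>
                (((hw k).continuous.measurable.comp
                  (hins.comp measurable_prodMk_left)).enorm.pow_const q)
        refine (ENNReal.rpow_le_rpow h1 hpos.le).trans (le_of_eq ?_)
        exact (ENNReal.orderIsoRpow (2 / q) hpos).liminf_apply
    _ ≤ liminf (fun k => ∫⁻ r : ℝ, (∫⁻ y, ‖w k (i.insertNth r y)‖ₑ ^ q) ^ (2 / q)) atTop :=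
        lintegral_liminf_le hmeas
    _ ≤ liminf (fun _ : ℕ => C * ∫⁻ x, ∑ i, ‖U i x‖ₑ ^ 2) atTop :=
        liminf_le_liminf (.of_forall fun k =>
          (slice_sobolev_smooth hC (hw k) (hws k) i).trans (mul_le_mul_right (hle k) _))
    _ = _ := liminf_const _

end Sobolev

/-! ### Optimal cutoff functions -/

section OptimalCutoff

open Filter Function Metric
open scoped Topology ContDiff NNReal

/-- For a weight `w` on an interval there is a probability density `h` on that interval for which
`∫ h² w` is controlled by the `Lᵟ` average of `w`, for any `δ > 0`: concentrate `h` on the set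
where `wᵟ` is at most twice its average. The error `ε` is the price of a smooth `h`. -/
theorem exists_density_of_weight {w : ℝ → ℝ≥0∞} (hw : Measurable w) (hfin : ∫⁻ r, w r ≠ ⊤)
    {a b δ : ℝ} (hab : a < b) (hb : b - a ≤ 1) (hδ : 0 < δ) {ε : ℝ≥0∞} (hε : ε ≠ 0) :
    ∃ h : ℝ → ℝ, ContDiff ℝ ∞ h ∧ HasCompactSupport h ∧ support h ⊆ Ioo a b ∧ (∀ r, 0 ≤ h r) ∧
      ∫ r, h r = 1 ∧ ∫⁻ r, ENNReal.ofReal (h r ^ 2) * w r ≤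
        ENNReal.ofReal (16 / (b - a) ^ 2) *
          ((ENNReal.ofReal (2 / (b - a)) * ∫⁻ r, w r ^ δ) ^ (1 / δ) + ε) := by
  have hba : 0 < b - a := by linarith
  set T : ℝ≥0∞ := ENNReal.ofReal (2 / (b - a)) * ∫⁻ r, w r ^ δ with hT
  have hwδ : Measurable fun r => w r ^ δ := hw.pow_const δ
  -- by Chebyshev's inequality, the bad set `S` fills at most half of the interval
  set S : Set ℝ := {r | T < w r ^ δ} with hS
  have hSm : MeasurableSet S := measurableSet_lt measurable_const hwδ
  have hSle : volume S ≤ ENNReal.ofReal ((b - a) / 2) := by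
    rcases eq_or_ne (∫⁻ r, w r ^ δ) 0 with h0 | h0
    · have : ∀ᵐ r, w r ^ δ = 0 := (lintegral_eq_zero_iff hwδ).1 h0
      have h1 : volume S = 0 := by
        refine measure_mono_null (fun r hr => ?_) this
        exact (lt_of_le_of_lt zero_le hr).ne'
      rw [h1]; exact zero_le
    rcases eq_or_ne (∫⁻ r, w r ^ δ) ⊤ with h1 | h1
    · have : T = ⊤ := by
        rw [hT, h1, ENNReal.mul_top]
        simpa using hba
      simp [hS, this]
    have hc0 : ENNReal.ofReal (2 / (b - a)) ≠ 0 := by simpa using hba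
    have hT0 : T ≠ 0 := mul_ne_zero hc0 h0
    have hTt : T ≠ ⊤ := ENNReal.mul_ne_top ENNReal.ofReal_ne_top h1
    calc volume S ≤ volume {r | T ≤ w r ^ δ} := measure_mono fun r (hr : T < w r ^ δ) => hr.le
      _ ≤ (∫⁻ r, w r ^ δ) / T := meas_ge_le_lintegral_div hwδ.aemeasurable hT0 hTt
      _ = (ENNReal.ofReal (2 / (b - a)))⁻¹ := by
          rw [hT, div_eq_mul_inv, ENNReal.mul_inv (Or.inl hc0) (Or.inl ENNReal.ofReal_ne_top),
            mul_comm, mul_assoc, ENNReal.inv_mul_cancel h0 h1, mul_one]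
      _ = ENNReal.ofReal ((b - a) / 2) := by
          rw [← ENNReal.ofReal_inv_of_pos (by positivity), inv_div]
  have hEbig : ENNReal.ofReal ((b - a) / 4) < volume (Ioo a b \ S) := by
    have h1 : ENNReal.ofReal (b - a) ≤ volume (Ioo a b \ S) + ENNReal.ofReal ((b - a) / 2) := by
      rw [← Real.volume_Ioo]
      calc volume (Ioo a b) ≤ volume ((Ioo a b \ S) ∪ S) := measure_mono (by
              intro x hx; by_cases hxS : x ∈ S
              · exact Or.inr hxS
              · exact Or.inl ⟨hx, hxS⟩)
        _ ≤ _ := (measure_union_le _ _).trans (by gcongr)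
    by_contra! hcon
    have h2 := h1.trans (add_le_add_left hcon _)
    rw [← ENNReal.ofReal_add (by linarith) (by linarith),
      ENNReal.ofReal_le_ofReal_iff (by linarith)] at h2
    linarith
  obtain ⟨K, hKE, hK, hKbig⟩ := (measurableSet_Ioo.diff hSm).exists_lt_isCompact hEbig
  set ν : Measure ℝ := volume.withDensity w with hν
  have : IsFiniteMeasure ν := isFiniteMeasure_withDensity hfin
  have hνK : ν K ≤ T ^ (1 / δ) := by
    rw [hν, withDensity_apply _ hK.measurableSet]
    calc ∫⁻ r in K, w r ≤ ∫⁻ _ in K, T ^ (1 / δ) := by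
          refine setLIntegral_mono measurable_const fun r hr => ?_
          have h1 : w r ^ δ ≤ T := not_lt.1 (hKE hr).2
          have h2 := ENNReal.rpow_le_rpow h1 (z := 1 / δ) (by positivity)
          rwa [← ENNReal.rpow_mul, mul_one_div_cancel hδ.ne', ENNReal.rpow_one] at h2
      _ = T ^ (1 / δ) * volume K := by rw [setLIntegral_const]
      _ ≤ T ^ (1 / δ) * 1 := by
          gcongr
          calc volume K ≤ volume (Ioo a b) := measure_mono (hKE.trans sdiff_subset)
            _ ≤ 1 := by rw [Real.volume_Ioo]; exact ENNReal.ofReal_le_one.2 hb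
      _ = _ := mul_one _
  -- smoothing the indicator function of `K` costs an arbitrarily small amount of `w`-measure
  obtain ⟨V, hKV, hV, hνV⟩ := K.exists_isOpen_lt_add (μ := ν) (measure_ne_top ν K) hε
  obtain ⟨h₀, hs, hc, ht, h1, h01⟩ := exists_smooth_cutoff hK (hV.inter isOpen_Ioo)
    (subset_inter hKV (hKE.trans sdiff_subset))
  have hint : Integrable h₀ := hs.continuous.integrable_of_hasCompactSupport hc
  have hKone : ∀ r ∈ K, h₀ r = 1 := fun r hr => h1.self_of_nhdsSet r hr
  have hI : (b - a) / 4 ≤ ∫ r, h₀ r := by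
    have h2 : volume.real K ≤ ∫ r, h₀ r := by
      calc volume.real K = ∫ r in K, h₀ r := by
            rw [setIntegral_congr_fun hK.measurableSet (g := fun _ => (1:ℝ)) hKone]; simp
        _ ≤ ∫ r, h₀ r := setIntegral_le_integral hint (.of_forall fun r => (h01 r).1)
    refine le_trans ?_ h2
    have := ENNReal.toReal_mono hK.measure_ne_top hKbig.le
    rwa [ENNReal.toReal_ofReal (by linarith)] at this
  set I := ∫ r, h₀ r with hIdef
  have hIpos : 0 < I := by linarith
  refine ⟨fun r => h₀ r / I, hs.div_const _, ?_, ?_, fun r => div_nonneg (h01 r).1 hIpos.le, ?_, ?_⟩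
  · simp only [div_eq_mul_inv]; exact hc.mul_right
  · intro r hr
    refine (ht (subset_tsupport _ fun h0 => hr ?_)).2
    simp [h0]
  · rw [integral_div, ← hIdef, div_self hIpos.ne']
  · calc ∫⁻ r, ENNReal.ofReal ((h₀ r / I) ^ 2) * w r
        ≤ ∫⁻ r, ENNReal.ofReal (16 / (b - a) ^ 2) * V.indicator w r := by
          refine lintegral_mono fun r => ?_
          by_cases hr : r ∈ V
          · simp only [indicator_of_mem hr]
            refine mul_le_mul_left (ENNReal.ofReal_le_ofReal ?_) _
            have h4 : h₀ r / I ≤ 1 / ((b - a) / 4) :=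
              div_le_div₀ zero_le_one (h01 r).2 (by linarith) hI
            calc (h₀ r / I) ^ 2 ≤ (1 / ((b - a) / 4)) ^ 2 :=
                  pow_le_pow_left₀ (div_nonneg (h01 r).1 hIpos.le) h4 2
              _ = 16 / (b - a) ^ 2 := by field_simp; norm_num
          · have : h₀ r = 0 := by
              by_contra h0
              exact hr (ht (subset_tsupport _ h0)).1
            simp [this]
      _ = ENNReal.ofReal (16 / (b - a) ^ 2) * ν V := by
          rw [lintegral_const_mul' _ _ ENNReal.ofReal_ne_top,
            lintegral_indicator hV.measurableSet, hν, withDensity_apply _ hV.measurableSet]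
      _ ≤ _ := by
          gcongr
          exact hνV.le.trans (by gcongr)

/-- An even profile which is `1` on `[-a, a]`, vanishes outside `(-b, b)`, and has derivative
`±h(|r|)`. -/
theorem exists_profile_of_density {h : ℝ → ℝ} {a b : ℝ} (ha : 0 < a) (hh : ContDiff ℝ ∞ h)
    (hc : HasCompactSupport h) (hs : support h ⊆ Ioo a b) (h0 : ∀ r, 0 ≤ h r)
    (h1 : ∫ r, h r = 1) :
    ∃ η : ℝ → ℝ, ContDiff ℝ ∞ η ∧ (∀ r, η r ∈ Icc (0 : ℝ) 1) ∧ (∀ r, |r| ≤ a → η r = 1) ∧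
      (∀ r, b ≤ |r| → η r = 0) ∧ ∀ r, |deriv η r| ≤ h |r| := by
  have hz : ∀ r, r ≤ a → h r = 0 := fun r hr => by
    by_contra hn; exact absurd (hs hn).1 (not_lt.2 hr)
  have hz' : ∀ r, b ≤ r → h r = 0 := fun r hr => by
    by_contra hn; exact absurd (hs hn).2 (not_lt.2 hr)
  have hcont := hh.continuous
  have hint : Integrable h := hcont.integrable_of_hasCompactSupport hc
  set P : ℝ → ℝ := fun r => ∫ s in (0:ℝ)..r, h s with hP
  have hPd : ∀ r, HasDerivAt P (h r) r := fun r =>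
    intervalIntegral.integral_hasDerivAt_right (hcont.intervalIntegrable _ _)
      (hcont.stronglyMeasurableAtFilter _ _) hcont.continuousAt
  have hPs : ContDiff ℝ ∞ P := by
    rw [contDiff_infty_iff_deriv]
    refine ⟨fun r => (hPd r).differentiableAt, ?_⟩
    rwa [show deriv P = h from funext fun r => (hPd r).deriv]
  have hPz : ∀ r, r ≤ a → P r = 0 := by
    intro r hr
    refine (intervalIntegral.integral_congr (g := fun _ => (0:ℝ)) fun s hs' => ?_).trans (by simp)
    refine hz s ?_
    have := hs'.2
    exact this.trans (max_le ha.le hr)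
  have hPmono : Monotone P := monotone_of_deriv_nonneg
    (fun r => (hPd r).differentiableAt) fun r => by rw [(hPd r).deriv]; exact h0 r
  have hP0 : ∀ r, 0 ≤ P r := fun r => by
    rcases le_total r a with hr | hr
    · rw [hPz r hr]
    · rw [← hPz a le_rfl]; exact hPmono hr
  have hPb : ∀ r, b ≤ r → a ≤ r → P r = 1 := by
    intro r hr har
    rw [hP]
    simp only
    rw [← h1, intervalIntegral.integral_of_le (ha.le.trans har),
      setIntegral_eq_integral_of_forall_compl_eq_zero]
    intro s hs'
    by_cases h : s ≤ a
    · exact hz s h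
    · refine hz' s ?_
      by_contra! hsb
      exact hs' ⟨ha.trans (not_le.1 h), (hsb.trans_le hr).le⟩
  have hP1 : ∀ r, P r ≤ 1 := fun r => by
    rw [← hPb (max r (max a b)) ((le_max_right _ _).trans (le_max_right _ _))
      ((le_max_left _ _).trans (le_max_right _ _))]
    exact hPmono (le_max_left _ _)
  have hηd : ∀ r, HasDerivAt (fun r => (1 - P r) * (1 - P (-r)))
      (-h r * (1 - P (-r)) + (1 - P r) * h (-r)) r := by
    intro r
    have e1 := (hPd r).const_sub 1
    have e2 : HasDerivAt (fun r => 1 - P (-r)) (h (-r)) r := by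
      have := ((hPd (-r)).comp r (hasDerivAt_neg r)).const_sub 1
      simpa using this
    exact e1.mul e2
  refine ⟨fun r => (1 - P r) * (1 - P (-r)), ?_, ?_, ?_, ?_, ?_⟩
  · exact (contDiff_const.sub hPs).mul (contDiff_const.sub (hPs.comp contDiff_neg))
  · intro r
    have := hP0 r; have := hP1 r; have := hP0 (-r); have := hP1 (-r)
    exact ⟨mul_nonneg (by linarith) (by linarith), mul_le_one₀ (by linarith) (by linarith)
      (by linarith)⟩
  · intro r hr
    simp [hPz r ((le_abs_self r).trans hr), hPz (-r) ((neg_le_abs r).trans hr)]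
  · intro r hr
    have hab : a ≤ b := by
      by_contra! hlt
      have : h = 0 := by
        ext s
        by_contra hn
        exact absurd ((hs hn).1.trans (hs hn).2) (not_lt.2 hlt.le)
      rw [this] at h1
      simp at h1
    rcases abs_cases r with ⟨h', _⟩ | ⟨h', _⟩
    · simp [hPb r (h' ▸ hr) (hab.trans (h' ▸ hr))]
    · simp [hPb (-r) (h' ▸ hr) (hab.trans (h' ▸ hr))]
  · intro r
    rw [(hηd r).deriv]
    rcases abs_cases r with ⟨h', hr⟩ | ⟨h', hr⟩
    · rw [h', hz (-r) (by linarith), hPz (-r) (by linarith)]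
      simp [abs_of_nonneg (h0 r)]
    · rw [h', hz r (by linarith), hPz r (by linarith)]
      simp [abs_of_nonneg (h0 (-r))]

theorem norm_lt_of_forall_abs_lt {d : ℕ} {x : Fin d → ℝ} {b : ℝ} (hb : 0 < b)
    (h : ∀ i, |x i| < b) : ‖x‖ < b :=
  (pi_norm_lt_iff hb).2 h

theorem partialDeriv_prod_profile {d : ℕ} {η : ℝ → ℝ} (hη : ContDiff ℝ ∞ η) (x : Fin d → ℝ)
    (i : Fin d) :
    partialDeriv i (fun x : Fin d → ℝ => ∏ j, η (x j)) x
      = (∏ j ∈ Finset.univ.erase i, η (x j)) * deriv η (x i) := by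
  have hj : ∀ j : Fin d, HasFDerivAt (fun x : Fin d → ℝ => η (x j))
      (deriv η (x j) • (ContinuousLinearMap.proj j : (Fin d → ℝ) →L[ℝ] ℝ)) x := fun j =>
    (hη.differentiable (by simp) (x j)).hasDerivAt.comp_hasFDerivAt x (hasFDerivAt_apply j x)
  have h := HasFDerivAt.finsetProd (u := Finset.univ) (fun j _ => hj j)
  unfold partialDeriv
  rw [h.fderiv, _root_.sum_apply, Finset.sum_eq_single i]
  · simp
  · intro j _ hji
    simp [hji]
  · simp

theorem lintegral_abs_mul_le {h : ℝ → ℝ} (hc : Continuous h) {w : ℝ → ℝ≥0∞} (hw : Measurable w) :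
    ∫⁻ r, ENNReal.ofReal (h |r| ^ 2) * w r
      ≤ ∫⁻ r, ENNReal.ofReal (h r ^ 2) * (w r + w (-r)) := by
  have hm : Measurable fun r => ENNReal.ofReal (h r ^ 2) := by fun_prop
  calc ∫⁻ r, ENNReal.ofReal (h |r| ^ 2) * w r
      ≤ ∫⁻ r, (ENNReal.ofReal (h r ^ 2) * w r + ENNReal.ofReal (h (-r) ^ 2) * w r) := by
        refine lintegral_mono fun r => ?_
        rcases abs_choice r with h' | h' <;> rw [h']
        · exact le_self_add
        · exact le_add_self
    _ = (∫⁻ r, ENNReal.ofReal (h r ^ 2) * w r) + ∫⁻ r, ENNReal.ofReal (h (-r) ^ 2) * w r :=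
        lintegral_add_left (hm.fun_mul hw) _
    _ = (∫⁻ r, ENNReal.ofReal (h r ^ 2) * w r) + ∫⁻ r, ENNReal.ofReal (h r ^ 2) * w (-r) := by
        congr 1
        rw [← lintegral_neg_eq_self]
        simp
    _ = _ := by
        rw [← lintegral_add_left (hm.fun_mul hw)]
        simp only [mul_add]

theorem ennreal_sum_rpow_le {ι : Type*} (s : Finset ι) (f : ι → ℝ≥0∞) {δ : ℝ} (hδ : 0 < δ)
    (hδ1 : δ ≤ 1) : (∑ i ∈ s, f i) ^ δ ≤ ∑ i ∈ s, f i ^ δ :=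
  Finset.le_sum_of_subadditive (fun x : ℝ≥0∞ => x ^ δ) (ENNReal.zero_rpow_of_pos hδ).le
    (fun x y => ENNReal.rpow_add_le_add_rpow x y hδ.le hδ1) s f

/-- A cutoff function between two concentric cubes adapted to a weight `g`: the energy
`∫ |∇η|² g` is controlled by the `δ`-th moments of the integrals of `g` over the hyperplanes
`{x i = r}`. -/
theorem exists_adapted_cutoff {m : ℕ} {g : (Fin (m + 1) → ℝ) → ℝ≥0∞} (hg : Measurable g)
    (hfin : ∫⁻ x, g x ≠ ⊤) {a b δ : ℝ} (ha : 0 < a) (hab : a < b) (hb : b - a ≤ 1) (hδ : 0 < δ)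
    (hδ1 : δ ≤ 1) {ε : ℝ≥0∞} (hε : ε ≠ 0) :
    ∃ η : (Fin (m + 1) → ℝ) → ℝ, ContDiff ℝ ∞ η ∧ (∀ x, η x ∈ Icc (0 : ℝ) 1) ∧
      (∀ x, ‖x‖ ≤ a → η x = 1) ∧ (∀ x, b ≤ ‖x‖ → η x = 0) ∧
      (∀ x, b ≤ ‖x‖ → ∀ i, partialDeriv i η x = 0) ∧
      ∑ i, ∫⁻ x, ENNReal.ofReal (partialDeriv i η x ^ 2) * g x ≤
        ENNReal.ofReal (16 / (b - a) ^ 2) * ((ENNReal.ofReal (2 / (b - a)) *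
          (2 * ∑ i : Fin (m + 1), ∫⁻ r : ℝ, (∫⁻ y, g (i.insertNth r y)) ^ δ)) ^ (1 / δ) + ε) := by
  have hb0 : 0 < b := ha.trans hab
  -- one density is chosen for all coordinates and both signs, adapted to the sum `W` of the weights
  set w : Fin (m + 1) → ℝ → ℝ≥0∞ := fun i r => ∫⁻ y, g (i.insertNth r y) with hw
  have hins : ∀ i : Fin (m + 1), Measurable fun p : ℝ × (Fin m → ℝ) =>
      (i.insertNth p.1 p.2 : Fin (m + 1) → ℝ) := fun i =>
    (continuous_fst.finInsertNth i continuous_snd).measurable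
  have hwm : ∀ i, Measurable (w i) := fun i =>
    Measurable.lintegral_prod_right' (f := fun p : ℝ × (Fin m → ℝ) => g (i.insertNth p.1 p.2))
      (hg.comp (hins i))
  have hwm' : ∀ i, Measurable fun r => w i (-r) := fun i => (hwm i).comp measurable_neg
  have hwint : ∀ i, ∫⁻ r, w i r = ∫⁻ x, g x := fun i =>
    (lintegral_eq_lintegral_insertNth i hg).symm
  have hneg : ∀ f : ℝ → ℝ≥0∞, ∫⁻ r, f (-r) = ∫⁻ r, f r := fun f => lintegral_neg_eq_self f
  set W : ℝ → ℝ≥0∞ := fun r => ∑ i, (w i r + w i (-r)) with hW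
  have hWm : Measurable W := Finset.measurable_sum _ fun i _ => (hwm i).add (hwm' i)
  have hWfin : ∫⁻ r, W r ≠ ⊤ := by
    simp only [hW]
    rw [lintegral_finsetSum _ fun i _ => (hwm i).fun_add (hwm' i)]
    refine ENNReal.sum_ne_top.2 fun i _ => ?_
    rw [lintegral_add_left (hwm i), hneg (w i), hwint]
    exact ENNReal.add_ne_top.2 ⟨hfin, hfin⟩
  obtain ⟨h, hh, hhc, hhs, hh0, hh1, hle⟩ := exists_density_of_weight hWm hWfin hab hb hδ hε
  obtain ⟨η, hη, h01, hηa, hηb, hηd⟩ := exists_profile_of_density ha hh hhc hhs hh0 hh1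
  have hprod : ∀ x : Fin (m + 1) → ℝ, b ≤ ‖x‖ → ∃ j, b ≤ |x j| := by
    intro x hx
    by_contra! hcon
    exact absurd (norm_lt_of_forall_abs_lt hb0 hcon) (not_lt.2 hx)
  have hp01 : ∀ (s : Finset (Fin (m + 1))) (x : Fin (m + 1) → ℝ),
      ∏ j ∈ s, η (x j) ∈ Icc (0:ℝ) 1 := fun s x =>
    ⟨Finset.prod_nonneg fun j _ => (h01 _).1, Finset.prod_le_one (fun j _ => (h01 _).1)
      fun j _ => (h01 _).2⟩
  refine ⟨fun x => ∏ j, η (x j), ?_, fun x => hp01 _ x, ?_, ?_, ?_, ?_⟩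
  · exact contDiff_prod fun j _ => hη.comp (contDiff_apply ℝ ℝ j)
  · intro x hx
    exact Finset.prod_eq_one fun j _ => hηa _ ((norm_le_pi_norm x j).trans hx)
  · intro x hx
    obtain ⟨j, hj⟩ := hprod x hx
    exact Finset.prod_eq_zero (Finset.mem_univ j) (hηb _ hj)
  · intro x hx i
    obtain ⟨j, hj⟩ := hprod x hx
    rw [partialDeriv_prod_profile hη]
    by_cases hji : j = i
    · subst hji
      have h1 := hηd (x j)
      have h2 : h |x j| = 0 := by
        by_contra hn
        exact absurd (hhs hn).2 (not_lt.2 hj)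
      rw [h2] at h1
      rw [abs_nonpos_iff.1 h1, mul_zero]
    · rw [Finset.prod_eq_zero (Finset.mem_erase.2 ⟨hji, Finset.mem_univ j⟩) (hηb _ hj), zero_mul]
  · calc ∑ i, ∫⁻ x, ENNReal.ofReal (partialDeriv i (fun x => ∏ j, η (x j)) x ^ 2) * g x
        ≤ ∑ i : Fin (m + 1), ∫⁻ x, ENNReal.ofReal (h |x i| ^ 2) * g x := by
          refine Finset.sum_le_sum fun i _ => lintegral_mono fun x => ?_
          refine mul_le_mul_left (ENNReal.ofReal_le_ofReal ?_) _
          rw [partialDeriv_prod_profile hη, mul_pow, ← sq_abs (deriv η (x i))]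
          have h1 := pow_le_pow_left₀ (abs_nonneg _) (hηd (x i)) 2
          have h2 := hp01 (Finset.univ.erase i) x
          have h3 : (∏ j ∈ Finset.univ.erase i, η (x j)) ^ 2 ≤ 1 := pow_le_one₀ h2.1 h2.2
          nlinarith [sq_nonneg |deriv η (x i)|]
      _ = ∑ i : Fin (m + 1), ∫⁻ r, ENNReal.ofReal (h |r| ^ 2) * w i r := by
          refine Finset.sum_congr rfl fun i _ => ?_
          have hcm : Measurable fun r : ℝ => ENNReal.ofReal (h |r| ^ 2) := by
            have := hh.continuous
            fun_prop
          rw [lintegral_eq_lintegral_insertNth i ((hcm.fun_comp (measurable_pi_apply i)).fun_mul hg)]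
          refine lintegral_congr fun r => ?_
          simp only [Fin.insertNth_apply_same]
          rw [lintegral_const_mul' _ _ ENNReal.ofReal_ne_top]
      _ ≤ ∑ i : Fin (m + 1), ∫⁻ r, ENNReal.ofReal (h r ^ 2) * (w i r + w i (-r)) :=
          Finset.sum_le_sum fun i _ => lintegral_abs_mul_le hh.continuous (hwm i)
      _ = ∫⁻ r, ENNReal.ofReal (h r ^ 2) * W r := by
          rw [← lintegral_finsetSum]
          · simp only [hW, Finset.mul_sum]
          · intro i _
            have : Measurable fun r => ENNReal.ofReal (h r ^ 2) := by
              have := hh.continuous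
              fun_prop
            exact this.mul ((hwm i).add (hwm' i))
      _ ≤ _ := hle
      _ ≤ _ := by
          gcongr
          calc ∫⁻ r, W r ^ δ ≤ ∫⁻ r, ∑ i, (w i r ^ δ + w i (-r) ^ δ) := by
                refine lintegral_mono fun r => (ennreal_sum_rpow_le _ _ hδ hδ1).trans ?_
                exact Finset.sum_le_sum fun i _ => ENNReal.rpow_add_le_add_rpow _ _ hδ.le hδ1
            _ = ∑ i, ((∫⁻ r, w i r ^ δ) + ∫⁻ r, w i (-r) ^ δ) := by
                rw [lintegral_finsetSum _ fun i _ =>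
                  ((hwm i).pow_const δ).fun_add ((hwm' i).pow_const δ)]
                refine Finset.sum_congr rfl fun i _ => ?_
                rw [lintegral_add_left ((hwm i).pow_const δ)]
            _ = 2 * ∑ i, ∫⁻ r, w i r ^ δ := by
                rw [Finset.mul_sum]
                refine Finset.sum_congr rfl fun i _ => ?_
                rw [hneg fun r => w i r ^ δ, two_mul]

end OptimalCutoff

/-! ### The Caccioppoli inequality on the unit cube -/

section CaccioppoliInequality

open Filter Function Metric
open scoped Topology ContDiff NNReal

theorem enorm_sq_eq_ofReal (t : ℝ) : ‖t‖ₑ ^ 2 = ENNReal.ofReal (t ^ 2) := by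
  rw [← ofReal_norm, ← ENNReal.ofReal_pow (norm_nonneg _), Real.norm_eq_abs, sq_abs]

/-- The cutoff function of `exists_adapted_cutoff`, with an estimate free of error terms: take the
main term for `ε`, unless it vanishes, in which case `g = 0` almost everywhere. -/
theorem exists_adapted_cutoff' {m : ℕ} {g : (Fin (m + 1) → ℝ) → ℝ≥0∞} (hg : Measurable g)
    (hfin : ∫⁻ x, g x ≠ ⊤) {a b δ : ℝ} (ha : 0 < a) (hab : a < b) (hb : b - a ≤ 1) (hδ : 0 < δ)
    (hδ1 : δ ≤ 1) :
    ∃ η : (Fin (m + 1) → ℝ) → ℝ, ContDiff ℝ ∞ η ∧ (∀ x, η x ∈ Icc (0 : ℝ) 1) ∧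
      (∀ x, ‖x‖ ≤ a → η x = 1) ∧ (∀ x, b ≤ ‖x‖ → η x = 0) ∧
      (∀ x, b ≤ ‖x‖ → ∀ i, partialDeriv i η x = 0) ∧
      ∫⁻ x, g x * ∑ i, ‖partialDeriv i η x‖ₑ ^ 2 ≤
        ENNReal.ofReal (32 / (b - a) ^ 2) * (ENNReal.ofReal (4 / (b - a)) *
          ∑ i : Fin (m + 1), ∫⁻ r : ℝ, (∫⁻ y, g (i.insertNth r y)) ^ δ) ^ (1 / δ) := by
  have hba : 0 < b - a := by linarith
  set S := (ENNReal.ofReal (4 / (b - a)) *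
          ∑ i : Fin (m + 1), ∫⁻ r : ℝ, (∫⁻ y, g (i.insertNth r y)) ^ δ) ^ (1 / δ) with hS
  have hS' : S = (ENNReal.ofReal (2 / (b - a)) * (2 *
          ∑ i : Fin (m + 1), ∫⁻ r : ℝ, (∫⁻ y, g (i.insertNth r y)) ^ δ)) ^ (1 / δ) := by
    rw [hS, ← mul_assoc, show (2 : ℝ≥0∞) = ENNReal.ofReal 2 by simp,
      ← ENNReal.ofReal_mul (by positivity)]
    congr 4
    ring
  have hsum : ∀ η : (Fin (m + 1) → ℝ) → ℝ, ContDiff ℝ ∞ η →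
      ∫⁻ x, g x * ∑ i, ‖partialDeriv i η x‖ₑ ^ 2
        = ∑ i, ∫⁻ x, ENNReal.ofReal (partialDeriv i η x ^ 2) * g x := by
    intro η hη
    rw [← lintegral_finsetSum]
    · refine lintegral_congr fun x => ?_
      rw [Finset.mul_sum]
      refine Finset.sum_congr rfl fun i _ => ?_
      rw [enorm_sq_eq_ofReal, mul_comm]
    · intro i _
      have := continuous_fderiv_dir hη (Pi.single i 1)
      exact (this.measurable.pow_const 2).ennreal_ofReal.fun_mul hg
  rcases eq_or_ne S 0 with h0 | h0
  · obtain ⟨η, hη, h01, h1, h2, h3, -⟩ :=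
      exists_adapted_cutoff hg hfin ha hab hb hδ hδ1 (ε := 1) one_ne_zero
    refine ⟨η, hη, h01, h1, h2, h3, ?_⟩
    have hg0 : ∫⁻ x, g x = 0 := by
      rw [hS, ENNReal.rpow_eq_zero_iff_of_pos (by positivity), mul_eq_zero] at h0
      have h4 := h0.resolve_left (by simpa using hba)
      have h5 := (Finset.sum_eq_zero_iff.1 h4) 0 (Finset.mem_univ _)
      have hins : Measurable fun p : ℝ × (Fin m → ℝ) =>
          ((0 : Fin (m + 1)).insertNth p.1 p.2 : Fin (m + 1) → ℝ) :=
        (continuous_fst.finInsertNth 0 continuous_snd).measurable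
      have hwm : Measurable fun r : ℝ => ∫⁻ y : Fin m → ℝ, g ((0 : Fin (m + 1)).insertNth r y) :=
        Measurable.lintegral_prod_right'
          (f := fun p : ℝ × (Fin m → ℝ) => g ((0 : Fin (m + 1)).insertNth p.1 p.2)) (hg.comp hins)
      rw [lintegral_eq_zero_iff (hwm.pow_const δ)] at h5
      rw [lintegral_eq_lintegral_insertNth 0 hg, lintegral_eq_zero_iff hwm]
      filter_upwards [h5] with r hr
      exact (ENNReal.rpow_eq_zero_iff_of_pos hδ).1 hr
    have hg0' := (lintegral_eq_zero_iff hg).1 hg0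
    refine le_of_eq_of_le ?_ zero_le
    rw [← lintegral_zero (μ := (volume : Measure (Fin (m + 1) → ℝ)))]
    refine lintegral_congr_ae ?_
    filter_upwards [hg0'] with x hx
    simp [hx]
  · obtain ⟨η, hη, h01, h1, h2, h3, h4⟩ :=
      exists_adapted_cutoff hg hfin ha hab hb hδ hδ1 (ε := S) h0
    refine ⟨η, hη, h01, h1, h2, h3, ?_⟩
    rw [hsum η hη]
    refine h4.trans (le_of_eq ?_)
    rw [← hS', ← two_mul, ← mul_assoc, show (2 : ℝ≥0∞) = ENNReal.ofReal 2 by simp,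
      ← ENNReal.ofReal_mul (by positivity)]
    congr 2
    ring

/-- The density `|∇(v - k)₊|²`, where `G` is the weak gradient of `v`. -/
noncomputable def truncGradSq {d : ℕ} (v : (Fin d → ℝ) → ℝ) (G : Fin d → (Fin d → ℝ) → ℝ) (k : ℝ)
    (x : Fin d → ℝ) : ℝ≥0∞ :=
  {x | k < v x}.indicator (fun x => ∑ i, ‖G i x‖ₑ ^ 2) x

/-- The energy of the truncation `(v - k)₊` on the cube of half-side `ρ`: the `L²` norm of the
gradient plus the `Lᵖ` norm, both squared. -/
noncomputable def truncEnergy {d : ℕ} (p : ℝ) (v : (Fin d → ℝ) → ℝ) (G : Fin d → (Fin d → ℝ) → ℝ)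
    (k ρ : ℝ) : ℝ≥0∞ :=
  (∫⁻ x in ball 0 ρ, truncGradSq v G k x) +
    (∫⁻ x in ball 0 ρ, ‖max (v x - k) 0‖ₑ ^ p) ^ (2 / p)

/-- The hypotheses of the local boundedness estimate, transplanted to the unit cube and written
with Lebesgue integrals: the truncations `(v - k)₊`, `k ≥ k₀`, have the weak gradients
`1_{v > k} G` and satisfy a Caccioppoli inequality. -/
structure CaccioppoliOnCube {d : ℕ} (cm M₁ M₂ k₀ : ℝ) (v : (Fin d → ℝ) → ℝ)
    (G : Fin d → (Fin d → ℝ) → ℝ) (f : (Fin d → ℝ) → ℝ) : Prop where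
  continuous : Continuous v
  memLp : ∀ i, MemLp (G i) 2 volume
  weak : ∀ k, k₀ ≤ k → ∀ i, HasWeakDirDeriv volume (ball 0 1) (fun x => max (v x - k) 0)
    ({x | k < v x}.indicator (G i)) (Pi.single i 1)
  caccioppoli : ∀ k, k₀ ≤ k → ∀ η : (Fin d → ℝ) → ℝ, ContDiff ℝ ∞ η → HasCompactSupport η →
    tsupport η ⊆ ball 0 1 → (∀ x, 0 ≤ η x) →
    ∫⁻ x, ‖η x‖ₑ ^ 2 * truncGradSq v G k x ≤
      ENNReal.ofReal (cm ^ 2 * M₁ ^ 2) *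
        (∫⁻ x, ‖max (v x - k) 0‖ₑ ^ 2 * ∑ i, ‖partialDeriv i η x‖ₑ ^ 2) +
      ENNReal.ofReal (cm ^ 2 * M₂ ^ 2) * ∫⁻ x in {x | k < v x}, ‖η x‖ₑ ^ 2 * ‖f x‖ₑ ^ 2

theorem hasCompactSupport_of_norm_ge {d : ℕ} {η : (Fin d → ℝ) → ℝ} {b : ℝ}
    (h : ∀ x, b ≤ ‖x‖ → η x = 0) : tsupport η ⊆ closedBall 0 b ∧ HasCompactSupport η := by
  have hs : support η ⊆ closedBall 0 b := fun x hx => by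
    rw [mem_closedBall_zero_iff]
    by_contra! hlt
    exact hx (h x hlt.le)
  exact ⟨closure_minimal hs isClosed_closedBall,
    HasCompactSupport.of_support_subset_isCompact (isCompact_closedBall 0 b) hs⟩

namespace CaccioppoliOnCube

variable {d : ℕ} {cm M₁ M₂ k₀ : ℝ} {v : (Fin d → ℝ) → ℝ} {G : Fin d → (Fin d → ℝ) → ℝ}
  {f : (Fin d → ℝ) → ℝ}

theorem measurableSet_lt (h : CaccioppoliOnCube cm M₁ M₂ k₀ v G f) (k : ℝ) :
    MeasurableSet {x | k < v x} :=
  _root_.measurableSet_lt measurable_const h.continuous.measurable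

theorem continuous_trunc (h : CaccioppoliOnCube cm M₁ M₂ k₀ v G f) (k : ℝ) :
    Continuous fun x => max (v x - k) 0 :=
  (h.continuous.sub continuous_const).max continuous_const

/-- An upper bound for `∫ |∇(χ (v - k)₊)|²`, the energy of the product of a truncation with a
cutoff function `χ`. -/
noncomputable def cutoffEnergy (v : (Fin d → ℝ) → ℝ) (G : Fin d → (Fin d → ℝ) → ℝ) (k : ℝ)
    (χ : (Fin d → ℝ) → ℝ) : ℝ≥0∞ :=
  2 * (∫⁻ x, ‖χ x‖ₑ ^ 2 * truncGradSq v G k x) +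
    2 * ∫⁻ x, ‖max (v x - k) 0‖ₑ ^ 2 * ∑ i, ‖partialDeriv i χ x‖ₑ ^ 2

/-- The product `χ (v - k)₊` satisfies the hypotheses of the Sobolev inequalities `sobolev_weak` and
`slice_sobolev_weak`. -/
theorem exists_weak_deriv_cutoff (h : CaccioppoliOnCube cm M₁ M₂ k₀ v G f) {k : ℝ} (hk : k₀ ≤ k)
    {χ : (Fin d → ℝ) → ℝ} (hχ : ContDiff ℝ ∞ χ) {b : ℝ} (hb : b < 1)
    (hχb : ∀ x, b ≤ ‖x‖ → χ x = 0) :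
    ∃ U : Fin d → (Fin d → ℝ) → ℝ,
      Continuous (fun x => χ x * max (v x - k) 0) ∧
      support (fun x => χ x * max (v x - k) 0) ⊆ ball 0 1 ∧
      (∀ i, AEStronglyMeasurable (U i)) ∧
      (∀ i, HasWeakDirDeriv volume univ (fun x => χ x * max (v x - k) 0) (U i) (Pi.single i 1)) ∧
      ∫⁻ x, ∑ i, ‖U i x‖ₑ ^ 2 ≤ cutoffEnergy v G k χ := by
  obtain ⟨hts, hc⟩ := hasCompactSupport_of_norm_ge hχb
  have hts' : tsupport χ ⊆ ball 0 1 := hts.trans (closedBall_subset_ball hb)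
  have hu := h.continuous_trunc k
  have hGm : ∀ i, MemLp ({x | k < v x}.indicator (G i)) 2 volume := fun i =>
    (h.memLp i).indicator (h.measurableSet_lt k)
  refine ⟨fun i x => χ x * {x | k < v x}.indicator (G i) x
      + fderiv ℝ χ x (Pi.single i 1) * max (v x - k) 0, hχ.continuous.mul hu, ?_, ?_, ?_, ?_⟩
  · intro x hx
    exact hts' (subset_tsupport _ (left_ne_zero_of_mul hx))
  · intro i
    exact (hχ.continuous.aestronglyMeasurable.mul (hGm i).aestronglyMeasurable).add
      ((continuous_fderiv_dir hχ _).mul hu).aestronglyMeasurable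
  · intro i
    exact (h.weak k hk i).mul_cutoff (hu.locallyIntegrable.locallyIntegrableOn _)
      (((hGm i).locallyIntegrable (by norm_num)).locallyIntegrableOn _) hχ hc hts'
  · rw [cutoffEnergy, ← lintegral_const_mul' _ _ (by simp), ← lintegral_const_mul' _ _ (by simp),
      ← lintegral_add_right]
    · refine lintegral_mono fun x => ?_
      have hsq : ∀ a b : ℝ, ‖a + b‖ₑ ^ 2 ≤ 2 * ‖a‖ₑ ^ 2 + 2 * ‖b‖ₑ ^ 2 := by
        intro a b
        rw [enorm_sq_eq_ofReal, enorm_sq_eq_ofReal, enorm_sq_eq_ofReal,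
          show (2 : ℝ≥0∞) = ENNReal.ofReal 2 by simp, ← ENNReal.ofReal_mul (by norm_num),
          ← ENNReal.ofReal_mul (by norm_num), ← ENNReal.ofReal_add (by positivity) (by positivity)]
        exact ENNReal.ofReal_le_ofReal (by nlinarith [sq_nonneg (a - b)])
      refine (Finset.sum_le_sum fun i _ => hsq _ _).trans (le_of_eq ?_)
      rw [Finset.sum_add_distrib, ← Finset.mul_sum, ← Finset.mul_sum]
      congr 2
      · rw [truncGradSq]
        by_cases hx : x ∈ {x | k < v x}
        · simp only [indicator_of_mem hx, enorm_mul, mul_pow, Finset.mul_sum]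
        · simp only [indicator_of_notMem hx]
          simp
      · simp only [enorm_mul, mul_pow, Finset.mul_sum]
        exact Finset.sum_congr rfl fun i _ => mul_comm _ _
    · refine Measurable.const_mul ?_ _
      refine (hu.measurable.enorm.pow_const 2).fun_mul (Finset.measurable_fun_sum _ fun i _ => ?_)
      exact (continuous_fderiv_dir hχ _).measurable.enorm.pow_const 2

/-- The Caccioppoli inequality in terms of `truncEnergy`; the zeroth order part of the energy is
recovered from the gradient by the Sobolev inequality. -/
theorem truncEnergy_le (h : CaccioppoliOnCube cm M₁ M₂ k₀ v G f) (hM₁ : 1 ≤ M₁)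
    {p : ℝ} (hp : 0 < p) {C : ℝ≥0}
    (hC : ∀ w : (Fin d → ℝ) → ℝ, ContDiff ℝ 1 w → HasCompactSupport w →
      support w ⊆ ball 0 2 →
      (∫⁻ x, ‖w x‖ₑ ^ p) ^ (2 / p) ≤ C * ∫⁻ x, ∑ i, ‖partialDeriv i w x‖ₑ ^ 2)
    {l : ℝ} (hl : k₀ ≤ l) {η : (Fin d → ℝ) → ℝ} (hη : ContDiff ℝ ∞ η) {a b : ℝ} (hb : b < 1)
    (h01 : ∀ x, η x ∈ Icc (0 : ℝ) 1) (hηa : ∀ x, ‖x‖ ≤ a → η x = 1)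
    (hηb : ∀ x, b ≤ ‖x‖ → η x = 0) :
    truncEnergy p v G l a ≤ ENNReal.ofReal ((1 + 4 * C) * (1 + cm ^ 2)) *
      (ENNReal.ofReal (M₁ ^ 2) *
        (∫⁻ x, ‖max (v x - l) 0‖ₑ ^ 2 * ∑ i, ‖partialDeriv i η x‖ₑ ^ 2) +
      ENNReal.ofReal (M₂ ^ 2) * ∫⁻ x in ball 0 b ∩ {x | l < v x}, ‖f x‖ₑ ^ 2) := by
  obtain ⟨hts, hc⟩ := hasCompactSupport_of_norm_ge hηb
  obtain ⟨U, hu, hus, hU, hw, hUe⟩ := h.exists_weak_deriv_cutoff hl hη hb hηb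
  have hsob := (sobolev_weak hp hC hu hus hU hw).trans (mul_le_mul_right hUe _)
  have hcac := h.caccioppoli l hl η hη hc (hts.trans (closedBall_subset_ball hb))
    fun x => (h01 x).1
  set I₁ := ∫⁻ x, ‖η x‖ₑ ^ 2 * truncGradSq v G l x with hI₁
  set I₂ := ∫⁻ x, ‖max (v x - l) 0‖ₑ ^ 2 * ∑ i, ‖partialDeriv i η x‖ₑ ^ 2 with hI₂
  set I₃ := ∫⁻ x in ball 0 b ∩ {x | l < v x}, ‖f x‖ₑ ^ 2 with hI₃
  have hη1 : ∀ x, ‖η x‖ₑ ≤ 1 := fun x => by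
    rw [Real.enorm_eq_ofReal (h01 x).1]; exact ENNReal.ofReal_le_one.2 (h01 x).2
  have h3 : ∫⁻ x in {x | l < v x}, ‖η x‖ₑ ^ 2 * ‖f x‖ₑ ^ 2 ≤ I₃ := by
    rw [hI₃, inter_comm, ← lintegral_indicator (h.measurableSet_lt l),
      ← lintegral_indicator ((h.measurableSet_lt l).inter measurableSet_ball)]
    refine lintegral_mono fun x => ?_
    by_cases hx : l < v x
    · by_cases hxb : ‖x‖ < b
      · rw [indicator_of_mem (show x ∈ {x | l < v x} from hx), indicator_of_mem
          (show x ∈ {x | l < v x} ∩ ball 0 b from ⟨hx, mem_ball_zero_iff.2 hxb⟩)]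
        exact mul_le_of_le_one_left zero_le (pow_le_one₀ zero_le (hη1 x))
      · rw [indicator_of_mem (show x ∈ {x | l < v x} from hx), hηb x (not_lt.1 hxb)]
        simp
    · rw [indicator_of_notMem (show x ∉ {x | l < v x} from hx)]
      exact zero_le
  have h1 : ∫⁻ x in ball 0 a, truncGradSq v G l x ≤ I₁ := by
    rw [hI₁, ← lintegral_indicator measurableSet_ball]
    refine lintegral_mono fun x => ?_
    by_cases hx : x ∈ ball (0 : Fin d → ℝ) a
    · rw [indicator_of_mem hx, hηa x (mem_ball_zero_iff.1 hx).le]; simp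
    · rw [indicator_of_notMem hx]; exact zero_le
  have h2 : (∫⁻ x in ball 0 a, ‖max (v x - l) 0‖ₑ ^ p) ^ (2 / p) ≤ C * cutoffEnergy v G l η := by
    refine le_trans (ENNReal.rpow_le_rpow ?_ (by positivity)) hsob
    rw [← lintegral_indicator measurableSet_ball]
    refine lintegral_mono fun x => ?_
    by_cases hx : x ∈ ball (0 : Fin d → ℝ) a
    · rw [indicator_of_mem hx, hηa x (mem_ball_zero_iff.1 hx).le, one_mul]
    · rw [indicator_of_notMem hx]; exact zero_le
  have hI : I₁ ≤ ENNReal.ofReal (cm ^ 2) * (ENNReal.ofReal (M₁ ^ 2) * I₂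
      + ENNReal.ofReal (M₂ ^ 2) * I₃) := by
    refine hcac.trans ?_
    rw [ENNReal.ofReal_mul (by positivity), ENNReal.ofReal_mul (by positivity), mul_add,
      mul_assoc, mul_assoc]
    gcongr
  set B := ENNReal.ofReal (M₁ ^ 2) * I₂ + ENNReal.ofReal (M₂ ^ 2) * I₃ with hB
  have hI₂B : I₂ ≤ B := by
    refine le_trans ?_ le_self_add
    refine le_mul_of_one_le_left zero_le ?_
    rw [ENNReal.one_le_ofReal]
    nlinarith
  calc truncEnergy p v G l a ≤ I₁ + C * (2 * I₁ + 2 * I₂) := add_le_add h1 h2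
    _ ≤ ENNReal.ofReal (cm ^ 2) * B + C * (2 * (ENNReal.ofReal (cm ^ 2) * B) + 2 * B) := by
        gcongr
    _ = (ENNReal.ofReal (cm ^ 2) + C * (2 * ENNReal.ofReal (cm ^ 2) + 2)) * B := by ring
    _ ≤ _ := by
        gcongr
        rw [← ENNReal.ofReal_coe_nnreal (p := C), show (2 : ℝ≥0∞) = ENNReal.ofReal 2 by simp,
          ← ENNReal.ofReal_mul (by norm_num), ← ENNReal.ofReal_add (by positivity) (by positivity),
          ← ENNReal.ofReal_mul (by positivity), ← ENNReal.ofReal_add (by positivity) (by positivity)]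
        refine ENNReal.ofReal_le_ofReal ?_
        have := C.coe_nonneg
        nlinarith [sq_nonneg cm, mul_nonneg this (sq_nonneg cm)]

end CaccioppoliOnCube

end CaccioppoliInequality

/-! ### Decay of the energy between two cubes -/

section EnergyDecay

open Filter Function Metric
open scoped Topology ContDiff NNReal

theorem lintegral_sq_le_rpow {X : Type*} [MeasurableSpace X] (μ : Measure X) {f : X → ℝ≥0∞}
    (hf : AEMeasurable f μ) {p : ℝ} (hp : 2 < p) :
    ∫⁻ x, f x ^ 2 ∂μ ≤ (∫⁻ x, f x ^ p ∂μ) ^ (2 / p) * μ univ ^ (1 - 2 / p) := by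
  have hr : 1 < p / 2 := by linarith
  have hconj := Real.HolderConjugate.conjExponent hr
  have h := ENNReal.lintegral_mul_le_Lp_mul_Lq μ hconj (hf.pow_const 2)
    (aemeasurable_const (b := (1 : ℝ≥0∞)))
  simp only [Pi.mul_apply, mul_one, ENNReal.one_rpow, lintegral_const, one_mul] at h
  have e1 : 1 / (p / 2) = 2 / p := by field_simp
  have e2 : 1 / (p / 2).conjExponent = 1 - 2 / p := by
    have := hconj.inv_add_inv_eq_one
    rw [← one_div, ← one_div, e1] at this
    linarith
  rw [e1, e2] at h
  refine h.trans (le_of_eq ?_)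
  congr 3
  ext x
  rw [← ENNReal.rpow_natCast, ← ENNReal.rpow_mul]
  congr 1
  push_cast; ring

theorem lintegral_ball_ne_top {d : ℕ} {u : (Fin d → ℝ) → ℝ} (hu : Continuous u) {p : ℝ}
    (hp : 0 ≤ p) (ρ : ℝ) : ∫⁻ x in ball 0 ρ, ‖u x‖ₑ ^ p ≠ ⊤ := by
  obtain ⟨M, hM⟩ := (isCompact_closedBall (0 : Fin d → ℝ) ρ).exists_bound_of_continuousOn
    hu.continuousOn
  refine ne_top_of_le_ne_top ?_ (setLIntegral_mono (g := fun _ => ENNReal.ofReal M ^ p)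
    measurable_const fun x hx => ENNReal.rpow_le_rpow ?_ hp)
  · rw [setLIntegral_const]
    exact ENNReal.mul_ne_top (ENNReal.rpow_ne_top_of_nonneg hp ENNReal.ofReal_ne_top)
      measure_ball_lt_top.ne
  · rw [← ofReal_norm]
    exact ENNReal.ofReal_le_ofReal (hM x (ball_subset_closedBall hx))

namespace CaccioppoliOnCube

theorem truncEnergy_ne_top {d : ℕ} {cm M₁ M₂ k₀ : ℝ} {v : (Fin d → ℝ) → ℝ}
    {G : Fin d → (Fin d → ℝ) → ℝ} {f : (Fin d → ℝ) → ℝ}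
    (h : CaccioppoliOnCube cm M₁ M₂ k₀ v G f) {p : ℝ} (hp : 0 ≤ p) (k ρ : ℝ) :
    truncEnergy p v G k ρ ≠ ⊤ := by
  refine ENNReal.add_ne_top.2 ⟨?_, ?_⟩
  · refine ne_top_of_le_ne_top ?_ ((setLIntegral_le_lintegral _ _).trans
      (lintegral_mono fun x => indicator_le_self _ (fun x => ∑ i, ‖G i x‖ₑ ^ 2) x))
    rw [lintegral_finsetSum' _ fun i _ => ((h.memLp i).aestronglyMeasurable.enorm.pow_const 2)]
    refine ENNReal.sum_ne_top.2 fun i _ => ?_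
    have := lintegral_rpow_enorm_lt_top_of_eLpNorm_lt_top (by norm_num) (by norm_num)
      (h.memLp i).2
    simpa using this.ne
  · exact ENNReal.rpow_ne_top_of_nonneg (by positivity)
      (lintegral_ball_ne_top (h.continuous_trunc k) hp ρ)

/-- Enlarging the level decreases the energy. -/
theorem truncEnergy_anti {d : ℕ} {v : (Fin d → ℝ) → ℝ} {G : Fin d → (Fin d → ℝ) → ℝ} {p : ℝ}
    (hp : 0 ≤ p) {k l : ℝ} (hkl : k ≤ l) (ρ : ℝ) :
    truncEnergy p v G l ρ ≤ truncEnergy p v G k ρ := by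
  refine add_le_add (lintegral_mono fun x => ?_)
    (ENNReal.rpow_le_rpow (lintegral_mono fun x => ENNReal.rpow_le_rpow ?_ hp) (by positivity))
  · exact indicator_le_indicator_of_subset (fun y (hy : l < v y) => hkl.trans_lt hy)
      (fun _ => zero_le) x
  · rw [Real.enorm_eq_ofReal (le_max_right _ _), Real.enorm_eq_ofReal (le_max_right _ _)]
    exact ENNReal.ofReal_le_ofReal (max_le_max (by linarith) le_rfl)

/-- A cutoff function between cubes of half-sides `b < c` for which `χ (v - k)₊` has energy at most
`C (c - b)⁻³` times the energy of `(v - k)₊`. It comes from `exists_adapted_cutoff'` with `δ = 1`. -/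
theorem exists_cutoff_energy_const (m : ℕ) {p : ℝ} (hp : 2 < p) :
    ∃ C : ℝ, 0 < C ∧ ∀ {cm M₁ M₂ k₀ : ℝ} {v : (Fin (m + 1) → ℝ) → ℝ}
      {G : Fin (m + 1) → (Fin (m + 1) → ℝ) → ℝ} {f : (Fin (m + 1) → ℝ) → ℝ},
      CaccioppoliOnCube cm M₁ M₂ k₀ v G f → ∀ (k : ℝ) {b c : ℝ}, 0 < b → b < c → c ≤ 1 →
      ∃ χ : (Fin (m + 1) → ℝ) → ℝ, ContDiff ℝ ∞ χ ∧ (∀ x, χ x ∈ Icc (0 : ℝ) 1) ∧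
        (∀ x, ‖x‖ ≤ b → χ x = 1) ∧ (∀ x, c ≤ ‖x‖ → χ x = 0) ∧
        (∫⁻ x, ‖max (v x - k) 0‖ₑ ^ 2 * ∑ i, ‖partialDeriv i χ x‖ₑ ^ 2) ≤
          ENNReal.ofReal (C / (c - b) ^ 3) * ∫⁻ x in ball 0 c, ‖max (v x - k) 0‖ₑ ^ 2 ∧
        cutoffEnergy v G k χ ≤ ENNReal.ofReal (C / (c - b) ^ 3) * truncEnergy p v G k c := by
  set V := volume (ball (0 : Fin (m + 1) → ℝ) 1) ^ (1 - 2 / p) with hV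
  have hVt : V ≠ ⊤ := ENNReal.rpow_ne_top_of_nonneg
    (by have : 2 / p ≤ 1 := (div_le_one (by linarith)).2 hp.le
        linarith) measure_ball_lt_top.ne
  set C₁ : ℝ := 128 * (m + 1) with hC₁
  have hC₁0 : 0 < C₁ := by positivity
  refine ⟨C₁ + (2 + 2 * C₁ * V.toReal), by positivity, ?_⟩
  intro cm M₁ M₂ k₀ v G f h k b c hb hbc hc
  have hcb : 0 < c - b := by linarith
  have hu := h.continuous_trunc k
  have hum : Measurable fun x => ‖max (v x - k) 0‖ₑ ^ 2 := hu.measurable.enorm.pow_const 2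
  set I := ∫⁻ x in ball 0 c, ‖max (v x - k) 0‖ₑ ^ 2 with hI
  have hIV : I ≤ (∫⁻ x in ball 0 c, ‖max (v x - k) 0‖ₑ ^ p) ^ (2 / p) * V := by
    refine (lintegral_sq_le_rpow _ hu.measurable.enorm.aemeasurable hp).trans ?_
    gcongr
    rw [Measure.restrict_apply_univ]
    exact ENNReal.rpow_le_rpow (measure_mono (ball_subset_ball hc))
      (by have : 2 / p ≤ 1 := (div_le_one (by linarith)).2 hp.le
          linarith)
  set g : (Fin (m + 1) → ℝ) → ℝ≥0∞ := (ball 0 c).indicator fun x => ‖max (v x - k) 0‖ₑ ^ 2 with hg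
  have hgm : Measurable g := hum.indicator measurableSet_ball
  have hgI : ∫⁻ x, g x = I := lintegral_indicator measurableSet_ball _
  have hIt : I ≠ ⊤ := by
    have := lintegral_ball_ne_top hu (p := 2) (by norm_num) c
    simpa using this
  obtain ⟨χ, hχ, h01, h1, h0, hd0, hle⟩ := exists_adapted_cutoff' hgm (hgI ▸ hIt) hb hbc
    (by linarith) one_pos le_rfl
  have hle' : (∫⁻ x, ‖max (v x - k) 0‖ₑ ^ 2 * ∑ i, ‖partialDeriv i χ x‖ₑ ^ 2) ≤
      ENNReal.ofReal (C₁ / (c - b) ^ 3) * I := by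
    calc (∫⁻ x, ‖max (v x - k) 0‖ₑ ^ 2 * ∑ i, ‖partialDeriv i χ x‖ₑ ^ 2)
        = ∫⁻ x, g x * ∑ i, ‖partialDeriv i χ x‖ₑ ^ 2 := by
          refine lintegral_congr fun x => ?_
          by_cases hx : x ∈ ball (0 : Fin (m + 1) → ℝ) c
          · rw [hg, indicator_of_mem hx]
          · have := hd0 x (not_lt.1 fun hlt => hx (mem_ball_zero_iff.2 hlt))
            simp [this]
      _ ≤ _ := hle
      _ = _ := by
          simp only [ENNReal.rpow_one, div_one]
          simp only [← lintegral_eq_lintegral_insertNth _ hgm, hgI, Finset.sum_const,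
            Finset.card_univ, Fintype.card_fin, nsmul_eq_mul]
          rw [show ((m + 1 : ℕ) : ℝ≥0∞) = ENNReal.ofReal (m + 1) by
            rw [← Nat.cast_succ, ENNReal.ofReal_natCast], ← mul_assoc, ← mul_assoc,
            ← ENNReal.ofReal_mul (by positivity), ← ENNReal.ofReal_mul (by positivity)]
          congr 2
          rw [hC₁]
          field_simp
          norm_num
  have hle3 : 1 ≤ 1 / (c - b) ^ 3 := by
    rw [le_div_iff₀ (by positivity), one_mul]
    exact pow_le_one₀ hcb.le (by linarith)
  refine ⟨χ, hχ, h01, h1, h0, hle'.trans ?_, ?_⟩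
  · gcongr
    have : 0 ≤ V.toReal := ENNReal.toReal_nonneg
    nlinarith
  · have hΓ : ∫⁻ x, ‖χ x‖ₑ ^ 2 * truncGradSq v G k x ≤ ∫⁻ x in ball 0 c, truncGradSq v G k x := by
      rw [← lintegral_indicator measurableSet_ball]
      refine lintegral_mono fun x => ?_
      by_cases hx : x ∈ ball (0 : Fin (m + 1) → ℝ) c
      · rw [indicator_of_mem hx]
        refine mul_le_of_le_one_left zero_le (pow_le_one₀ zero_le ?_)
        rw [Real.enorm_eq_ofReal (h01 x).1]; exact ENNReal.ofReal_le_one.2 (h01 x).2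
      · rw [h0 x (not_lt.1 fun hlt => hx (mem_ball_zero_iff.2 hlt))]; simp
    set A := ∫⁻ x in ball 0 c, truncGradSq v G k x with hA
    set B := (∫⁻ x in ball 0 c, ‖max (v x - k) 0‖ₑ ^ p) ^ (2 / p) with hB
    calc cutoffEnergy v G k χ
        ≤ 2 * A + 2 * (ENNReal.ofReal (C₁ / (c - b) ^ 3) * (B * V)) := by
          unfold cutoffEnergy
          gcongr
          exact hle'.trans (by gcongr)
      _ = ENNReal.ofReal 2 * A + ENNReal.ofReal (2 * (C₁ / (c - b) ^ 3) * V.toReal) * B := by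
          rw [ENNReal.ofReal_mul (by positivity), ENNReal.ofReal_mul (by positivity),
            ENNReal.ofReal_toReal hVt]
          simp only [ENNReal.ofReal_ofNat]
          ring
      _ ≤ ENNReal.ofReal ((C₁ + (2 + 2 * C₁ * V.toReal)) / (c - b) ^ 3) * A +
          ENNReal.ofReal ((C₁ + (2 + 2 * C₁ * V.toReal)) / (c - b) ^ 3) * B := by
          have : 0 ≤ V.toReal := ENNReal.toReal_nonneg
          have h5 : 0 ≤ C₁ * V.toReal := by positivity
          gcongr
          · calc (2:ℝ) ≤ C₁ + (2 + 2 * C₁ * V.toReal) := by nlinarith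
              _ = (C₁ + (2 + 2 * C₁ * V.toReal)) * 1 := by ring
              _ ≤ (C₁ + (2 + 2 * C₁ * V.toReal)) * (1 / (c - b) ^ 3) := by gcongr
              _ = _ := by ring
          · rw [show 2 * (C₁ / (c - b) ^ 3) * V.toReal = 2 * C₁ * V.toReal / (c - b) ^ 3 by ring]
            gcongr
            linarith
      _ = _ := by rw [truncEnergy, ← mul_add]

/-- The Chebyshev inequality for superlevel sets. -/
theorem measure_superlevel_le {d : ℕ} {cm M₁ M₂ k₀ : ℝ} {v : (Fin d → ℝ) → ℝ}
    {G : Fin d → (Fin d → ℝ) → ℝ} {f : (Fin d → ℝ) → ℝ}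
    (h : CaccioppoliOnCube cm M₁ M₂ k₀ v G f) {p : ℝ} (hp : 0 < p) (k c : ℝ) {Δ τ : ℝ}
    (hΔ : 0 < Δ) (hτ : 0 ≤ τ) (hJ : truncEnergy p v G k c ≤ ENNReal.ofReal ((Δ * τ) ^ 2)) :
    volume (ball 0 c ∩ {x | k + Δ < v x}) ≤ ENNReal.ofReal (τ ^ p) := by
  have h1 : ENNReal.ofReal (Δ ^ p) * volume (ball 0 c ∩ {x | k + Δ < v x})
      ≤ ∫⁻ x in ball 0 c, ‖max (v x - k) 0‖ₑ ^ p := by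
    rw [← setLIntegral_const]
    refine (setLIntegral_mono' (measurableSet_ball.inter (h.measurableSet_lt _))
      fun x hx => ?_).trans (lintegral_mono_set inter_subset_left)
    have hx2 : k + Δ < v x := hx.2
    rw [Real.enorm_eq_ofReal (le_max_right _ _), ENNReal.ofReal_rpow_of_nonneg
      (le_max_right _ _) hp.le]
    refine ENNReal.ofReal_le_ofReal (Real.rpow_le_rpow hΔ.le ?_ hp.le)
    exact le_max_of_le_left (by linarith)
  have h2 : ∫⁻ x in ball 0 c, ‖max (v x - k) 0‖ₑ ^ p ≤ ENNReal.ofReal ((Δ * τ) ^ p) := by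
    have h3 : (∫⁻ x in ball 0 c, ‖max (v x - k) 0‖ₑ ^ p) ^ (2 / p)
        ≤ ENNReal.ofReal ((Δ * τ) ^ 2) := le_trans le_add_self hJ
    have h4 := ENNReal.rpow_le_rpow h3 (z := p / 2) (by positivity)
    rw [← ENNReal.rpow_mul, show 2 / p * (p / 2) = 1 by field_simp, ENNReal.rpow_one,
      ENNReal.ofReal_rpow_of_nonneg (by positivity) (by positivity)] at h4
    refine h4.trans (le_of_eq ?_)
    congr 1
    rw [← Real.rpow_natCast, ← Real.rpow_mul (by positivity)]
    congr 1
    push_cast; ring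
  have h5 := h1.trans h2
  rw [Real.mul_rpow hΔ.le hτ, ENNReal.ofReal_mul (by positivity)] at h5
  have hΔp : 0 < Δ ^ p := Real.rpow_pos_of_pos hΔ p
  exact (ENNReal.mul_le_mul_iff_right (by simpa using hΔp) ENNReal.ofReal_ne_top).1 h5

/-- One step of the De Giorgi iteration. The gain over the usual exponent comes from estimating
the slices `{x i = r}` by the Sobolev inequality in one dimension less. Between the cubes of
half-sides `a < c` two cutoff functions are used: `χ`, from `(a + c) / 2` to `c`, localizes the
Sobolev inequality on slices, and `η`, from `a` to `(a + c) / 2`, is adapted to `(v - k - Δ)₊²` and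
enters the Caccioppoli inequality. -/
theorem exists_step_const {m : ℕ} {p : ℝ} (hp : 2 < p) {α : ℝ} (hα : 0 < α) {Cp Cq : ℝ≥0}
    (hCp : ∀ w : (Fin (m + 1) → ℝ) → ℝ, ContDiff ℝ 1 w → HasCompactSupport w →
      support w ⊆ ball 0 2 →
      (∫⁻ x, ‖w x‖ₑ ^ p) ^ (2 / p) ≤ Cp * ∫⁻ x, ∑ i, ‖partialDeriv i w x‖ₑ ^ 2)
    (hCq : ∀ w : (Fin m → ℝ) → ℝ, ContDiff ℝ 1 w → HasCompactSupport w →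
      support w ⊆ ball 0 2 →
      (∫⁻ x, ‖w x‖ₑ ^ (2 + 2 * α)) ^ (2 / (2 + 2 * α))
        ≤ Cq * ∫⁻ x, ∑ i, ‖partialDeriv i w x‖ₑ ^ 2) (cm : ℝ) :
    ∃ C : ℝ, 0 ≤ C ∧ ∀ {M₁ M₂ k₀ : ℝ} {v : (Fin (m + 1) → ℝ) → ℝ}
      {G : Fin (m + 1) → (Fin (m + 1) → ℝ) → ℝ} {f : (Fin (m + 1) → ℝ) → ℝ}, 1 ≤ M₁ →
      CaccioppoliOnCube cm M₁ M₂ k₀ v G f → ∀ (k Δ a c : ℝ), k₀ ≤ k → 0 < Δ → 0 < a → a < c →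
      c < 1 → truncEnergy p v G (k + Δ) a ≤
        ENNReal.ofReal (C * (M₁ ^ 2 * ((c - a) ^ (-(6 + 4 * α)) * Δ ^ (-(2 * α))))) *
            truncEnergy p v G k c ^ (1 + α) +
          ENNReal.ofReal (C * M₂ ^ 2) * ∫⁻ x in ball 0 c ∩ {x | k + Δ < v x}, ‖f x‖ₑ ^ 2 := by
  obtain ⟨C₁, hC₁0, hC₁⟩ := exists_cutoff_energy_const m hp
  set q : ℝ := 2 + 2 * α with hq
  set δ : ℝ := 2 / q with hδ
  have hq0 : 0 < q := by positivity
  have hδ0 : 0 < δ := by positivity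
  have hδ1 : δ ≤ 1 := by rw [hδ, div_le_one hq0]; linarith
  have hδinv : 1 / δ = 1 + α := by rw [hδ, hq]; field_simp
  set C₂ : ℝ := (1 + 4 * Cp) * (1 + cm ^ 2) with hC₂
  have hC₂0 : 0 ≤ C₂ := by positivity
  set C₃ : ℝ := 128 * (64 * (m + 1) * Cq * C₁) ^ (1 + α) with hC₃
  have hC₃0 : 0 ≤ C₃ := by positivity
  refine ⟨C₂ * (1 + C₃), by positivity, ?_⟩
  intro M₁ M₂ k₀ v G f hM₁ h k Δ a c hk hΔ ha hac hc
  have hs : 0 < c - a := by linarith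
  obtain ⟨χ, hχ, hχ01, hχ1, hχ0, -, hχe⟩ := hC₁ h k (b := (a + c) / 2) (c := c)
    (by linarith) (by linarith) hc.le
  set b := (a + c) / 2 with hb
  have hcb : c - b = (c - a) / 2 := by rw [hb]; ring
  have hba : b - a = (c - a) / 2 := by rw [hb]; ring
  set J := truncEnergy p v G k c with hJ
  obtain ⟨U, hu, hus, hU, hw, hUe⟩ := h.exists_weak_deriv_cutoff hk hχ hc hχ0
  have hslice : ∀ i : Fin (m + 1), ∫⁻ r : ℝ, (∫⁻ y : Fin m → ℝ,
      ‖χ (i.insertNth r y) * max (v (i.insertNth r y) - k) 0‖ₑ ^ q) ^ δ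
      ≤ Cq * (ENNReal.ofReal (C₁ / (c - b) ^ 3) * J) := fun i =>
    (slice_sobolev_weak hq0 hCq hu hus hU hw i).trans
      (mul_le_mul_right (hUe.trans hχe) _)
  -- the weight for the cutoff function
  set g : (Fin (m + 1) → ℝ) → ℝ≥0∞ :=
    (ball 0 b).indicator fun x => ‖max (v x - (k + Δ)) 0‖ₑ ^ 2 with hg
  have hul := h.continuous_trunc (k + Δ)
  have hgm : Measurable g := (hul.measurable.enorm.pow_const 2).indicator measurableSet_ball
  have hgfin : ∫⁻ x, g x ≠ ⊤ := by
    rw [hg, lintegral_indicator measurableSet_ball]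
    have := lintegral_ball_ne_top hul (p := 2) (by norm_num) b
    simpa using this
  -- on `{v > k + Δ}` the exponent `2` can be raised to `q = 2 + 2α` at the cost of `Δ ^ (-2α)`
  have hgle : ∀ x, g x ≤ ENNReal.ofReal (Δ ^ (-(2 * α))) * ‖χ x * max (v x - k) 0‖ₑ ^ q := by
    intro x
    by_cases hx : x ∈ ball (0 : Fin (m + 1) → ℝ) b
    · rw [hg, indicator_of_mem hx, hχ1 x (mem_ball_zero_iff.1 hx).le, one_mul]
      rcases le_or_gt (v x) (k + Δ) with hv | hv
      · rw [max_eq_right (by linarith)]; simp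
      · have h1 : 0 < v x - k := by linarith
        rw [max_eq_left (by linarith), max_eq_left h1.le, enorm_sq_eq_ofReal,
          Real.enorm_eq_ofReal h1.le, ENNReal.ofReal_rpow_of_nonneg h1.le hq0.le,
          ← ENNReal.ofReal_mul (by positivity)]
        refine ENNReal.ofReal_le_ofReal ?_
        have h2 : (v x - k) ^ (2:ℝ) = (v x - k) ^ (-(2 * α)) * (v x - k) ^ q := by
          rw [← Real.rpow_add h1]; congr 1; rw [hq]; ring
        calc (v x - (k + Δ)) ^ 2 ≤ (v x - k) ^ 2 := by
              refine pow_le_pow_left₀ ?_ ?_ 2 <;> linarith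
          _ = (v x - k) ^ (2:ℝ) := by norm_cast
          _ = _ := h2
          _ ≤ _ := by
              exact mul_le_mul_of_nonneg_right (Real.rpow_le_rpow_of_nonpos hΔ
                (show Δ ≤ v x - k by linarith) (show -(2 * α) ≤ 0 by linarith)) (by positivity)
    · rw [hg, indicator_of_notMem hx]; exact zero_le
  obtain ⟨η, hη, hη01, hη1, hη0, hηd0, hηe⟩ := exists_adapted_cutoff' hgm hgfin ha
    (show a < b by linarith) (by linarith) hδ0 hδ1
  have hsum : ∑ i : Fin (m + 1), ∫⁻ r : ℝ, (∫⁻ y, g (i.insertNth r y)) ^ δ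
      ≤ ENNReal.ofReal (Δ ^ (-(2 * α))) ^ δ *
        (ENNReal.ofReal (m + 1) * (Cq * (ENNReal.ofReal (C₁ / (c - b) ^ 3) * J))) := by
    have hi : ∀ i : Fin (m + 1), ∫⁻ r : ℝ, (∫⁻ y, g (i.insertNth r y)) ^ δ
        ≤ ENNReal.ofReal (Δ ^ (-(2 * α))) ^ δ *
          (Cq * (ENNReal.ofReal (C₁ / (c - b) ^ 3) * J)) := by
      intro i
      refine le_trans ?_ (mul_le_mul_right (hslice i) _)
      rw [← lintegral_const_mul' _ _ (ENNReal.rpow_ne_top_of_nonneg hδ0.le ENNReal.ofReal_ne_top)]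
      refine lintegral_mono fun r => ?_
      rw [← ENNReal.mul_rpow_of_nonneg _ _ hδ0.le, ← lintegral_const_mul' _ _ ENNReal.ofReal_ne_top]
      exact ENNReal.rpow_le_rpow (lintegral_mono fun y => hgle _) hδ0.le
    refine (Finset.sum_le_sum fun i _ => hi i).trans (le_of_eq ?_)
    rw [Finset.sum_const, Finset.card_univ, Fintype.card_fin, nsmul_eq_mul,
      show ((m + 1 : ℕ) : ℝ≥0∞) = ENNReal.ofReal (m + 1) by
        rw [← Nat.cast_succ, ENNReal.ofReal_natCast]]
    ring
  have hηe' : ∫⁻ x, ‖max (v x - (k + Δ)) 0‖ₑ ^ 2 * ∑ i, ‖partialDeriv i η x‖ₑ ^ 2 ≤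
      ENNReal.ofReal (C₃ * ((c - a) ^ (-(6 + 4 * α)) * Δ ^ (-(2 * α)))) * J ^ (1 + α) := by
    calc ∫⁻ x, ‖max (v x - (k + Δ)) 0‖ₑ ^ 2 * ∑ i, ‖partialDeriv i η x‖ₑ ^ 2
        = ∫⁻ x, g x * ∑ i, ‖partialDeriv i η x‖ₑ ^ 2 := by
          refine lintegral_congr fun x => ?_
          by_cases hx : x ∈ ball (0 : Fin (m + 1) → ℝ) b
          · rw [hg, indicator_of_mem hx]
          · have := hηd0 x (not_lt.1 fun hlt => hx (mem_ball_zero_iff.2 hlt))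
            simp [this]
      _ ≤ _ := hηe
      _ ≤ ENNReal.ofReal (32 / (b - a) ^ 2) * (ENNReal.ofReal (4 / (b - a)) *
          (ENNReal.ofReal (Δ ^ (-(2 * α))) ^ δ *
        (ENNReal.ofReal (m + 1) * (Cq * (ENNReal.ofReal (C₁ / (c - b) ^ 3) * J))))) ^ (1 / δ) := by
          gcongr
      _ = ENNReal.ofReal (32 / (b - a) ^ 2) * (ENNReal.ofReal (Δ ^ (-(2 * α))) ^ δ *
          (ENNReal.ofReal (4 / (b - a) * (m + 1) * Cq * (C₁ / (c - b) ^ 3)) * J)) ^ (1 / δ) := by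
          rw [ENNReal.ofReal_mul (p := 4 / (b - a) * (m + 1) * Cq) (by rw [hba]; positivity),
            ENNReal.ofReal_mul (p := 4 / (b - a) * (m + 1)) (by rw [hba]; positivity),
            ENNReal.ofReal_mul (p := 4 / (b - a)) (by rw [hba]; positivity),
            ENNReal.ofReal_coe_nnreal]
          congr 2
          ring
      _ = _ := by
          have hd : δ * (1 / δ) = 1 := by field_simp
          rw [ENNReal.mul_rpow_of_nonneg _ _ (by positivity), ← ENNReal.rpow_mul, hd,
            ENNReal.rpow_one, ENNReal.mul_rpow_of_nonneg _ _ (by positivity), hδinv,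
            ENNReal.ofReal_rpow_of_nonneg (by rw [hba, hcb]; positivity) (by positivity),
            ← mul_assoc, ← mul_assoc, ← ENNReal.ofReal_mul (by positivity),
            ← ENNReal.ofReal_mul (by positivity)]
          congr 2
          rw [hba, hcb, hC₃]
          have e1 : 4 / ((c - a) / 2) * (m + 1) * Cq * (C₁ / ((c - a) / 2) ^ 3)
              = (64 * (m + 1) * Cq * C₁) * (c - a) ^ (-4 : ℝ) := by
            rw [Real.rpow_neg hs.le]
            norm_cast
            field_simp
            norm_num
          have e2 : (32:ℝ) / ((c - a) / 2) ^ 2 = 128 * (c - a) ^ (-2 : ℝ) := by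
            rw [Real.rpow_neg hs.le]
            norm_cast
            field_simp
            norm_num
          rw [e1, e2, Real.mul_rpow (by positivity) (by positivity), ← Real.rpow_mul hs.le]
          have e3 : (c - a) ^ (-(6 + 4 * α)) = (c - a) ^ (-2 : ℝ) * (c - a) ^ (-4 * (1 + α)) := by
            rw [← Real.rpow_add hs]; congr 1; ring
          rw [e3]
          ring
  refine (h.truncEnergy_le hM₁ (by linarith) hCp (l := k + Δ) (by linarith) hη
    (show b < 1 by linarith) hη01 hη1 hη0).trans ?_
  rw [← hC₂, mul_add]
  refine add_le_add ?_ ?_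
  · calc ENNReal.ofReal C₂ * (ENNReal.ofReal (M₁ ^ 2) *
          ∫⁻ x, ‖max (v x - (k + Δ)) 0‖ₑ ^ 2 * ∑ i, ‖partialDeriv i η x‖ₑ ^ 2)
        ≤ ENNReal.ofReal C₂ * (ENNReal.ofReal (M₁ ^ 2) *
          (ENNReal.ofReal (C₃ * ((c - a) ^ (-(6 + 4 * α)) * Δ ^ (-(2 * α)))) * J ^ (1 + α))) := by
          gcongr
      _ = ENNReal.ofReal (C₂ * (M₁ ^ 2 * (C₃ * ((c - a) ^ (-(6 + 4 * α)) * Δ ^ (-(2 * α)))))) *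
          J ^ (1 + α) := by
          rw [ENNReal.ofReal_mul hC₂0, ENNReal.ofReal_mul (sq_nonneg M₁)]
          ring
      _ ≤ _ := by
          gcongr ENNReal.ofReal ?_ * _
          have e : 0 ≤ M₁ ^ 2 * ((c - a) ^ (-(6 + 4 * α)) * Δ ^ (-(2 * α))) := by positivity
          have : C₂ * C₃ * (M₁ ^ 2 * ((c - a) ^ (-(6 + 4 * α)) * Δ ^ (-(2 * α))))
              ≤ C₂ * (1 + C₃) * (M₁ ^ 2 * ((c - a) ^ (-(6 + 4 * α)) * Δ ^ (-(2 * α)))) :=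
            mul_le_mul_of_nonneg_right (by nlinarith) e
          linarith
  · rw [← mul_assoc, ← ENNReal.ofReal_mul hC₂0]
    refine mul_le_mul' (ENNReal.ofReal_le_ofReal ?_) (lintegral_mono_set
      (inter_subset_inter_left _ (ball_subset_ball (by linarith))))
    have : C₂ * 1 ≤ C₂ * (1 + C₃) := mul_le_mul_of_nonneg_left (by linarith) hC₂0
    nlinarith [sq_nonneg M₂]

/-- The energy at the initial level `k₀`, on the cube of half-side `3 / 4`. -/
theorem exists_initial_const {m : ℕ} {p : ℝ} (hp : 2 < p) {Cp : ℝ≥0}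
    (hCp : ∀ w : (Fin (m + 1) → ℝ) → ℝ, ContDiff ℝ 1 w → HasCompactSupport w →
      support w ⊆ ball 0 2 →
      (∫⁻ x, ‖w x‖ₑ ^ p) ^ (2 / p) ≤ Cp * ∫⁻ x, ∑ i, ‖partialDeriv i w x‖ₑ ^ 2) (cm : ℝ) :
    ∃ C : ℝ, 0 ≤ C ∧ ∀ {M₁ M₂ k₀ : ℝ} {v : (Fin (m + 1) → ℝ) → ℝ}
      {G : Fin (m + 1) → (Fin (m + 1) → ℝ) → ℝ} {f : (Fin (m + 1) → ℝ) → ℝ}, 1 ≤ M₁ →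
      CaccioppoliOnCube cm M₁ M₂ k₀ v G f → truncEnergy p v G k₀ (3 / 4) ≤
        ENNReal.ofReal (C * M₁ ^ 2) * (∫⁻ x in ball 0 1, ‖max (v x - k₀) 0‖ₑ ^ 2) +
          ENNReal.ofReal (C * M₂ ^ 2) * ∫⁻ x in ball 0 1, ‖f x‖ₑ ^ 2 := by
  obtain ⟨C₁, hC₁0, hC₁⟩ := exists_cutoff_energy_const m hp
  set C₂ : ℝ := (1 + 4 * Cp) * (1 + cm ^ 2) with hC₂
  have hC₂0 : 0 ≤ C₂ := by positivity
  refine ⟨C₂ * (1 + 512 * C₁), by positivity, ?_⟩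
  intro M₁ M₂ k₀ v G f hM₁ h
  obtain ⟨χ, hχ, hχ01, hχ1, hχ0, hχe, -⟩ := hC₁ h k₀ (b := 3 / 4) (c := 7 / 8)
    (by norm_num) (by norm_num) (by norm_num)
  refine (h.truncEnergy_le hM₁ (by linarith) hCp le_rfl hχ
    (show (7 / 8 : ℝ) < 1 by norm_num) hχ01 hχ1 hχ0).trans ?_
  rw [← hC₂, mul_add]
  refine add_le_add ?_ ?_
  · rw [show C₁ / (7 / 8 - 3 / 4) ^ 3 = 512 * C₁ by norm_num; ring] at hχe
    calc _ ≤ ENNReal.ofReal C₂ * (ENNReal.ofReal (M₁ ^ 2) * (ENNReal.ofReal (512 * C₁) *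
          ∫⁻ x in ball 0 1, ‖max (v x - k₀) 0‖ₑ ^ 2)) := by
          gcongr
          exact hχe.trans (mul_le_mul_right (lintegral_mono_set (ball_subset_ball (by norm_num))) _)
      _ = ENNReal.ofReal (C₂ * (M₁ ^ 2 * (512 * C₁))) *
          ∫⁻ x in ball 0 1, ‖max (v x - k₀) 0‖ₑ ^ 2 := by
          rw [ENNReal.ofReal_mul hC₂0, ENNReal.ofReal_mul (sq_nonneg M₁)]
          ring
      _ ≤ _ := by
          gcongr ENNReal.ofReal ?_ * _
          have : 0 ≤ C₂ * M₁ ^ 2 := by positivity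
          nlinarith
  · rw [← mul_assoc, ← ENNReal.ofReal_mul hC₂0]
    refine mul_le_mul' (ENNReal.ofReal_le_ofReal ?_) (lintegral_mono_set
      (inter_subset_left.trans (ball_subset_ball (by norm_num))))
    have : C₂ * 1 ≤ C₂ * (1 + 512 * C₁) := mul_le_mul_of_nonneg_left (by linarith) hC₂0
    nlinarith [sq_nonneg M₂]

end CaccioppoliOnCube

end EnergyDecay

/-! ### The De Giorgi iteration -/

section Iteration

/-- The De Giorgi iteration with adaptively chosen levels. `J k ν` is the energy at level `k` on
the `ν`-th cube and `H ν` measures the right-hand side on sets of measure `τᵖᵛ`. The increments of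
the level are proportional to `τ⁻ᵛ Yᵥ`, where `Yᵥ = (τ/2)ᵛ Y + M₂ Hᵥ` bounds `√J`. -/
theorem exists_deGiorgi_const {C b α τ Λ : ℝ} (hC : 1 ≤ C) (hb : 1 ≤ b) (hα : 0 < α) (hτ : 0 < τ)
    (hτ1 : τ < 1) (hbτ : b * τ ^ (2 * α) ≤ 1) (hΛ : 1 ≤ Λ) :
    ∃ K : ℝ, 1 ≤ K ∧ ∀ {M₁ M₂ k₀ Y L : ℝ} {J : ℝ → ℕ → ℝ} {H : ℕ → ℝ}, 1 ≤ M₁ → 0 ≤ M₂ → 0 < Y →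
      (∀ ν, 0 ≤ H ν) → (∀ ν, H ν ≤ Λ * H (ν + 1)) →
      (∀ N, ∑ ν ∈ Finset.range N, H ν / τ ^ ν ≤ L) → (∀ k ν, 0 ≤ J k ν) →
      J k₀ 0 ≤ C * (Y + M₂ * H 0) ^ 2 →
      (∀ k Δ ν, k₀ ≤ k → 0 < Δ → J k ν ≤ (Δ * τ ^ (ν + 1)) ^ 2 →
        J (k + Δ) (ν + 1) ≤ C * b ^ ν * M₁ ^ 2 * Δ ^ (-(2 * α)) * J k ν ^ (1 + α) +
          C * M₂ ^ 2 * H (ν + 1) ^ 2) →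
      ∀ ν, ∃ k, k₀ ≤ k ∧ k ≤ k₀ + K * M₁ ^ (1 / α) * (Y + M₂ * L) ∧
        J k ν ≤ K * (τ ^ ν * (Y + M₂ * L)) ^ 2 := by
  -- `Λ'` bounds the ratios `yᵥ / yᵥ₊₁`, where `yᵥ = (τ/2)ᵛ Y + M₂ Hᵥ`
  set Λ' : ℝ := Λ + 2 / τ with hΛ'
  have hτ2 : 0 < 2 / τ := by positivity
  have hΛ'1 : 1 ≤ Λ' := by linarith
  set C₁ : ℝ := 2 * C with hC₁
  have hC₁1 : 1 ≤ C₁ := by linarith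
  set B : ℝ := C₁ ^ (1 + α) * Λ' ^ 2 with hB
  have hB1 : 1 ≤ B := by
    have h1 : 1 ≤ C₁ ^ (1 + α) := Real.one_le_rpow hC₁1 (by linarith)
    have h2 : 1 ≤ Λ' ^ 2 := one_le_pow₀ hΛ'1
    nlinarith
  set D : ℝ := B ^ (1 / (2 * α)) with hD
  have hD1 : 1 ≤ D := Real.one_le_rpow hB1 (by positivity)
  -- the factor `C₁ / τ` in the increments makes the Chebyshev condition hold, the factor `D` absorbs
  -- the nonlinear term
  set C₄ : ℝ := C₁ / τ * D with hC₄
  have hC₁τ : C₁ ≤ C₁ / τ := by rw [le_div_iff₀ hτ]; nlinarith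
  have hC₄C₁ : C₁ / τ ≤ C₄ := le_mul_of_one_le_right (by positivity) hD1
  have hC₄D : D ≤ C₄ := le_mul_of_one_le_left (by linarith) (by linarith)
  have hC₄0 : 0 < C₄ := by positivity
  have hC₄B : B ≤ C₄ ^ (2 * α) := by
    calc B = D ^ (2 * α) := by
          rw [hD, ← Real.rpow_mul (by linarith), one_div_mul_cancel (by positivity), Real.rpow_one]
      _ ≤ _ := Real.rpow_le_rpow (by linarith) hC₄D (by positivity)
  refine ⟨2 * C₄, by linarith, ?_⟩
  intro M₁ M₂ k₀ Y L J H hM₁ hM₂ hY hH hHΛ hL hJ0 hJ hstep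
  set m : ℝ := M₁ ^ (1 / α) with hm
  have hm1 : 1 ≤ m := Real.one_le_rpow hM₁ (by positivity)
  have hm2 : m ^ (2 * α) = M₁ ^ 2 := by
    rw [hm, ← Real.rpow_mul (by linarith), show 1 / α * (2 * α) = 2 by field_simp]
    norm_cast
  set y : ℕ → ℝ := fun ν => (τ / 2) ^ ν * Y + M₂ * H ν with hy
  have hy0 : ∀ ν, 0 < y ν := fun ν =>
    add_pos_of_pos_of_nonneg (by positivity) (mul_nonneg hM₂ (hH ν))
  have hyΛ : ∀ ν, y ν ≤ Λ' * y (ν + 1) := by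
    intro ν
    have h1 : (τ / 2) ^ ν * Y = 2 / τ * ((τ / 2) ^ (ν + 1) * Y) := by
      rw [pow_succ]; field_simp
    have h2 : 0 ≤ M₂ * H (ν + 1) := mul_nonneg hM₂ (hH _)
    have h3 : 0 ≤ (τ / 2) ^ (ν + 1) * Y := by positivity
    have h4 : M₂ * H ν ≤ M₂ * (Λ * H (ν + 1)) := mul_le_mul_of_nonneg_left (hHΛ ν) hM₂
    simp only [hy, hΛ']
    rw [h1]
    nlinarith [mul_nonneg (by linarith : 0 ≤ Λ) h3, mul_nonneg hτ2.le h2]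
  set Δ : ℕ → ℝ := fun ν => C₄ * m * (y ν / τ ^ ν) with hΔ
  have hΔ0 : ∀ ν, 0 < Δ ν := fun ν => by
    have := hy0 ν
    simp only [hΔ]; positivity
  set κ : ℕ → ℝ := fun ν => k₀ + ∑ i ∈ Finset.range ν, Δ i with hκ
  have hκ0 : ∀ ν, k₀ ≤ κ ν := fun ν =>
    le_add_of_nonneg_right (Finset.sum_nonneg fun i _ => (hΔ0 i).le)
  have hmain : ∀ ν, J (κ ν) ν ≤ C₁ * y ν ^ 2 := by
    intro ν
    induction ν with
    | zero =>
      simp only [hκ, hy, Finset.range_zero, Finset.sum_empty, add_zero, pow_zero, one_mul]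
      nlinarith [sq_nonneg (Y + M₂ * H 0)]
    | succ ν ih =>
      have hyν := hy0 ν
      have hτν : 0 < τ ^ ν := by positivity
      have hΔτ : Δ ν * τ ^ (ν + 1) = C₄ * τ * m * y ν := by
        simp only [hΔ]; rw [pow_succ]; field_simp
      have hcond : J (κ ν) ν ≤ (Δ ν * τ ^ (ν + 1)) ^ 2 := by
        rw [hΔτ]
        have h1 : C₁ ≤ C₄ * τ := by rwa [div_le_iff₀ hτ] at hC₄C₁
        have h2 : C₁ * y ν ≤ C₄ * τ * m * y ν := by
          have : C₁ ≤ C₄ * τ * m := h1.trans (le_mul_of_one_le_right (by positivity) hm1)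
          exact mul_le_mul_of_nonneg_right this hyν.le
        calc J (κ ν) ν ≤ C₁ * y ν ^ 2 := ih
          _ ≤ (C₁ * y ν) ^ 2 := by
              rw [mul_pow]; exact mul_le_mul_of_nonneg_right (by nlinarith) (sq_nonneg _)
          _ ≤ _ := pow_le_pow_left₀ (by positivity) h2 2
      have h := hstep (κ ν) (Δ ν) ν (hκ0 ν) (hΔ0 ν) hcond
      have hκs : κ (ν + 1) = κ ν + Δ ν := by simp only [hκ, Finset.sum_range_succ, add_assoc]
      rw [hκs]
      have hsecond : C * M₂ ^ 2 * H (ν + 1) ^ 2 ≤ C * y (ν + 1) ^ 2 := by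
        rw [mul_assoc, ← mul_pow]
        refine mul_le_mul_of_nonneg_left (pow_le_pow_left₀ (mul_nonneg hM₂ (hH _)) ?_ 2)
          (by linarith)
        exact le_add_of_nonneg_left (by positivity)
      have hfirst : C * b ^ ν * M₁ ^ 2 * Δ ν ^ (-(2 * α)) * J (κ ν) ν ^ (1 + α)
          ≤ C * y (ν + 1) ^ 2 := by
        have e1 : J (κ ν) ν ^ (1 + α) ≤ C₁ ^ (1 + α) * (y ν ^ 2 * y ν ^ (2 * α)) := by
          refine (Real.rpow_le_rpow (hJ0 _ _) ih (by positivity)).trans (le_of_eq ?_)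
          rw [Real.mul_rpow (by positivity) (by positivity)]
          congr 1
          rw [← Real.rpow_natCast, ← Real.rpow_mul hyν.le, ← Real.rpow_add hyν]
          congr 1; push_cast; ring
        have e2 : Δ ν ^ (2 * α) = C₄ ^ (2 * α) * M₁ ^ 2 * (y ν ^ (2 * α) / (τ ^ (2 * α)) ^ ν) := by
          simp only [hΔ]
          rw [Real.mul_rpow (by positivity) (by positivity), Real.mul_rpow (by positivity)
            (by positivity), hm2, Real.div_rpow hyν.le (by positivity)]
          congr 2
          rw [← Real.rpow_natCast, ← Real.rpow_natCast, ← Real.rpow_mul hτ.le,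
            ← Real.rpow_mul hτ.le, mul_comm]
        have e3 : b ^ ν * (τ ^ (2 * α)) ^ ν ≤ 1 := by
          rw [← mul_pow]
          exact pow_le_one₀ (by positivity) hbτ
        have hyα : 0 < y ν ^ (2 * α) := Real.rpow_pos_of_pos hyν _
        have hM : 0 < M₁ ^ 2 := by positivity
        have hCα : 0 < C₄ ^ (2 * α) := Real.rpow_pos_of_pos hC₄0 _
        have hbpos : 0 < b ^ ν := by positivity
        have hτα : 0 < (τ ^ (2 * α)) ^ ν := by positivity
        have e4 : y ν ^ 2 ≤ Λ' ^ 2 * y (ν + 1) ^ 2 := by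
          rw [← mul_pow]; exact pow_le_pow_left₀ hyν.le (hyΛ ν) 2
        calc C * b ^ ν * M₁ ^ 2 * Δ ν ^ (-(2 * α)) * J (κ ν) ν ^ (1 + α)
            ≤ C * b ^ ν * M₁ ^ 2 * Δ ν ^ (-(2 * α)) *
              (C₁ ^ (1 + α) * (y ν ^ 2 * y ν ^ (2 * α))) := by
              refine mul_le_mul_of_nonneg_left e1 ?_
              have := hΔ0 ν
              positivity
          _ = C * (b ^ ν * (τ ^ (2 * α)) ^ ν) * (C₁ ^ (1 + α) * y ν ^ 2 / C₄ ^ (2 * α)) := by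
              rw [Real.rpow_neg (hΔ0 ν).le, e2]
              field_simp
          _ ≤ C * 1 * (C₁ ^ (1 + α) * (Λ' ^ 2 * y (ν + 1) ^ 2) / C₄ ^ (2 * α)) := by
              gcongr
          _ = C * y (ν + 1) ^ 2 * (B / C₄ ^ (2 * α)) := by rw [hB]; ring
          _ ≤ C * y (ν + 1) ^ 2 * 1 := by
              refine mul_le_mul_of_nonneg_left ?_ (by positivity)
              rwa [div_le_one hCα]
          _ = _ := mul_one _
      linarith
  intro ν
  have hgeom : ∀ N, ∑ i ∈ Finset.range N, ((1:ℝ) / 2) ^ i ≤ 2 := fun N =>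
    (summable_geometric_two.sum_le_tsum _ fun i _ => by positivity).trans tsum_geometric_two.le
  have hL0 : 0 ≤ L := by simpa using hL 0
  refine ⟨κ ν, hκ0 ν, ?_, (hmain ν).trans ?_⟩
  · simp only [hκ]
    refine add_le_add le_rfl ?_
    have e : ∀ i, Δ i = C₄ * m * ((1 / 2) ^ i * Y + M₂ * (H i / τ ^ i)) := by
      intro i
      simp only [hΔ, hy]
      rw [div_pow, div_pow, one_pow]
      field_simp
    simp only [e]
    rw [← Finset.mul_sum, Finset.sum_add_distrib, ← Finset.sum_mul, ← Finset.mul_sum]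
    have h1 := mul_le_mul_of_nonneg_right (hgeom ν) hY.le
    have h2 := mul_le_mul_of_nonneg_left (hL ν) hM₂
    have h3 : 0 ≤ M₂ * L := mul_nonneg hM₂ hL0
    have h4 : 0 ≤ C₄ * m := by positivity
    calc _ ≤ C₄ * m * (2 * Y + M₂ * L) := mul_le_mul_of_nonneg_left (by linarith) h4
      _ ≤ C₄ * m * (2 * (Y + M₂ * L)) := mul_le_mul_of_nonneg_left (by linarith) h4
      _ = _ := by ring
  · have hτν : 0 < τ ^ ν := by positivity
    have h1 : H ν / τ ^ ν ≤ L := by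
      refine le_trans ?_ (hL (ν + 1))
      exact Finset.single_le_sum (f := fun ν => H ν / τ ^ ν)
        (fun i _ => div_nonneg (hH i) (by positivity)) (Finset.self_mem_range_succ ν)
    have h2 : y ν ≤ τ ^ ν * (Y + M₂ * L) := by
      have h3 : (τ / 2) ^ ν ≤ τ ^ ν := pow_le_pow_left₀ (by positivity) (by linarith) ν
      have h4 : H ν ≤ τ ^ ν * L := by rwa [div_le_iff₀ hτν, mul_comm] at h1
      have h5 := mul_le_mul_of_nonneg_left h4 hM₂
      have h6 := mul_le_mul_of_nonneg_right h3 hY.le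
      simp only [hy]
      linarith
    have h7 := pow_le_pow_left₀ (hy0 ν).le h2 2
    have h8 : C₁ ≤ 2 * C₄ := by linarith
    exact mul_le_mul h8 h7 (sq_nonneg _) (by linarith)

end Iteration

/-! ### Integrals over small sets -/

section LevelSets

theorem tsum_sq_le_sq_tsum (a : ℕ → ℝ≥0∞) : ∑' i, a i ^ 2 ≤ (∑' i, a i) ^ 2 := by
  rw [sq, ← ENNReal.tsum_mul_right]
  refine ENNReal.tsum_le_tsum fun i => ?_
  rw [sq]
  exact mul_le_mul_right (ENNReal.le_tsum i) _

/-- If `|{|f| > F i}| ≤ θⁱ`, then the integral of `f²` over a set of measure `V θʲ` is bounded by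
splitting the set according to which of the intervals `(F i, F (i + 1)]` contains `|f|`. -/
theorem setLIntegral_sq_le_tsum {X : Type*} [MeasurableSpace X] {μ : Measure X} {f : X → ℝ}
    (hf : AEMeasurable f μ) {F : ℕ → ℝ} {θ : ℝ} (hθ0 : 0 ≤ θ) (hθ1 : θ < 1)
    (hF : ∀ i, μ {x | F i < |f x|} ≤ ENNReal.ofReal (θ ^ i)) {V : ℝ} (hV : 1 ≤ V) (j : ℕ)
    {A : Set X} (hA : MeasurableSet A) (hμA : μ A ≤ ENNReal.ofReal (V * θ ^ j)) :
    ∫⁻ x in A, ‖f x‖ₑ ^ 2 ∂μ ≤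
      ENNReal.ofReal V * ∑' i, if j ≤ i then ENNReal.ofReal (F (i + 1) ^ 2 * θ ^ i) else 0 := by
  set S : ℕ → Set X := fun i => {x | F i < |f x|} with hS
  have hSm : ∀ i, NullMeasurableSet (S i) μ := fun i =>
    nullMeasurableSet_lt aemeasurable_const hf.abs
  have hae : ∀ᵐ x ∂μ, ∃ i, j + 1 ≤ i ∧ |f x| ≤ F i := by
    have h0 : μ (⋂ i, S (j + 1 + i)) = 0 := by
      refine le_antisymm (ge_of_tendsto' (f := fun i : ℕ => ENNReal.ofReal (θ ^ (j + 1 + i)))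
        (x := Filter.atTop) ?_ fun i => ?_) zero_le
      · have h1 := (tendsto_pow_atTop_nhds_zero_of_lt_one hθ0 hθ1).comp
          (Filter.tendsto_add_atTop_nat (j + 1))
        have h2 := ENNReal.tendsto_ofReal h1
        rw [ENNReal.ofReal_zero] at h2
        refine h2.congr fun i => ?_
        simp [add_comm]
      · exact (measure_mono (iInter_subset _ i)).trans (hF _)
    refine measure_mono_null (fun x hx => ?_) h0
    rw [mem_iInter]
    intro i
    by_contra hcon
    exact hx ⟨j + 1 + i, by omega, not_lt.1 hcon⟩
  set c : ℕ → ℝ≥0∞ := fun i => ENNReal.ofReal (F (i + 1) ^ 2) with hc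
  have hpt : ∀ᵐ x ∂μ, A.indicator (fun x => ‖f x‖ₑ ^ 2) x ≤
      A.indicator (fun _ => c j) x +
        ∑' i, if j + 1 ≤ i then (S i).indicator (fun _ => c i) x else 0 := by
    filter_upwards [hae] with x hx
    by_cases hxA : x ∈ A
    swap
    · simp [hxA]
    rw [indicator_of_mem hxA, indicator_of_mem hxA]
    classical
    have hle : ∀ i, |f x| ≤ F i → ‖f x‖ₑ ^ 2 ≤ ENNReal.ofReal (F i ^ 2) := by
      intro i hi
      rw [← ofReal_norm, ← ENNReal.ofReal_pow (norm_nonneg _)]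
      exact ENNReal.ofReal_le_ofReal (pow_le_pow_left₀ (abs_nonneg _) hi 2)
    obtain ⟨hi1, hi2⟩ := Nat.find_spec hx
    set i := Nat.find hx with hi
    rcases hi1.eq_or_lt with h | h
    · refine le_trans ?_ le_self_add
      exact hle _ (h ▸ hi2)
    · refine le_trans ?_ le_add_self
      refine le_trans ?_ (ENNReal.le_tsum (i - 1))
      have hmin : ¬ (j + 1 ≤ i - 1 ∧ |f x| ≤ F (i - 1)) := Nat.find_min hx (by omega)
      have hxS : x ∈ S (i - 1) := by
        by_contra hcon
        exact hmin ⟨by omega, not_lt.1 hcon⟩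
      rw [if_pos (by omega), indicator_of_mem hxS, hc]
      simp only
      rw [show i - 1 + 1 = i by omega]
      exact hle i hi2
  calc ∫⁻ x in A, ‖f x‖ₑ ^ 2 ∂μ = ∫⁻ x, A.indicator (fun x => ‖f x‖ₑ ^ 2) x ∂μ :=
        (lintegral_indicator hA _).symm
    _ ≤ ∫⁻ x, (A.indicator (fun _ => c j) x +
        ∑' i, if j + 1 ≤ i then (S i).indicator (fun _ => c i) x else 0) ∂μ :=
        lintegral_mono_ae hpt
    _ = ∫⁻ x, A.indicator (fun _ => c j) x ∂μ +
        ∑' i, ∫⁻ x, (if j + 1 ≤ i then (S i).indicator (fun _ => c i) x else 0) ∂μ := by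
        rw [lintegral_add_left (measurable_const.indicator hA), lintegral_tsum]
        intro i
        split_ifs
        · exact (aemeasurable_const (b := c i)).indicator₀ (hSm i)
        · exact aemeasurable_const
    _ ≤ ENNReal.ofReal V * ENNReal.ofReal (F (j + 1) ^ 2 * θ ^ j) +
        ∑' i, ENNReal.ofReal V *
          if j + 1 ≤ i then ENNReal.ofReal (F (i + 1) ^ 2 * θ ^ i) else 0 := by
        refine add_le_add ?_ (ENNReal.tsum_le_tsum fun i => ?_)
        · refine (lintegral_indicator_const_le _ _).trans ((mul_le_mul_right hμA _).trans ?_)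
          rw [hc, ← ENNReal.ofReal_mul (sq_nonneg _), ← ENNReal.ofReal_mul (by linarith)]
          exact ENNReal.ofReal_le_ofReal (le_of_eq (by ring))
        · split_ifs
          · refine (lintegral_indicator_const_le _ _).trans ((mul_le_mul_right (hF i) _).trans ?_)
            rw [hc, ← ENNReal.ofReal_mul (sq_nonneg _)]
            exact le_mul_of_one_le_left zero_le (ENNReal.one_le_ofReal.2 hV)
          · simp
    _ = _ := by
        rw [ENNReal.tsum_mul_left, ← mul_add]
        congr 1
        rw [ENNReal.tsum_eq_add_tsum_ite (f := fun i =>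
          if j ≤ i then ENNReal.ofReal (F (i + 1) ^ 2 * θ ^ i) else 0) j]
        rw [if_pos le_rfl]
        congr 2
        ext i
        by_cases h1 : i = j
        · subst h1; simp
        · rw [if_neg h1]
          by_cases h2 : j ≤ i
          · rw [if_pos h2, if_pos (by omega)]
          · rw [if_neg h2, if_neg (by omega)]

/-- Summability of the level sequence `F` against a geometric weight is turned into bounds for the
integral of `f²` over small sets. With `g i = F (i + 1) rⁱ`, the sequence is `H ν = ∑_{i ≥ ν} g i`,
which dominates the square root of `∑_{i ≥ ν} (g i)²`. -/
theorem exists_tail_sequence {X : Type*} [MeasurableSpace X] {μ : Measure X} {f : X → ℝ}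
    (hf : AEMeasurable f μ) {F : ℕ → ℝ} (hF0 : ∀ i, 0 ≤ F i) (hFm : Monotone F)
    {r ρ τ : ℝ} (hr0 : 0 < r) (hr1 : r < 1) (hτ0 : 0 < τ) (hτ1 : τ < 1)
    (hrρ : r = τ * ρ) (hF : ∀ i, μ {x | F i < |f x|} ≤ ENNReal.ofReal ((r ^ 2) ^ i)) {L : ℝ}
    (hL : ∀ N, ∑ i ∈ Finset.range N, F (i + 1) * ρ ^ i ≤ L) :
    ∃ H : ℕ → ℝ, (∀ ν, 0 ≤ H ν) ∧ (∀ ν, H ν ≤ (1 + 1 / r) * H (ν + 1)) ∧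
      (∀ N, ∑ ν ∈ Finset.range N, H ν / τ ^ ν ≤ L / (1 - τ)) ∧
      ∀ (V : ℝ) (ν : ℕ) (A : Set X), 1 ≤ V → MeasurableSet A →
        μ A ≤ ENNReal.ofReal (V * (r ^ 2) ^ ν) →
        ∫⁻ x in A, ‖f x‖ₑ ^ 2 ∂μ ≤ ENNReal.ofReal (V * H ν ^ 2) := by
  have hρ0 : 0 < ρ := by
    by_contra! h
    nlinarith
  set a : ℕ → ℝ := fun i => F (i + 1) * ρ ^ i with ha
  have ha0 : ∀ i, 0 ≤ a i := fun i => mul_nonneg (hF0 _) (by positivity)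
  have has : Summable a := summable_of_sum_range_le ha0 hL
  have haL : ∑' i, a i ≤ L := Real.tsum_le_of_sum_range_le ha0 hL
  set g : ℕ → ℝ := fun i => F (i + 1) * r ^ i with hg
  have hg0 : ∀ i, 0 ≤ g i := fun i => mul_nonneg (hF0 _) (by positivity)
  have hga : ∀ i, g i = τ ^ i * a i := fun i => by simp only [hg, ha, hrρ, mul_pow]; ring
  have hgs : Summable g := Summable.of_nonneg_of_le hg0 (fun i => by
    rw [hga]; exact mul_le_of_le_one_left (ha0 i) (pow_le_one₀ hτ0.le hτ1.le)) has
  set G : ℕ → ℕ → ℝ := fun ν i => if ν ≤ i then g i else 0 with hG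
  have hG0 : ∀ ν i, 0 ≤ G ν i := fun ν i => by
    simp only [hG]; split_ifs
    · exact hg0 i
    · exact le_rfl
  have hGs : ∀ ν, Summable (G ν) := fun ν => Summable.of_nonneg_of_le (hG0 ν) (fun i => by
    simp only [hG]; split_ifs
    · exact le_rfl
    · exact hg0 i) hgs
  refine ⟨fun ν => ∑' i, G ν i, fun ν => tsum_nonneg (hG0 ν), fun ν => ?_, fun N => ?_, ?_⟩
  · have h1 : ∑' i, G ν i = g ν + ∑' i, G (ν + 1) i := by
      rw [(hGs ν).tsum_eq_add_tsum_ite ν]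
      simp only [hG, le_refl, if_true]
      congr 2
      ext i
      by_cases h1 : i = ν
      · subst h1; simp
      · rw [if_neg h1]
        by_cases h2 : ν ≤ i
        · rw [if_pos h2, if_pos (by omega)]
        · rw [if_neg h2, if_neg (by omega)]
    have h2 : g (ν + 1) ≤ ∑' i, G (ν + 1) i := by
      have := (hGs (ν + 1)).le_tsum (ν + 1) fun i _ => hG0 _ i
      simpa [hG] using this
    have h3 : g ν ≤ 1 / r * g (ν + 1) := by
      simp only [hg]
      rw [pow_succ, show 1 / r * (F (ν + 1 + 1) * (r ^ ν * r)) = F (ν + 1 + 1) * r ^ ν by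
        field_simp]
      exact mul_le_mul_of_nonneg_right (hFm (by omega)) (by positivity)
    have h4 : 1 / r * g (ν + 1) ≤ 1 / r * ∑' i, G (ν + 1) i :=
      mul_le_mul_of_nonneg_left h2 (by positivity)
    simp only
    rw [h1]
    linarith
  · have h1 : ∑ ν ∈ Finset.range N, (∑' i, G ν i) / τ ^ ν
        = ∑' i, ∑ ν ∈ Finset.range N, G ν i / τ ^ ν := by
      rw [Summable.tsum_finsetSum fun ν _ => (hGs ν).div_const _]
      refine Finset.sum_congr rfl fun ν _ => ?_
      rw [tsum_div_const]
    rw [h1]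
    have h1τ : 0 < 1 - τ := by linarith
    have h2 : ∀ i, ∑ ν ∈ Finset.range N, G ν i / τ ^ ν ≤ a i / (1 - τ) := by
      intro i
      calc ∑ ν ∈ Finset.range N, G ν i / τ ^ ν
          = ∑ ν ∈ (Finset.range N).filter (· ≤ i), g i / τ ^ ν := by
            rw [Finset.sum_filter]
            refine Finset.sum_congr rfl fun ν _ => ?_
            simp only [hG]; split_ifs <;> simp
        _ ≤ ∑ ν ∈ Finset.range (i + 1), g i / τ ^ ν := by
            refine Finset.sum_le_sum_of_subset_of_nonneg (fun ν hν => ?_)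
              fun ν _ _ => div_nonneg (hg0 i) (by positivity)
            rw [Finset.mem_filter] at hν
            exact Finset.mem_range.2 (by omega)
        _ = ∑ ν ∈ Finset.range (i + 1), a i * τ ^ ν := by
            rw [← Finset.sum_range_reflect]
            refine Finset.sum_congr rfl fun ν hν => ?_
            rw [Finset.mem_range] at hν
            rw [hga, show i + 1 - 1 - ν = i - ν by omega, div_eq_iff (by positivity),
              mul_assoc, ← pow_add, show ν + (i - ν) = i by omega, mul_comm]
        _ = a i * ∑ ν ∈ Finset.range (i + 1), τ ^ ν := by rw [Finset.mul_sum]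
        _ ≤ a i * (1 - τ)⁻¹ := by
            refine mul_le_mul_of_nonneg_left ?_ (ha0 i)
            rw [← tsum_geometric_of_lt_one hτ0.le hτ1]
            exact (summable_geometric_of_lt_one hτ0.le hτ1).sum_le_tsum _ fun i _ => by positivity
        _ = _ := rfl
    have h3 : Summable fun i => a i / (1 - τ) := has.div_const _
    calc ∑' i, ∑ ν ∈ Finset.range N, G ν i / τ ^ ν ≤ ∑' i, a i / (1 - τ) :=
          (summable_sum fun ν _ => (hGs ν).div_const _).tsum_le_tsum h2 h3
      _ = (∑' i, a i) / (1 - τ) := tsum_div_const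
      _ ≤ _ := by gcongr
  · intro V ν A hV hA hμA
    refine (setLIntegral_sq_le_tsum hf (sq_nonneg r) (by nlinarith) hF hV ν hA hμA).trans ?_
    rw [ENNReal.ofReal_mul (by linarith)]
    refine mul_le_mul_right ?_ _
    rw [ENNReal.ofReal_pow (tsum_nonneg (hG0 ν)), ENNReal.ofReal_tsum_of_nonneg (hG0 ν) (hGs ν)]
    refine le_trans (le_of_eq ?_) (tsum_sq_le_sq_tsum _)
    congr 1
    ext i
    simp only [hG, hg]
    split_ifs
    · rw [← ENNReal.ofReal_pow (mul_nonneg (hF0 _) (by positivity))]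
      congr 1
      rw [mul_pow, ← pow_mul, ← pow_mul, mul_comm 2 i]
    · simp

end LevelSets

/-! ### The estimate at the centre of the unit cube -/

section CubeEstimate

open Filter Function Metric
open scoped Topology ContDiff NNReal

theorem truncEnergy_mono_radius {d : ℕ} {p : ℝ} (hp : 0 ≤ p) (v : (Fin d → ℝ) → ℝ)
    (G : Fin d → (Fin d → ℝ) → ℝ) (k : ℝ) {ρ ρ' : ℝ} (h : ρ ≤ ρ') :
    truncEnergy p v G k ρ ≤ truncEnergy p v G k ρ' :=
  add_le_add (lintegral_mono_set (ball_subset_ball h))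
    (ENNReal.rpow_le_rpow (lintegral_mono_set (ball_subset_ball h)) (by positivity))

theorem le_of_truncEnergy_eq_zero {d : ℕ} {p : ℝ} (hp : 0 < p) {v : (Fin d → ℝ) → ℝ}
    (hv : Continuous v) {G : Fin d → (Fin d → ℝ) → ℝ} {k ρ : ℝ} (hρ : 0 < ρ)
    (h : truncEnergy p v G k ρ = 0) : v 0 ≤ k := by
  have hu : Continuous fun x => max (v x - k) 0 := (hv.sub continuous_const).max continuous_const
  have h1 : (∫⁻ x in ball 0 ρ, ‖max (v x - k) 0‖ₑ ^ p) ^ (2 / p) = 0 := (add_eq_zero.1 h).2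
  rw [ENNReal.rpow_eq_zero_iff_of_pos (by positivity),
    lintegral_eq_zero_iff (hu.measurable.enorm.pow_const p)] at h1
  have h2 : (fun x => max (v x - k) 0) =ᵐ[volume.restrict (ball 0 ρ)] fun _ => 0 := by
    filter_upwards [h1] with x hx
    simpa [ENNReal.rpow_eq_zero_iff_of_pos hp] using hx
  have h3 := Measure.eqOn_open_of_ae_eq h2 isOpen_ball hu.continuousOn continuousOn_const
    (mem_ball_self hρ)
  have h4 := le_max_left (v 0 - k) 0
  rw [show max (v 0 - k) 0 = 0 from h3] at h4
  linarith

set_option maxHeartbeats 1600000 in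
/-- The local boundedness estimate at the centre of the unit cube, in dimension `m + 1`. The right-hand
side enters through levels `F i` that `|f|` exceeds on sets of measure at most `θⁱ` only. -/
theorem exists_cube_const {m : ℕ} (hm : 2 ≤ m) {σ : ℝ} (hσ : 0 < σ)
    (hσm : ((m : ℝ) - 2) / 2 ≤ σ) (cm : ℝ) :
    ∃ θ C : ℝ, 0 < θ ∧ θ < 1 ∧ 1 ≤ C ∧ ∀ {M₁ M₂ k₀ L I : ℝ} {v : (Fin (m + 1) → ℝ) → ℝ}
      {G : Fin (m + 1) → (Fin (m + 1) → ℝ) → ℝ} {f : (Fin (m + 1) → ℝ) → ℝ} {F : ℕ → ℝ},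
      1 ≤ M₁ → 0 ≤ M₂ → CaccioppoliOnCube cm M₁ M₂ k₀ v G f → AEMeasurable f →
      (∀ i, 0 ≤ F i) → Monotone F → (∀ i, volume {x | F i < |f x|} ≤ ENNReal.ofReal (θ ^ i)) →
      (∀ N, ∑ i ∈ Finset.range N, F (i + 1) * (θ ^ (1 / ((m : ℝ) + 1))) ^ i ≤ L) → 0 ≤ I →
      ∫⁻ x in ball 0 1, ‖max (v x - k₀) 0‖ₑ ^ 2 ≤ ENNReal.ofReal (I ^ 2) →
      v 0 ≤ k₀ + C * M₁ ^ σ * (M₁ * I + M₂ * L) := by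
  have hm2 : (2:ℝ) ≤ m := by exact_mod_cast hm
  have hm1 : 0 < (m:ℝ) - 1 := by linarith
  -- `p` is the critical Sobolev exponent in dimension `m + 1`
  set p : ℝ := 2 * (m + 1) / (m - 1) with hp
  have hp2 : 2 < p := by rw [hp, lt_div_iff₀ hm1]; linarith
  have hp0 : 0 < p := by linarith
  set α : ℝ := 1 / σ with hα
  have hα0 : 0 < α := by positivity
  have hασ : 1 / α = σ := by rw [hα, one_div_one_div]
  obtain ⟨Cp, hCp⟩ := exists_sobolev_const (d := m + 1) (by omega) hp2.le
    (le_of_eq (by rw [hp]; push_cast; field_simp; ring))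
  -- the lower bound on `σ` says that `2 + 2α` is at most critical in dimension `m`
  obtain ⟨Cq, hCq⟩ := exists_sobolev_const (d := m) hm (q := 2 + 2 * α) (by linarith) (by
    rw [hα]
    have h1 : 1 / (2 + 2 * (1 / σ)) = σ / (2 * (σ + 1)) := by field_simp
    have h2 : 1 / 2 - 1 / (m:ℝ) = (m - 2) / (2 * m) := by field_simp
    rw [h1, h2, div_le_div_iff₀ (by positivity) (by positivity)]
    nlinarith)
  obtain ⟨CS, hCS0, hCS⟩ := CaccioppoliOnCube.exists_step_const hp2 hα0 hCp hCq cm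
  obtain ⟨CI, hCI0, hCI⟩ := CaccioppoliOnCube.exists_initial_const hp2 hCp cm
  set β : ℝ := 6 + 4 * α with hβ
  have hβ0 : 0 < β := by positivity
  set b : ℝ := 2 ^ β with hb
  have hb1 : 1 < b := Real.one_lt_rpow (by norm_num) hβ0
  have hb0 : 0 < b := by linarith
  -- `τ` compensates for the growth `bᵛ` of the constants
  set τ : ℝ := b ^ (-(1 / (2 * α))) with hτ
  have hτ0 : 0 < τ := Real.rpow_pos_of_pos hb0 _
  have hτ1 : τ < 1 := Real.rpow_lt_one_of_one_lt_of_neg hb1 (by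
    have : 0 < 1 / (2 * α) := by positivity
    linarith)
  have hbτ : b * τ ^ (2 * α) ≤ 1 := by
    rw [hτ, ← Real.rpow_mul hb0.le, show -(1 / (2 * α)) * (2 * α) = -1 by field_simp,
      Real.rpow_neg_one, mul_inv_cancel₀ hb0.ne']
  set r : ℝ := τ ^ (p / 2) with hr
  have hr0 : 0 < r := Real.rpow_pos_of_pos hτ0 _
  have hr1 : r < 1 := Real.rpow_lt_one hτ0.le hτ1 (by positivity)
  have hr2 : r ^ 2 = τ ^ p := by
    rw [hr, ← Real.rpow_natCast, ← Real.rpow_mul hτ0.le]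
    congr 1; push_cast; ring
  -- with `θ = r² = τᵖ`, the critical exponent `p` makes `θ ^ (1 / n)` the right weight in the norm
  have hθρ : r = τ * (r ^ 2) ^ (1 / ((m:ℝ) + 1)) := by
    rw [hr2, ← Real.rpow_mul hτ0.le, hr]
    nth_rewrite 2 [← Real.rpow_one τ]
    rw [← Real.rpow_add hτ0]
    congr 1
    rw [hp]; field_simp; ring
  set W : ℝ := 2 ^ (m + 1) with hW
  have hW1 : 1 ≤ W := one_le_pow₀ (by norm_num)
  set C₀ : ℝ := 1 + (CS + CS * 8 ^ β) + CI * W with hC₀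
  have h8 : (0:ℝ) < 8 ^ β := Real.rpow_pos_of_pos (by norm_num) _
  have hCSpos : 0 ≤ CS * 8 ^ β := by positivity
  have hCIW : 0 ≤ CI * W := by positivity
  obtain ⟨K, hK1, hK⟩ := exists_deGiorgi_const (C := C₀) (b := b) (α := α) (τ := τ)
    (Λ := 1 + 1 / r) (by linarith) hb1.le hα0 hτ0 hτ1 hbτ
    (by have : 0 < 1 / r := by positivity
        linarith)
  have h1τ : 0 < 1 - τ := by linarith
  have hKτ : K ≤ K / (1 - τ) := by
    rw [le_div_iff₀ h1τ]
    nlinarith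
  refine ⟨r ^ 2, K / (1 - τ), by positivity, by nlinarith, hK1.trans hKτ, ?_⟩
  intro M₁ M₂ k₀ L I v G f F hM₁ hM₂ h hf hF0 hFm hF hL hI hIle
  obtain ⟨H, hH0, hHΛ, hHL, hHA⟩ := exists_tail_sequence hf hF0 hFm hr0 hr1 hτ0 hτ1 hθρ hF hL
  have hL0 : 0 ≤ L := by simpa using hL 0
  set R : ℕ → ℝ := fun ν => 1 / 2 + 1 / 4 * (1 / 2) ^ ν with hR
  have hRhalf : ∀ ν, 1 / 2 ≤ R ν := fun ν => le_add_of_nonneg_right (by positivity)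
  have hRsucc : ∀ ν, R ν - R (ν + 1) = 1 / 8 * (1 / 2) ^ ν := fun ν => by
    simp only [hR]; rw [pow_succ]; ring
  have hR1 : ∀ ν, R ν < 1 := fun ν => by
    have : ((1:ℝ) / 2) ^ ν ≤ 1 := pow_le_one₀ (by norm_num) (by norm_num)
    simp only [hR]; linarith
  set J : ℝ → ℕ → ℝ := fun k ν => (truncEnergy p v G k (R ν)).toReal with hJ
  have hJt : ∀ k ν, truncEnergy p v G k (R ν) ≠ ⊤ := fun k ν => h.truncEnergy_ne_top hp0.le k _
  have hJof : ∀ k ν, truncEnergy p v G k (R ν) = ENNReal.ofReal (J k ν) := fun k ν =>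
    (ENNReal.ofReal_toReal (hJt k ν)).symm
  have hJ0 : ∀ k ν, 0 ≤ J k ν := fun k ν => ENNReal.toReal_nonneg
  have hvol : volume (ball (0 : Fin (m + 1) → ℝ) 1) ≤ ENNReal.ofReal (W * (r ^ 2) ^ 0) := by
    rw [Real.volume_pi_ball _ one_pos]
    simp [hW]
  have hinit : ∀ Y, M₁ * I ≤ Y → J k₀ 0 ≤ C₀ * (Y + M₂ * H 0) ^ 2 := by
    intro Y hY
    have hR0 : R 0 = 3 / 4 := by simp only [hR]; norm_num
    have h1 := hCI hM₁ h
    rw [← hR0, hJof] at h1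
    have h2 := h1.trans (add_le_add (mul_le_mul_right hIle _)
      (mul_le_mul_right (hHA W 0 _ hW1 measurableSet_ball hvol) _))
    rw [← ENNReal.ofReal_mul (by positivity), ← ENNReal.ofReal_mul (by positivity),
      ← ENNReal.ofReal_add (by positivity) (by positivity),
      ENNReal.ofReal_le_ofReal_iff (by positivity)] at h2
    have hY0 : 0 ≤ M₁ * I := by positivity
    have hMH : 0 ≤ M₂ * H 0 := mul_nonneg hM₂ (hH0 0)
    calc J k₀ 0 ≤ CI * (M₁ * I) ^ 2 + CI * W * (M₂ * H 0) ^ 2 := by linarith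
      _ ≤ CI * W * (M₁ * I) ^ 2 + CI * W * (M₂ * H 0) ^ 2 := by
          gcongr
          exact le_mul_of_one_le_right hCI0 hW1
      _ = CI * W * ((M₁ * I) ^ 2 + (M₂ * H 0) ^ 2) := by ring
      _ ≤ C₀ * (Y + M₂ * H 0) ^ 2 := by
          refine mul_le_mul (by linarith) ?_ (by positivity) (by linarith)
          nlinarith
  have hstep : ∀ k Δ ν, k₀ ≤ k → 0 < Δ → J k ν ≤ (Δ * τ ^ (ν + 1)) ^ 2 →
      J (k + Δ) (ν + 1) ≤ C₀ * b ^ ν * M₁ ^ 2 * Δ ^ (-(2 * α)) * J k ν ^ (1 + α) +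
        C₀ * M₂ ^ 2 * H (ν + 1) ^ 2 := by
    intro k Δ ν hk hΔ hJΔ
    have hch := h.measure_superlevel_le hp0 k (R ν) hΔ (τ := τ ^ (ν + 1)) (by positivity)
      (by rw [hJof]; exact ENNReal.ofReal_le_ofReal hJΔ)
    have hτp : (τ ^ (ν + 1)) ^ p = 1 * (r ^ 2) ^ (ν + 1) := by
      rw [hr2, one_mul, ← Real.rpow_natCast, ← Real.rpow_natCast, ← Real.rpow_mul hτ0.le,
        ← Real.rpow_mul hτ0.le, mul_comm]
    rw [hτp] at hch
    have hf2 := hHA 1 (ν + 1) _ le_rfl (measurableSet_ball.inter (h.measurableSet_lt _)) hch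
    have h1 := hCS hM₁ h k Δ (R (ν + 1)) (R ν) hk hΔ (by linarith [hRhalf (ν + 1)])
      (by have := hRsucc ν
          have : (0:ℝ) < 1 / 8 * (1 / 2) ^ ν := by positivity
          linarith) (hR1 ν)
    have hs : (R ν - R (ν + 1)) ^ (-β) = 8 ^ β * b ^ ν := by
      rw [hRsucc, Real.mul_rpow (by norm_num) (by positivity), hb]
      congr 1
      · rw [Real.rpow_neg (by norm_num), ← Real.inv_rpow (by norm_num)]; norm_num
      · rw [Real.rpow_neg (by positivity), ← Real.inv_rpow (by positivity), ← Real.rpow_natCast,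
          ← Real.rpow_natCast, ← Real.rpow_mul (by norm_num), ← Real.inv_rpow (by norm_num),
          ← Real.rpow_mul (by norm_num), mul_comm]
        norm_num
    rw [hs, hJof, hJof] at h1
    have h2 := h1.trans (add_le_add le_rfl (mul_le_mul_right hf2 _))
    have hΔα : 0 < Δ ^ (-(2 * α)) := Real.rpow_pos_of_pos hΔ _
    have hJα : 0 ≤ J k ν ^ (1 + α) := Real.rpow_nonneg (hJ0 _ _) _
    rw [ENNReal.ofReal_rpow_of_nonneg (hJ0 _ _) (by positivity),
      ← ENNReal.ofReal_mul (by positivity), ← ENNReal.ofReal_mul (by positivity),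
      ← ENNReal.ofReal_add (by positivity) (by positivity),
      ENNReal.ofReal_le_ofReal_iff (by positivity)] at h2
    refine h2.trans (add_le_add ?_ ?_)
    · calc _ = CS * 8 ^ β * (b ^ ν * M₁ ^ 2 * Δ ^ (-(2 * α)) * J k ν ^ (1 + α)) := by ring
        _ ≤ C₀ * (b ^ ν * M₁ ^ 2 * Δ ^ (-(2 * α)) * J k ν ^ (1 + α)) :=
            mul_le_mul_of_nonneg_right (by linarith) (by positivity)
        _ = _ := by ring
    · calc _ = CS * (M₂ ^ 2 * H (ν + 1) ^ 2) := by ring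
        _ ≤ C₀ * (M₂ ^ 2 * H (ν + 1) ^ 2) :=
            mul_le_mul_of_nonneg_right (by linarith) (by positivity)
        _ = _ := by ring
  have hMσ : 0 < M₁ ^ σ := Real.rpow_pos_of_pos (by linarith) _
  -- the estimate with an arbitrary positive number in place of a possibly vanishing average
  have hY : ∀ Y, 0 < Y → M₁ * I ≤ Y → v 0 ≤ k₀ + K / (1 - τ) * M₁ ^ σ * (Y + M₂ * L) := by
    intro Y hY hIY
    set k' := k₀ + K * M₁ ^ σ * (Y + M₂ * (L / (1 - τ))) with hk'
    have hlim : ∀ ν : ℕ, truncEnergy p v G k' (1 / 2) ≤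
        ENNReal.ofReal (K * (τ ^ ν * (Y + M₂ * (L / (1 - τ)))) ^ 2) := by
      intro ν
      obtain ⟨k, -, hk, hJk⟩ := hK hM₁ hM₂ hY hH0 hHΛ hHL hJ0 (hinit Y hIY) hstep ν
      rw [hασ] at hk
      calc truncEnergy p v G k' (1 / 2) ≤ truncEnergy p v G k (R ν) :=
            (CaccioppoliOnCube.truncEnergy_anti hp0.le hk _).trans
              (truncEnergy_mono_radius hp0.le _ _ _ (hRhalf ν))
        _ = ENNReal.ofReal (J k ν) := hJof k ν
        _ ≤ _ := ENNReal.ofReal_le_ofReal hJk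
    have hzero : truncEnergy p v G k' (1 / 2) = 0 := by
      refine le_antisymm (ge_of_tendsto' (x := atTop) ?_ hlim) zero_le
      have h1 := tendsto_pow_atTop_nhds_zero_of_lt_one hτ0.le hτ1
      have h2 := ENNReal.tendsto_ofReal
        (((h1.mul_const (Y + M₂ * (L / (1 - τ)))).pow 2).const_mul K)
      simpa using h2
    have h3 := le_of_truncEnergy_eq_zero hp0 h.continuous (by norm_num) hzero
    refine h3.trans ?_
    rw [hk']
    have h4 : K * M₁ ^ σ * (Y + M₂ * (L / (1 - τ))) ≤ K / (1 - τ) * M₁ ^ σ * (Y + M₂ * L) := by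
      have h5 : K * M₁ ^ σ * Y ≤ K / (1 - τ) * M₁ ^ σ * Y := by gcongr
      calc _ = K * M₁ ^ σ * Y + K / (1 - τ) * M₁ ^ σ * (M₂ * L) := by ring
        _ ≤ _ := by linarith
    linarith
  refine le_of_forall_pos_le_add fun ε hε => ?_
  have hKp : 0 < K / (1 - τ) := by positivity
  have h1 := hY (M₁ * I + ε / (K / (1 - τ) * M₁ ^ σ)) (by positivity)
    (le_add_of_nonneg_right (by positivity))
  refine h1.trans (le_of_eq ?_)
  have : K / (1 - τ) * M₁ ^ σ * (ε / (K / (1 - τ) * M₁ ^ σ)) = ε :=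
    mul_div_cancel₀ _ (by positivity)
  calc _ = k₀ + K / (1 - τ) * M₁ ^ σ * (M₁ * I + M₂ * L)
        + K / (1 - τ) * M₁ ^ σ * (ε / (K / (1 - τ) * M₁ ^ σ)) := by ring
    _ = _ := by rw [this]

end CubeEstimate

/-! ### Rearrangements and the Lorentz norm -/

section Lorentz

open scoped Topology

variable {n : ℕ}

theorem rearrangement_anti (f : EuclideanSpace ℝ (Fin n) → ℝ) {s t : ℝ} (hst : s ≤ t) :
    rearrangement f t ≤ rearrangement f s :=
  le_iInf₂ fun σ hσ => iInf₂_le σ ⟨hσ.1, hσ.2.trans (ENNReal.ofReal_le_ofReal hst)⟩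

/-- By Chebyshev's inequality the rearrangement of an `L²` function is finite. -/
theorem rearrangement_ne_top {f : EuclideanSpace ℝ (Fin n) → ℝ} (hf : MemLp f 2 volume) {t : ℝ}
    (ht : 0 < t) : rearrangement f t ≠ ⊤ := by
  have hN : ∫⁻ x, ‖f x‖ₑ ^ 2 ≠ ⊤ := by
    have := lintegral_rpow_enorm_lt_top_of_eLpNorm_lt_top (by norm_num) (by norm_num) hf.2
    simpa using this.ne
  set N := (∫⁻ x, ‖f x‖ₑ ^ 2).toReal with hNdef
  have hN0 : 0 ≤ N := ENNReal.toReal_nonneg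
  set σ : ℝ := Real.sqrt (N / t) + 1 with hσ
  have hσ0 : 0 < σ := by positivity
  have hσ2 : N ≤ t * σ ^ 2 := by
    have h1 : N / t ≤ σ ^ 2 := by
      rw [hσ]
      nlinarith [Real.sq_sqrt (show 0 ≤ N / t by positivity), Real.sqrt_nonneg (N / t)]
    rw [div_le_iff₀ ht] at h1
    linarith
  have hmeas : volume {x | σ < |f x|} ≤ ENNReal.ofReal t := by
    have h1 : ENNReal.ofReal (σ ^ 2) * volume {x | σ < |f x|} ≤ ∫⁻ x, ‖f x‖ₑ ^ 2 := by
      refine le_trans (mul_le_mul_right (measure_mono fun x hx => ?_) _)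
        (mul_meas_ge_le_lintegral₀ (hf.aestronglyMeasurable.enorm.pow_const 2)
          (ENNReal.ofReal (σ ^ 2)))
      change ENNReal.ofReal (σ ^ 2) ≤ ‖f x‖ₑ ^ 2
      rw [← ofReal_norm, ← ENNReal.ofReal_pow (norm_nonneg _)]
      exact ENNReal.ofReal_le_ofReal (pow_le_pow_left₀ hσ0.le (le_of_lt hx) 2)
    have h2 : ∫⁻ x, ‖f x‖ₑ ^ 2 ≤ ENNReal.ofReal (σ ^ 2) * ENNReal.ofReal t := by
      rw [← ENNReal.ofReal_mul (sq_nonneg σ), ← ENNReal.ofReal_toReal hN, mul_comm]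
      exact ENNReal.ofReal_le_ofReal hσ2
    have hpos : ENNReal.ofReal (σ ^ 2) ≠ 0 := by
      have : 0 < σ ^ 2 := by positivity
      exact (ENNReal.ofReal_pos.2 this).ne'
    exact (ENNReal.mul_le_mul_iff_right hpos ENNReal.ofReal_ne_top).1 (h1.trans h2)
  exact ne_top_of_le_ne_top ENNReal.ofReal_ne_top (iInf₂_le σ ⟨hσ0, hmeas⟩)

/-- The infimum in the definition of the rearrangement is attained. -/
theorem volume_rearrangement_lt_le (f : EuclideanSpace ℝ (Fin n) → ℝ) {t : ℝ}
    (hf : rearrangement f t ≠ ⊤) :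
    volume {x | (rearrangement f t).toReal < |f x|} ≤ ENNReal.ofReal t := by
  set a := (rearrangement f t).toReal with ha
  have ha0 : 0 ≤ a := ENNReal.toReal_nonneg
  set A : ℕ → Set (EuclideanSpace ℝ (Fin n)) := fun j => {x | a + 1 / ((j : ℝ) + 1) < |f x|} with hA
  have hmono : Monotone A := by
    intro i j hij x hx
    simp only [hA, mem_ofPred_eq] at hx ⊢
    refine lt_of_le_of_lt ?_ hx
    exact add_le_add le_rfl (one_div_le_one_div_of_le (by positivity) (by gcongr))
  have hsub : {x | a < |f x|} ⊆ ⋃ j, A j := by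
    intro x hx
    obtain ⟨j, hj⟩ := exists_nat_one_div_lt (sub_pos.2 (show a < |f x| from hx))
    exact mem_iUnion.2 ⟨j, show a + 1 / ((j : ℝ) + 1) < |f x| by linarith⟩
  refine (measure_mono hsub).trans ?_
  rw [hmono.measure_iUnion]
  refine iSup_le fun j => ?_
  have hlt : rearrangement f t < ENNReal.ofReal (a + 1 / ((j : ℝ) + 1)) := by
    rw [← ENNReal.ofReal_toReal hf, ← ha]
    exact (ENNReal.ofReal_lt_ofReal_iff (by positivity)).2 (lt_add_of_pos_right _ (by positivity))
  obtain ⟨σ, hσ⟩ := iInf_lt_iff.1 hlt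
  obtain ⟨⟨hσ0, hσt⟩, hσa⟩ := iInf_lt_iff.1 hσ
  rw [ENNReal.ofReal_lt_ofReal_iff (by positivity)] at hσa
  exact (measure_mono fun x (hx : _ < _) => hσa.trans hx).trans hσt

/-- A lower bound for the Lorentz norm by the values of the rearrangement at `Sⁿθ, Sⁿθ², …`: on
`(Sⁿθⁱ⁺², Sⁿθⁱ⁺¹]` the integrand is at least its value at the right endpoint. -/
theorem sum_rearrangement_le_lorentzNorm (hn : 1 ≤ n) {Ω : Set (EuclideanSpace ℝ (Fin n))}
    {f : EuclideanSpace ℝ (Fin n) → ℝ} {S θ : ℝ} (hS : 0 < S) (hθ0 : 0 < θ) (hθ1 : θ < 1)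
    (hΩ : ENNReal.ofReal (S ^ n) ≤ volume Ω) (N : ℕ) :
    ∑ i ∈ Finset.range N, ENNReal.ofReal ((1 - θ) * S * (θ ^ (1 / (n : ℝ))) ^ (i + 1)) *
      rearrangement (Ω.indicator f) (S ^ n * θ ^ (i + 1)) ≤ lorentzNorm Ω f := by
  have hn0 : (0:ℝ) < n := by exact_mod_cast hn
  have hn1 : (1:ℝ) ≤ n := by exact_mod_cast hn
  set t : ℕ → ℝ := fun i => S ^ n * θ ^ (i + 1) with ht
  have ht0 : ∀ i, 0 < t i := fun i => by positivity
  have htS : ∀ i, t i < S ^ n := fun i => by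
    have : θ ^ (i + 1) < 1 := pow_lt_one₀ hθ0.le hθ1 (by omega)
    have h2 : 0 < S ^ n := by positivity
    simp only [ht]; nlinarith
  have hanti : Antitone t := antitone_nat_of_succ_le fun i => by
    simp only [ht]
    rw [pow_succ θ (i + 1)]
    have : 0 < S ^ n * θ ^ (i + 1) := ht0 i
    nlinarith
  set Φ : ℝ → ℝ≥0∞ := fun s => ENNReal.ofReal (s ^ (1 / (n : ℝ)) / s) *
    rearrangement (Ω.indicator f) s with hΦ
  have hstep : ∀ i, ENNReal.ofReal ((1 - θ) * S * (θ ^ (1 / (n : ℝ))) ^ (i + 1)) *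
      rearrangement (Ω.indicator f) (t i) ≤ ∫⁻ s in Ioc (t (i + 1)) (t i), Φ s := by
    intro i
    have hti := ht0 i
    calc ENNReal.ofReal ((1 - θ) * S * (θ ^ (1 / (n : ℝ))) ^ (i + 1)) *
          rearrangement (Ω.indicator f) (t i)
        = ENNReal.ofReal (t i ^ (1 / (n : ℝ)) / t i) * rearrangement (Ω.indicator f) (t i) *
            volume (Ioc (t (i + 1)) (t i)) := by
          have h1 : t i - t (i + 1) = (1 - θ) * t i := by
            simp only [ht]; ring
          have h2 : t i ^ (1 / (n : ℝ)) = S * (θ ^ (1 / (n : ℝ))) ^ (i + 1) := by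
            simp only [ht]
            rw [Real.mul_rpow (by positivity) (by positivity), ← Real.rpow_natCast S n,
              ← Real.rpow_mul hS.le, mul_one_div_cancel hn0.ne', Real.rpow_one,
              ← Real.rpow_natCast, ← Real.rpow_natCast, ← Real.rpow_mul hθ0.le,
              ← Real.rpow_mul hθ0.le, mul_comm (1 / (n : ℝ))]
          rw [Real.volume_Ioc, h1, mul_right_comm (ENNReal.ofReal _) (rearrangement _ _), ← ENNReal.ofReal_mul (by positivity), h2]
          congr 2
          field_simp
      _ = ∫⁻ _ in Ioc (t (i + 1)) (t i), ENNReal.ofReal (t i ^ (1 / (n : ℝ)) / t i) *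
            rearrangement (Ω.indicator f) (t i) := (setLIntegral_const _ _).symm
      _ ≤ _ := by
          refine setLIntegral_mono' measurableSet_Ioc fun s hs => ?_
          have hs0 : 0 < s := (ht0 _).trans hs.1
          refine mul_le_mul' (ENNReal.ofReal_le_ofReal ?_) (rearrangement_anti _ hs.2)
          have e : ∀ x : ℝ, 0 < x → x ^ (1 / (n : ℝ)) / x = x ^ (1 / (n : ℝ) - 1) := fun x hx => by
            rw [Real.rpow_sub hx, Real.rpow_one]
          rw [e _ hti, e _ hs0]
          refine Real.rpow_le_rpow_of_nonpos hs0 hs.2 ?_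
          have : 1 / (n:ℝ) ≤ 1 := (div_le_one hn0).2 hn1
          linarith
  calc _ ≤ ∑ i ∈ Finset.range N, ∫⁻ s in Ioc (t (i + 1)) (t i), Φ s :=
        Finset.sum_le_sum fun i _ => hstep i
    _ ≤ ∑' i, ∫⁻ s in Ioc (t (i + 1)) (t i), Φ s := ENNReal.sum_le_tsum _
    _ = ∫⁻ s in ⋃ i, Ioc (t (i + 1)) (t i), Φ s :=
        (lintegral_iUnion (fun i => measurableSet_Ioc)
          hanti.pairwise_disjoint_on_Ioc_succ _).symm
    _ ≤ _ := by
        refine lintegral_mono_set (iUnion_subset fun i s hs => ⟨(ht0 _).trans hs.1, ?_⟩)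
        refine lt_of_lt_of_le ?_ hΩ
        exact (ENNReal.ofReal_lt_ofReal_iff (by positivity)).2 (hs.2.trans_lt (htS i))

end Lorentz

/-! ### Weak gradients on Euclidean space -/

section WeakGradients

open Metric
open scoped ContDiff

variable {n : ℕ} {Ω : Set (EuclideanSpace ℝ (Fin n))} {v : EuclideanSpace ℝ (Fin n) → ℝ}
  {g : EuclideanSpace ℝ (Fin n) → EuclideanSpace ℝ (Fin n)}

/-- The coordinates of the gradient are the partial derivatives. -/
theorem gradient_apply (φ : EuclideanSpace ℝ (Fin n) → ℝ) (x : EuclideanSpace ℝ (Fin n))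
    (i : Fin n) : (∇ φ x) i = fderiv ℝ φ x (EuclideanSpace.single i 1) := by
  rw [← inner_gradient_left, EuclideanSpace.inner_single_right]
  simp

theorem locallyIntegrableOn_apply (hg : LocallyIntegrableOn g Ω volume) (i : Fin n) :
    LocallyIntegrableOn (fun x => g x i) Ω volume := fun x hx => by
  obtain ⟨U, hU, hi⟩ := hg x hx
  exact ⟨U, hU, (EuclideanSpace.proj (𝕜 := ℝ) i).integrable_comp hi⟩

theorem HasWeakGradient.hasWeakDirDeriv (h : HasWeakGradient Ω v g) (i : Fin n) :
    HasWeakDirDeriv volume Ω v (fun x => g x i) (EuclideanSpace.single i 1) := by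
  intro φ hφ hφc hφs
  have key := h.integral_eq φ hφ hφc hφs i
  rw [setIntegral_eq_integral_of_forall_compl_eq_zero,
    setIntegral_eq_integral_of_forall_compl_eq_zero] at key
  · simpa only [gradient_apply] using key
  · intro x hx
    rw [image_eq_zero_of_notMem_tsupport fun h => hx (hφs h), mul_zero]
  · intro x hx
    have : fderiv ℝ φ x = 0 := image_eq_zero_of_notMem_tsupport
      fun h => hx (hφs (tsupport_fderiv_subset ℝ h))
    rw [gradient_apply, this]
    simp

/-- The weak gradient of the truncation `(v - k)₊` is `1_{v > k} ∇v`. -/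
theorem HasWeakGradient.posPart (hΩ : IsOpen Ω) (h : HasWeakGradient Ω v g)
    (hv : ContinuousOn v Ω) (k : ℝ) :
    HasWeakGradient Ω (fun x => max (v x - k) 0) ((Ω ∩ {x | k < v x}).indicator g) where
  locallyIntegrableOn :=
    ((hv.sub continuousOn_const).sup continuousOn_const).locallyIntegrableOn hΩ.measurableSet
  locallyIntegrableOn_gradient := fun x hx => by
    obtain ⟨U, hU, hi⟩ := h.locallyIntegrableOn_gradient x hx
    have : IsOpen (Ω ∩ {x | k < v x}) := hv.isOpen_inter_preimage hΩ isOpen_Ioi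
    exact ⟨U, hU, hi.indicator this.measurableSet⟩
  integral_eq := by
    intro φ hφ hφc hφs i
    have key := (h.hasWeakDirDeriv i).posPart hΩ hv
      (locallyIntegrableOn_apply h.locallyIntegrableOn_gradient i) k φ hφ hφc hφs
    rw [setIntegral_eq_integral_of_forall_compl_eq_zero,
      setIntegral_eq_integral_of_forall_compl_eq_zero]
    · simp only [gradient_apply]
      rw [key]
      congr 1
      refine integral_congr_ae (.of_forall fun x => ?_)
      by_cases hx : x ∈ Ω
      · by_cases hk : k < v x <;> simp [indicator, hx, hk]
      · simp [image_eq_zero_of_notMem_tsupport fun h => hx (hφs h)]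
    · intro x hx
      rw [image_eq_zero_of_notMem_tsupport fun h => hx (hφs h), mul_zero]
    · intro x hx
      have : fderiv ℝ φ x = 0 := image_eq_zero_of_notMem_tsupport
        fun h => hx (hφs (tsupport_fderiv_subset ℝ h))
      rw [gradient_apply, this]
      simp

end WeakGradients

/-! ### Affine maps from the unit cube -/

section CubeMap

open Metric
open scoped ContDiff

variable {n : ℕ}

/-- The affine map carrying the unit cube `{|zᵢ| < 1}`, the unit ball of the sup norm, onto the
cube with centre `y` and half-side `S`. -/
noncomputable def cubeMap (y : EuclideanSpace ℝ (Fin n)) (S : ℝ) (z : Fin n → ℝ) :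
    EuclideanSpace ℝ (Fin n) := y + S • WithLp.toLp 2 z

/-- The inverse of `cubeMap`. -/
noncomputable def cubeMapInv (y : EuclideanSpace ℝ (Fin n)) (S : ℝ)
    (x : EuclideanSpace ℝ (Fin n)) : Fin n → ℝ := S⁻¹ • WithLp.ofLp (x - y)

variable {y : EuclideanSpace ℝ (Fin n)} {S : ℝ}

theorem cubeMapInv_cubeMap (hS : S ≠ 0) (z : Fin n → ℝ) : cubeMapInv y S (cubeMap y S z) = z := by
  ext i
  simp [cubeMap, cubeMapInv, hS]

theorem cubeMap_cubeMapInv (hS : S ≠ 0) (x : EuclideanSpace ℝ (Fin n)) :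
    cubeMap y S (cubeMapInv y S x) = x := by
  ext i
  simp [cubeMap, cubeMapInv, hS]

theorem contDiff_cubeMap {k : WithTop ℕ∞} : ContDiff ℝ k (cubeMap y S) :=
  contDiff_const.add ((PiLp.contDiff_toLp).const_smul S)

theorem contDiff_cubeMapInv {k : WithTop ℕ∞} : ContDiff ℝ k (cubeMapInv y S) :=
  ((PiLp.contDiff_ofLp).comp (contDiff_id.sub contDiff_const)).const_smul S⁻¹

theorem fderiv_cubeMap (z w : Fin n → ℝ) :
    fderiv ℝ (cubeMap y S) z w = S • WithLp.toLp 2 w := by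
  have h : HasFDerivAt (cubeMap y S)
      (S • ((PiLp.continuousLinearEquiv 2 ℝ fun _ : Fin n => ℝ).symm :
        (Fin n → ℝ) →L[ℝ] EuclideanSpace ℝ (Fin n))) z :=
    (((PiLp.continuousLinearEquiv 2 ℝ fun _ : Fin n => ℝ).symm.hasFDerivAt).const_smul S).const_add y
  rw [h.fderiv]
  rfl

theorem partialDeriv_comp_cubeMap {φ : EuclideanSpace ℝ (Fin n) → ℝ} {z : Fin n → ℝ}
    (hφ : DifferentiableAt ℝ φ (cubeMap y S z)) (i : Fin n) :
    partialDeriv i (fun z => φ (cubeMap y S z)) z = S * (∇ φ (cubeMap y S z)) i := by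
  have h := fderiv_comp z hφ ((contDiff_cubeMap (k := 1)).differentiable one_ne_zero z)
  change fderiv ℝ (φ ∘ cubeMap y S) z (Pi.single i 1) = _
  rw [h, ContinuousLinearMap.comp_apply, fderiv_cubeMap, map_smul, gradient_apply]
  rfl

theorem measurableEmbedding_cubeMap (hS : S ≠ 0) :
    MeasurableEmbedding (cubeMap (n := n) y S) := by
  let e : (Fin n → ℝ) ≃ₜ EuclideanSpace ℝ (Fin n) :=
    { toFun := cubeMap y S
      invFun := cubeMapInv y S
      left_inv := cubeMapInv_cubeMap hS
      right_inv := cubeMap_cubeMapInv hS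
      continuous_toFun := (contDiff_cubeMap (k := 0)).continuous
      continuous_invFun := (contDiff_cubeMapInv (k := 0)).continuous }
  exact e.measurableEmbedding

theorem map_cubeMap (hS : 0 < S) :
    Measure.map (cubeMap y S) volume
      = ENNReal.ofReal ((S ^ n)⁻¹) • (volume : Measure (EuclideanSpace ℝ (Fin n))) := by
  have h1 : Measure.map (fun z : Fin n → ℝ => (WithLp.toLp 2 z : EuclideanSpace ℝ (Fin n))) volume
      = volume := (PiLp.volume_preserving_toLp (Fin n)).map_eq
  have h2 := Measure.map_addHaar_smul (volume : Measure (EuclideanSpace ℝ (Fin n))) hS.ne'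
  have h3 : Measure.map (fun x : EuclideanSpace ℝ (Fin n) => y + x) volume = volume :=
    map_add_left_eq_self volume y
  have e : cubeMap y S = (fun x : EuclideanSpace ℝ (Fin n) => y + x) ∘
      ((fun x => S • x) ∘ fun z : Fin n → ℝ => WithLp.toLp 2 z) := rfl
  rw [e, ← Measure.map_map (by fun_prop) (by fun_prop), ← Measure.map_map (by fun_prop)
    (by fun_prop), h1, h2, Measure.map_smul, h3, finrank_euclideanSpace_fin,
    abs_of_pos (by positivity)]

theorem lintegral_comp_cubeMap (hS : 0 < S) (F : EuclideanSpace ℝ (Fin n) → ℝ≥0∞) :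
    ∫⁻ z, F (cubeMap y S z) = ENNReal.ofReal ((S ^ n)⁻¹) * ∫⁻ x, F x := by
  rw [← (measurableEmbedding_cubeMap hS.ne').lintegral_map, map_cubeMap hS, lintegral_smul_measure,
    smul_eq_mul]

theorem integral_comp_cubeMap (hS : 0 < S) (F : EuclideanSpace ℝ (Fin n) → ℝ) :
    ∫ z, F (cubeMap y S z) = (S ^ n)⁻¹ * ∫ x, F x := by
  rw [← (measurableEmbedding_cubeMap hS.ne').integral_map, map_cubeMap hS, integral_smul_measure,
    ENNReal.toReal_ofReal (by positivity), smul_eq_mul]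

theorem volume_preimage_cubeMap (hS : 0 < S) (A : Set (EuclideanSpace ℝ (Fin n))) :
    volume (cubeMap y S ⁻¹' A) = ENNReal.ofReal ((S ^ n)⁻¹) * volume A := by
  rw [← (measurableEmbedding_cubeMap hS.ne').map_apply, map_cubeMap hS, Measure.smul_apply,
    smul_eq_mul]

/-- The closed cube of half-side `S` around a point of `ball x₀ (R / 4)` lies in `ball x₀ R` if
`nS ≤ R / 2`, since the Euclidean norm is at most `n` times the sup norm. -/
theorem cubeMap_mem_ball {x₀ : EuclideanSpace ℝ (Fin n)} {R : ℝ} (hR : 0 < R) (hS : 0 ≤ S)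
    (hSR : n * S ≤ R / 2) (hy : y ∈ ball x₀ (R / 4)) {z : Fin n → ℝ} (hz : ‖z‖ ≤ 1) :
    cubeMap y S z ∈ ball x₀ R := by
  have h1 : ‖(WithLp.toLp 2 z : EuclideanSpace ℝ (Fin n))‖ ≤ n := by
    rw [EuclideanSpace.norm_eq]
    refine Real.sqrt_le_iff.2 ⟨n.cast_nonneg, ?_⟩
    calc ∑ i, ‖z i‖ ^ 2 ≤ ∑ i : Fin n, (1:ℝ) := Finset.sum_le_sum fun i _ =>
          pow_le_one₀ (norm_nonneg _) ((norm_le_pi_norm z i).trans hz)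
      _ = n := by simp
      _ ≤ n ^ 2 := by exact_mod_cast Nat.le_self_pow two_ne_zero n
  rw [mem_ball, dist_eq_norm] at hy ⊢
  have e : cubeMap y S z - x₀ = (y - x₀) + S • WithLp.toLp 2 z := by simp only [cubeMap]; abel
  rw [e]
  refine (norm_add_le _ _).trans_lt ?_
  rw [norm_smul, Real.norm_of_nonneg hS]
  have : S * ‖(WithLp.toLp 2 z : EuclideanSpace ℝ (Fin n))‖ ≤ S * n :=
    mul_le_mul_of_nonneg_left h1 hS
  linarith

theorem hasCompactSupport_comp_cubeMapInv (hS : S ≠ 0) {φ : (Fin n → ℝ) → ℝ}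
    (hφ : HasCompactSupport φ) : HasCompactSupport (fun x => φ (cubeMapInv y S x)) ∧
      tsupport (fun x => φ (cubeMapInv y S x)) ⊆ cubeMap y S '' tsupport φ := by
  have hK : IsCompact (cubeMap y S '' tsupport φ) :=
    IsCompact.image hφ (contDiff_cubeMap (k := 0)).continuous
  have hs : Function.support (fun x => φ (cubeMapInv y S x)) ⊆ cubeMap y S '' tsupport φ :=
    fun x hx => ⟨cubeMapInv y S x, subset_tsupport _ hx, cubeMap_cubeMapInv hS x⟩
  exact ⟨HasCompactSupport.of_support_subset_isCompact hK hs, closure_minimal hs hK.isClosed⟩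

/-- Weak derivatives under the change of variables `cubeMap`. The functions `w` and `W` have to be
the transplanted ones on `D` only. -/
theorem HasWeakDirDeriv.comp_cubeMap (hS : 0 < S) {Ω : Set (EuclideanSpace ℝ (Fin n))}
    {u U : EuclideanSpace ℝ (Fin n) → ℝ} {i : Fin n}
    (h : HasWeakDirDeriv volume Ω u U (EuclideanSpace.single i 1)) {w W : (Fin n → ℝ) → ℝ}
    {D : Set (Fin n → ℝ)} (hD : MapsTo (cubeMap y S) D Ω) (hw : ∀ z ∈ D, w z = u (cubeMap y S z))
    (hW : ∀ z ∈ D, W z = S * U (cubeMap y S z)) :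
    HasWeakDirDeriv volume D w W (Pi.single i 1) := by
  intro φ hφ hφc hφs
  obtain ⟨hψc, hψs⟩ := hasCompactSupport_comp_cubeMapInv (y := y) hS.ne' hφc
  have hψ : ContDiff ℝ ∞ fun x => φ (cubeMapInv y S x) := hφ.comp contDiff_cubeMapInv
  set ψ := fun x => φ (cubeMapInv y S x) with hψdef
  have hφψ : φ = fun z => ψ (cubeMap y S z) := by
    ext z
    simp only [hψdef, cubeMapInv_cubeMap hS.ne']
  have key := h ψ hψ hψc (hψs.trans ((image_mono hφs).trans hD.image_subset))
  have e1 : ∫ z, w z * fderiv ℝ φ z (Pi.single i 1)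
      = S * ((S ^ n)⁻¹ * ∫ x, u x * fderiv ℝ ψ x (EuclideanSpace.single i 1)) := by
    rw [← integral_comp_cubeMap (y := y) hS, ← integral_const_mul]
    refine integral_congr_ae (.of_forall fun z => ?_)
    have e : fderiv ℝ φ z (Pi.single i 1)
        = S * fderiv ℝ ψ (cubeMap y S z) (EuclideanSpace.single i 1) := by
      conv_lhs => rw [hφψ]
      rw [← gradient_apply]
      exact partialDeriv_comp_cubeMap ((hψ.differentiable (by simp)) _) i
    by_cases hz : z ∈ D
    · simp only [hw z hz, e]
      ring
    · have h0 : fderiv ℝ φ z = 0 := image_eq_zero_of_notMem_tsupport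
        fun h => hz (hφs (tsupport_fderiv_subset ℝ h))
      rw [h0] at e
      simp only [h0, _root_.zero_apply, mul_zero] at e ⊢
      rw [mul_left_comm, ← e, mul_zero]
  have e2 : ∫ z, W z * φ z = S * ((S ^ n)⁻¹ * ∫ x, U x * ψ x) := by
    rw [← integral_comp_cubeMap (y := y) hS, ← integral_const_mul]
    refine integral_congr_ae (.of_forall fun z => ?_)
    have e : φ z = ψ (cubeMap y S z) := congrFun hφψ z
    by_cases hz : z ∈ D
    · simp only [hW z hz, e]
      ring
    · have h0 : φ z = 0 := image_eq_zero_of_notMem_tsupport fun h => hz (hφs h)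
      simp only [← e, h0, mul_zero]
  rw [e1, e2, key]
  ring

end CubeMap

/-! ### Transplantation of the hypotheses to the unit cube -/

section Transplantation

open Metric
open scoped ContDiff

variable {n : ℕ}

/-- No integrability is needed here, since the integral of a non-integrable function is zero. -/
theorem ofReal_integral_le_lintegral {α : Type*} [MeasurableSpace α] {μ : Measure α} {F : α → ℝ}
    (hF : ∀ x, 0 ≤ F x) : ENNReal.ofReal (∫ x, F x ∂μ) ≤ ∫⁻ x, ENNReal.ofReal (F x) ∂μ := by
  by_cases hi : Integrable F μ
  · exact (ofReal_integral_eq_lintegral_ofReal hi (.of_forall hF)).le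
  · simp [integral_undef hi]

theorem ofReal_norm_sq_eq_sum (w : EuclideanSpace ℝ (Fin n)) :
    ENNReal.ofReal (‖w‖ ^ 2) = ∑ i, ‖w i‖ₑ ^ 2 := by
  rw [EuclideanSpace.norm_sq_eq, ENNReal.ofReal_sum_of_nonneg fun i _ => sq_nonneg _]
  refine Finset.sum_congr rfl fun i _ => ?_
  rw [enorm_sq_eq_ofReal, Real.norm_eq_abs, sq_abs]

theorem enorm_mul_sq_eq {S : ℝ} (t : ℝ) :
    ‖S * t‖ₑ ^ 2 = ENNReal.ofReal (S ^ 2) * ‖t‖ₑ ^ 2 := by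
  rw [enorm_mul, mul_pow, enorm_sq_eq_ofReal S]

/-- The coordinatewise retraction onto the closed unit cube. Composition with it turns a function
that is continuous on the cube into one that is continuous everywhere. -/
noncomputable def cubeClip (z : Fin n → ℝ) : Fin n → ℝ := fun i => max (-1) (min 1 (z i))

theorem continuous_cubeClip : Continuous (cubeClip (n := n)) := by
  unfold cubeClip
  fun_prop

theorem norm_cubeClip_le (z : Fin n → ℝ) : ‖cubeClip z‖ ≤ 1 := by
  refine (pi_norm_le_iff_of_nonneg zero_le_one).2 fun i => ?_
  rw [Real.norm_eq_abs, abs_le]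
  exact ⟨le_max_left _ _, max_le (by norm_num) (min_le_left _ _)⟩

theorem cubeClip_of_mem_ball {z : Fin n → ℝ} (hz : z ∈ ball (0 : Fin n → ℝ) 1) :
    cubeClip z = z := by
  ext i
  have h := (norm_le_pi_norm z i).trans (mem_ball_zero_iff.1 hz).le
  rw [Real.norm_eq_abs, abs_le] at h
  simp only [cubeClip]
  rw [min_eq_right h.2, max_eq_right h.1]

variable {B : Set (EuclideanSpace ℝ (Fin n))} {v f : EuclideanSpace ℝ (Fin n) → ℝ}
  {g : EuclideanSpace ℝ (Fin n) → EuclideanSpace ℝ (Fin n)}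
  {y : EuclideanSpace ℝ (Fin n)} {S cm M₁ M₂ k₀ : ℝ}

theorem memLp_comp_cubeMap {F : Type*} [NormedAddCommGroup F] (hS : 0 < S)
    {h : EuclideanSpace ℝ (Fin n) → F} {p : ℝ≥0∞} (hh : MemLp h p volume) :
    MemLp (fun z => h (cubeMap y S z)) p volume := by
  have : MemLp h p (Measure.map (cubeMap y S) volume) := by
    rw [map_cubeMap hS]
    exact hh.smul_measure ENNReal.ofReal_ne_top
  exact this.comp_of_map (measurableEmbedding_cubeMap hS.ne').measurable.aemeasurable

/-- The hypotheses on `v` and `f` in an open set `B` give those of `CaccioppoliOnCube` for the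
functions transplanted from a cube in `B` to the unit cube. The gradient and the right-hand side are
both multiplied by `S`, which makes the constants scale invariant. -/
theorem caccioppoliOnCube_of_hasWeakGradient (hB : IsOpen B) (hS : 0 < S)
    (hT : ∀ z : Fin n → ℝ, ‖z‖ ≤ 1 → cubeMap y S z ∈ B) (hv : ContinuousOn v B)
    (hg : HasWeakGradient B v g) (hg2 : MemLp g 2 (volume.restrict B))
    (hcac : ∀ k : ℝ, k₀ ≤ k →
      ∀ g : EuclideanSpace ℝ (Fin n) → EuclideanSpace ℝ (Fin n),
        HasWeakGradient B (fun x => max (v x - k) 0) g →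
      ∀ η : EuclideanSpace ℝ (Fin n) → ℝ, ContDiff ℝ 1 η → HasCompactSupport η →
        tsupport η ⊆ B → (∀ x, 0 ≤ η x) →
        (∫ x in B, ‖g x‖ ^ 2 * η x ^ 2) ≤
          cm ^ 2 * M₁ ^ 2 * (∫ x in B, (max (v x - k) 0) ^ 2 * ‖∇ η x‖ ^ 2) +
            cm ^ 2 * M₂ ^ 2 * (∫ x in B ∩ {x | k < v x}, η x ^ 2 * |f x| ^ 2)) :
    CaccioppoliOnCube cm M₁ M₂ k₀ (fun z => v (cubeMap y S (cubeClip z)))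
      (fun i => (ball 0 1).indicator fun z => S * g (cubeMap y S z) i)
      ((ball 0 1).indicator fun z => S * f (cubeMap y S z)) where
  continuous := by
    refine hv.comp_continuous ((contDiff_cubeMap (k := 0)).continuous.comp continuous_cubeClip)
      fun z => hT _ (norm_cubeClip_le z)
  memLp := fun i => by
    have h1 : MemLp (fun z => S * (B.indicator g (cubeMap y S z)) i) 2 volume :=
      (((EuclideanSpace.proj (𝕜 := ℝ) i).comp_memLp'
        (memLp_comp_cubeMap hS ((memLp_indicator_iff_restrict hB.measurableSet).2 hg2)))).const_mul S
    refine (memLp_congr_ae (.of_forall fun z => ?_)).1 (h1.indicator (measurableSet_ball (x := 0)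
      (ε := 1)))
    by_cases hz : z ∈ ball (0 : Fin n → ℝ) 1
    · simp only [indicator_of_mem hz, indicator_of_mem (hT z (mem_ball_zero_iff.1 hz).le)]
    · simp only [indicator_of_notMem hz]
  weak := fun k hk i => by
    refine ((hg.posPart hB hv k).hasWeakDirDeriv i).comp_cubeMap hS
      (fun z hz => hT z (mem_ball_zero_iff.1 hz).le) (fun z hz => ?_) fun z hz => ?_
    · rw [cubeClip_of_mem_ball hz]
    · have hzB := hT z (mem_ball_zero_iff.1 hz).le
      by_cases hkz : k < v (cubeMap y S z) <;>
        simp [indicator, cubeClip_of_mem_ball hz, hkz, hzB, mem_ball_zero_iff.1 hz]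
  caccioppoli := fun k hk η hη hηc hηs hη0 => by
    have hTB : ∀ z ∈ ball (0 : Fin n → ℝ) 1, cubeMap y S z ∈ B :=
      fun z hz => hT z (mem_ball_zero_iff.1 hz).le
    obtain ⟨hψc, hψs⟩ := hasCompactSupport_comp_cubeMapInv (y := y) hS.ne' hηc
    have hψ : ContDiff ℝ ∞ fun x => η (cubeMapInv y S x) := hη.comp contDiff_cubeMapInv
    obtain ⟨ψ, hψdef⟩ : ∃ ψ : EuclideanSpace ℝ (Fin n) → ℝ, ψ = fun x => η (cubeMapInv y S x) :=
      ⟨_, rfl⟩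
    rw [← hψdef] at hψc hψs hψ
    have hηψ : ∀ z, ψ (cubeMap y S z) = η z := fun z => by
      simp only [hψdef, cubeMapInv_cubeMap hS.ne']
    have hdη : ∀ i z, partialDeriv i η z = S * (∇ ψ (cubeMap y S z)) i := fun i z => by
      rw [← partialDeriv_comp_cubeMap ((hψ.differentiable (by simp)) _) i]
      simp only [hηψ]
    have hη_out : ∀ z, z ∉ ball (0 : Fin n → ℝ) 1 → η z = 0 := fun z hz =>
      image_eq_zero_of_notMem_tsupport fun h => hz (hηs h)
    have hdη_out : ∀ z, z ∉ ball (0 : Fin n → ℝ) 1 → ∀ i, partialDeriv i η z = 0 := fun z hz i => by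
      have : fderiv ℝ η z = 0 := image_eq_zero_of_notMem_tsupport
        fun h => hz (hηs (tsupport_fderiv_subset ℝ h))
      simp [partialDeriv, this]
    have hopen : IsOpen (B ∩ {x | k < v x}) := hv.isOpen_inter_preimage hB isOpen_Ioi
    set gk := (B ∩ {x | k < v x}).indicator g with hgk
    have key := hcac k hk gk (hg.posPart hB hv k) ψ (hψ.of_le (by exact_mod_cast le_top)) hψc
      (hψs.trans ((image_mono hηs).trans (image_subset_iff.2 hTB))) fun x => by
        rw [hψdef]; exact hη0 _
    -- the left-hand side, transplanted
    have hL : ∫⁻ z, ‖η z‖ₑ ^ 2 * truncGradSq (fun z => v (cubeMap y S (cubeClip z)))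
          (fun i => (ball 0 1).indicator fun z => S * g (cubeMap y S z) i) k z
        = ENNReal.ofReal (S ^ 2) * (ENNReal.ofReal ((S ^ n)⁻¹) *
          ENNReal.ofReal (∫ x in B, ‖gk x‖ ^ 2 * ψ x ^ 2)) := by
      rw [ofReal_integral_eq_lintegral_ofReal _ (.of_forall fun x => by positivity),
        ← lintegral_indicator hB.measurableSet, ← lintegral_comp_cubeMap (y := y) hS,
        ← lintegral_const_mul' _ _ ENNReal.ofReal_ne_top]
      · refine lintegral_congr fun z => ?_
        by_cases hz : z ∈ ball (0 : Fin n → ℝ) 1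
        · rw [indicator_of_mem (hTB z hz), hηψ, ENNReal.ofReal_mul (sq_nonneg _),
            ofReal_norm_sq_eq_sum, ← enorm_sq_eq_ofReal (η z), mul_comm (‖η z‖ₑ ^ 2), ← mul_assoc]
          congr 1
          by_cases hkz : k < v (cubeMap y S z)
          · rw [truncGradSq, indicator_of_mem (by simpa [cubeClip_of_mem_ball hz] using hkz), hgk,
              indicator_of_mem (s := B ∩ {x | k < v x}) ⟨hTB z hz, hkz⟩, Finset.mul_sum]
            refine Finset.sum_congr rfl fun i _ => ?_
            rw [indicator_of_mem hz, enorm_mul_sq_eq]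
          · rw [truncGradSq, indicator_of_notMem (by simpa [cubeClip_of_mem_ball hz] using hkz), hgk,
              indicator_of_notMem fun h => hkz h.2]
            simp
        · have : (B.indicator (fun x => ENNReal.ofReal (‖gk x‖ ^ 2 * ψ x ^ 2)) (cubeMap y S z))
              = 0 := by simp [indicator, hηψ, hη_out z hz]
          rw [this, hη_out z hz]
          simp
      · have h1 : MemLp gk 2 (volume.restrict B) := hg2.indicator hopen.measurableSet
        obtain ⟨C, hC⟩ := hψ.continuous.bounded_above_of_compact_support hψc
        refine (h1.integrable_norm_pow two_ne_zero).mul_bdd (c := C ^ 2)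
          (hψ.continuous.pow 2).aestronglyMeasurable (.of_forall fun x => ?_)
        rw [norm_pow]
        exact pow_le_pow_left₀ (norm_nonneg _) (hC x) 2
    have hR₁ : ENNReal.ofReal (S ^ 2) * (ENNReal.ofReal ((S ^ n)⁻¹) *
          ENNReal.ofReal (∫ x in B, (max (v x - k) 0) ^ 2 * ‖∇ ψ x‖ ^ 2))
        ≤ ∫⁻ z, ‖max (v (cubeMap y S (cubeClip z)) - k) 0‖ₑ ^ 2 * ∑ i, ‖partialDeriv i η z‖ₑ ^ 2 := by
      refine (mul_le_mul_right (mul_le_mul_right (ofReal_integral_le_lintegral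
        fun x => by positivity) _) _).trans ?_
      rw [← lintegral_indicator hB.measurableSet, ← lintegral_comp_cubeMap (y := y) hS,
        ← lintegral_const_mul' _ _ ENNReal.ofReal_ne_top]
      refine lintegral_mono fun z => ?_
      have hs : ∑ i, ‖partialDeriv i η z‖ₑ ^ 2
          = ENNReal.ofReal (S ^ 2) * ENNReal.ofReal (‖∇ ψ (cubeMap y S z)‖ ^ 2) := by
        rw [ofReal_norm_sq_eq_sum, Finset.mul_sum]
        exact Finset.sum_congr rfl fun i _ => by rw [hdη, enorm_mul_sq_eq]
      by_cases hz : z ∈ ball (0 : Fin n → ℝ) 1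
      · rw [indicator_of_mem (hTB z hz), hs, cubeClip_of_mem_ball hz,
          ENNReal.ofReal_mul (sq_nonneg _), ← enorm_sq_eq_ofReal (max _ _)]
        exact (mul_left_comm _ _ _).le
      · have h0 : ∑ i, ‖partialDeriv i η z‖ₑ ^ 2 = 0 := by simp [hdη_out z hz]
        refine le_of_eq_of_le ?_ zero_le
        rw [h0] at hs
        by_cases hzB : cubeMap y S z ∈ B
        · rw [indicator_of_mem hzB, ENNReal.ofReal_mul (sq_nonneg _), mul_left_comm, ← hs, mul_zero]
        · rw [indicator_of_notMem hzB, mul_zero]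
    have hR₂ : ENNReal.ofReal (S ^ 2) * (ENNReal.ofReal ((S ^ n)⁻¹) *
          ENNReal.ofReal (∫ x in B ∩ {x | k < v x}, ψ x ^ 2 * |f x| ^ 2))
        ≤ ∫⁻ z in {z | k < v (cubeMap y S (cubeClip z))}, ‖η z‖ₑ ^ 2 *
          ‖(ball 0 1).indicator (fun z => S * f (cubeMap y S z)) z‖ₑ ^ 2 := by
      have hvc : Continuous fun z => v (cubeMap y S (cubeClip z)) :=
        hv.comp_continuous ((contDiff_cubeMap (k := 0)).continuous.comp continuous_cubeClip)
          fun z => hT _ (norm_cubeClip_le z)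
      refine (mul_le_mul_right (mul_le_mul_right (ofReal_integral_le_lintegral
        fun x => by positivity) _) _).trans ?_
      rw [← lintegral_indicator hopen.measurableSet, ← lintegral_comp_cubeMap (y := y) hS,
        ← lintegral_const_mul' _ _ ENNReal.ofReal_ne_top,
        ← lintegral_indicator (isOpen_lt continuous_const hvc).measurableSet]
      refine lintegral_mono fun z => ?_
      by_cases hz : z ∈ ball (0 : Fin n → ℝ) 1
      · by_cases hkz : k < v (cubeMap y S z)
        · rw [indicator_of_mem (s := B ∩ {x | k < v x}) ⟨hTB z hz, hkz⟩,
            indicator_of_mem (by simpa [cubeClip_of_mem_ball hz] using hkz), indicator_of_mem hz,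
            ENNReal.ofReal_mul (sq_nonneg _), hηψ, enorm_mul_sq_eq, sq_abs, ← enorm_sq_eq_ofReal (η z),
            ← enorm_sq_eq_ofReal (f _)]
          exact (mul_left_comm _ _ _).le
        · rw [indicator_of_notMem fun h => hkz h.2, mul_zero]
          exact zero_le
      · refine le_of_eq_of_le ?_ zero_le
        simp [indicator, hηψ, hη_out z hz]
    rw [hL]
    have hp₁ : 0 ≤ ∫ x in B, (max (v x - k) 0) ^ 2 * ‖∇ ψ x‖ ^ 2 :=
      integral_nonneg fun x => by positivity
    have hp₂ : 0 ≤ ∫ x in B ∩ {x | k < v x}, ψ x ^ 2 * |f x| ^ 2 :=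
      integral_nonneg fun x => by positivity
    refine (mul_le_mul_right (mul_le_mul_right (ENNReal.ofReal_le_ofReal key) _) _).trans ?_
    rw [ENNReal.ofReal_add (by positivity) (by positivity), ENNReal.ofReal_mul (by positivity),
      ENNReal.ofReal_mul (p := cm ^ 2 * M₂ ^ 2) (by positivity)]
    refine le_trans (le_of_eq ?_) (add_le_add (mul_le_mul_right hR₁ _) (mul_le_mul_right hR₂ _))
    ring

end Transplantation

/-! ### Local boundedness -/

section LocalBoundedness

open Metric
open scoped ContDiff

variable {n : ℕ} {x₀ y : EuclideanSpace ℝ (Fin n)} {R S : ℝ}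

/-- A set that contains a cube of half-side `S` has measure at least `Sⁿ`. -/
theorem ofReal_pow_le_volume (hS : 0 < S) {B : Set (EuclideanSpace ℝ (Fin n))}
    (hT : ∀ z : Fin n → ℝ, ‖z‖ ≤ 1 → cubeMap y S z ∈ B) :
    ENNReal.ofReal (S ^ n) ≤ volume B := by
  have h1 : (1 : ℝ≥0∞) ≤ volume (cubeMap y S ⁻¹' B) := by
    calc (1 : ℝ≥0∞) ≤ ENNReal.ofReal ((2 * 1) ^ Fintype.card (Fin n)) := by
          rw [← ENNReal.ofReal_one]
          exact ENNReal.ofReal_le_ofReal (one_le_pow₀ (by norm_num))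
      _ = volume (closedBall (0 : Fin n → ℝ) 1) := (Real.volume_pi_closedBall 0 zero_le_one).symm
      _ ≤ _ := measure_mono fun z hz => hT z (mem_closedBall_zero_iff.1 hz)
  rw [volume_preimage_cubeMap hS] at h1
  calc ENNReal.ofReal (S ^ n)
      ≤ ENNReal.ofReal (S ^ n) * (ENNReal.ofReal ((S ^ n)⁻¹) * volume B) := le_mul_of_one_le_right' h1
    _ = volume B := by
        rw [← mul_assoc, ← ENNReal.ofReal_mul (by positivity), mul_inv_cancel₀ (by positivity),
          ENNReal.ofReal_one, one_mul]

/-- The integral of a square over the transplanted cube is controlled by the mean square over the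
ball. -/
theorem lintegral_cube_sq_le (hn : 1 ≤ n) (hR : 0 < R) (hSR : S = R / (2 * n))
    (hT : ∀ z : Fin n → ℝ, ‖z‖ ≤ 1 → cubeMap y S z ∈ ball x₀ R)
    {w : EuclideanSpace ℝ (Fin n) → ℝ} (hw : MemLp w 2 (volume.restrict (ball x₀ R)))
    {u : (Fin n → ℝ) → ℝ} (hu : ∀ z ∈ ball (0 : Fin n → ℝ) 1, u z = w (cubeMap y S z)) :
    ∫⁻ z in ball 0 1, ‖u z‖ₑ ^ 2 ≤ ENNReal.ofReal
      ((2 * n) ^ n * volume.real (ball (0 : EuclideanSpace ℝ (Fin n)) 1) *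
        ⨍ x in ball x₀ R, w x ^ 2) := by
  have hn0 : (0:ℝ) < n := by exact_mod_cast hn
  have hS : 0 < S := by rw [hSR]; positivity
  calc ∫⁻ z in ball 0 1, ‖u z‖ₑ ^ 2
      ≤ ∫⁻ z, (ball x₀ R).indicator (fun x => ENNReal.ofReal (w x ^ 2)) (cubeMap y S z) := by
        rw [← lintegral_indicator measurableSet_ball]
        refine lintegral_mono fun z => ?_
        by_cases hz : z ∈ ball (0 : Fin n → ℝ) 1
        · rw [indicator_of_mem hz, indicator_of_mem (hT z (mem_ball_zero_iff.1 hz).le), hu z hz,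
            enorm_sq_eq_ofReal]
        · rw [indicator_of_notMem hz]
          exact zero_le
    _ = ENNReal.ofReal ((S ^ n)⁻¹ * ∫ x in ball x₀ R, w x ^ 2) := by
        rw [lintegral_comp_cubeMap hS, lintegral_indicator measurableSet_ball,
          ENNReal.ofReal_mul (by positivity),
          ofReal_integral_eq_lintegral_ofReal hw.integrable_sq (.of_forall fun x => sq_nonneg _)]
    _ = _ := by
        have hω : 0 < volume.real (ball (0 : EuclideanSpace ℝ (Fin n)) 1) :=
          ENNReal.toReal_pos (measure_ball_pos _ _ one_pos).ne' measure_ball_lt_top.ne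
        have hv : volume.real (ball x₀ R)
            = R ^ n * volume.real (ball (0 : EuclideanSpace ℝ (Fin n)) 1) := by
          rw [Measure.real, Measure.addHaar_ball_of_pos _ _ hR, ENNReal.toReal_mul,
            ENNReal.toReal_ofReal (by positivity), finrank_euclideanSpace_fin, Measure.real]
        rw [setAverage_eq, hv, hSR, smul_eq_mul]
        congr 1
        rw [div_pow]
        field_simp

/-- The values of the rearrangement along the sequence `Sⁿθʲ` bound the distribution function of
the transplanted right-hand side, and their weighted sum is bounded by the Lorentz norm. -/
theorem exists_dyadic_levels (hn : 1 ≤ n) (hS : 0 < S) {B : Set (EuclideanSpace ℝ (Fin n))}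
    (hB : MeasurableSet B) (hT : ∀ z : Fin n → ℝ, ‖z‖ ≤ 1 → cubeMap y S z ∈ B)
    {f : EuclideanSpace ℝ (Fin n) → ℝ} (hf : MemLp f 2 volume) {θ : ℝ} (hθ0 : 0 < θ) (hθ1 : θ < 1)
    (hL : lorentzNorm B f ≠ ⊤) :
    ∃ F : ℕ → ℝ, (∀ i, 0 ≤ F i) ∧ Monotone F ∧
      (∀ i, volume {z | F i < |(ball 0 1).indicator (fun z => S * f (cubeMap y S z)) z|}
        ≤ ENNReal.ofReal (θ ^ i)) ∧
      ∀ N, ∑ i ∈ Finset.range N, F (i + 1) * (θ ^ (1 / (n : ℝ))) ^ i ≤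
        (lorentzNorm B f).toReal / ((1 - θ) * θ ^ (1 / (n : ℝ))) := by
  set r : ℕ → ℝ≥0∞ := fun j => rearrangement (B.indicator f) (S ^ n * θ ^ j) with hr
  have hrt : ∀ j, r j ≠ ⊤ := fun j => rearrangement_ne_top (hf.indicator hB) (by positivity)
  refine ⟨fun j => S * (r j).toReal, fun i => by positivity, ?_, ?_, ?_⟩
  · refine monotone_nat_of_le_succ fun i => mul_le_mul_of_nonneg_left
      (ENNReal.toReal_mono (hrt _) (rearrangement_anti _ ?_)) hS.le
    rw [pow_succ, ← mul_assoc]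
    exact mul_le_of_le_one_right (by positivity) hθ1.le
  · intro i
    have hsub : {z | S * (r i).toReal < |(ball 0 1).indicator (fun z => S * f (cubeMap y S z)) z|}
        ⊆ cubeMap y S ⁻¹' {x | (r i).toReal < |B.indicator f x|} := by
      intro z hz
      rw [mem_ofPred_eq] at hz
      rw [mem_preimage, mem_ofPred_eq]
      by_cases hz1 : z ∈ ball (0 : Fin n → ℝ) 1
      · rw [indicator_of_mem hz1, abs_mul, abs_of_pos hS] at hz
        rw [indicator_of_mem (hT z (mem_ball_zero_iff.1 hz1).le)]
        exact lt_of_mul_lt_mul_left hz hS.le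
      · rw [indicator_of_notMem hz1, abs_zero] at hz
        exact absurd hz (not_lt.2 (by positivity))
    refine (measure_mono hsub).trans ?_
    rw [volume_preimage_cubeMap hS]
    refine (mul_le_mul_right (volume_rearrangement_lt_le _ (hrt i)) _).trans (le_of_eq ?_)
    rw [← ENNReal.ofReal_mul (by positivity), inv_mul_cancel_left₀ (by positivity)]
  · intro N
    set ρ := θ ^ (1 / (n : ℝ)) with hρ
    have hρ0 : 0 < ρ := by positivity
    have h1θ : 0 < 1 - θ := by linarith
    have key := ENNReal.toReal_mono hL
      (sum_rearrangement_le_lorentzNorm hn (f := f) hS hθ0 hθ1 (ofReal_pow_le_volume hS hT) N)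
    rw [ENNReal.toReal_sum fun i _ => ENNReal.mul_ne_top ENNReal.ofReal_ne_top (hrt _)] at key
    rw [le_div_iff₀ (by positivity), Finset.sum_mul]
    refine le_trans (le_of_eq (Finset.sum_congr rfl fun i _ => ?_)) key
    rw [ENNReal.toReal_mul, ENNReal.toReal_ofReal (by positivity), ← hρ]
    change S * (r (i + 1)).toReal * ρ ^ i * _ = _ * (r (i + 1)).toReal
    ring

/-- The pointwise form of the local boundedness estimate, with a general exponent `σ`. -/
theorem exists_pointwise_const (hn : 3 ≤ n) {σ : ℝ} (hσ : 0 < σ) (hσn : ((n : ℝ) - 3) / 2 ≤ σ)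
    (cm : ℝ) : ∃ c : ℝ, 1 ≤ c ∧
      ∀ (x₀ : EuclideanSpace ℝ (Fin n)) (R : ℝ), 0 < R →
      ∀ v : EuclideanSpace ℝ (Fin n) → ℝ,
        MemW12 (ball x₀ R) v → ContinuousOn v (ball x₀ R) → (∀ x ∈ ball x₀ R, 0 ≤ v x) →
      ∀ f : EuclideanSpace ℝ (Fin n) → ℝ, MemLp f 2 volume →
      ∀ M₁ M₂ k₀ : ℝ, 1 ≤ M₁ → 0 < M₂ → 0 ≤ k₀ →
        (∀ k : ℝ, k₀ ≤ k →
          ∀ g : EuclideanSpace ℝ (Fin n) → EuclideanSpace ℝ (Fin n),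
            HasWeakGradient (ball x₀ R) (fun x => max (v x - k) 0) g →
          ∀ η : EuclideanSpace ℝ (Fin n) → ℝ, ContDiff ℝ 1 η → HasCompactSupport η →
            tsupport η ⊆ ball x₀ R → (∀ x, 0 ≤ η x) →
            (∫ x in ball x₀ R, ‖g x‖ ^ 2 * η x ^ 2) ≤
              cm ^ 2 * M₁ ^ 2 * (∫ x in ball x₀ R, (max (v x - k) 0) ^ 2 * ‖∇ η x‖ ^ 2) +
                cm ^ 2 * M₂ ^ 2 * (∫ x in ball x₀ R ∩ {x | k < v x}, η x ^ 2 * |f x| ^ 2)) →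
        ∀ y ∈ ball x₀ (R / 4), ENNReal.ofReal (v y) ≤
          ENNReal.ofReal k₀ +
            ENNReal.ofReal (c * M₁ ^ (1 + σ) *
              (⨍ x in ball x₀ R, (max (v x - k₀) 0) ^ 2) ^ (1 / 2 : ℝ)) +
            ENNReal.ofReal (c * M₁ ^ σ * M₂) * lorentzNorm (ball x₀ R) f := by
  obtain ⟨m, rfl⟩ : ∃ m, n = m + 1 := ⟨n - 1, by omega⟩
  have hσm : ((m:ℝ) - 2) / 2 ≤ σ := by
    push_cast at hσn
    linarith
  obtain ⟨θ, C, hθ0, hθ1, hC, hmain⟩ := exists_cube_const (m := m) (by omega) hσ hσm cm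
  set nn : ℝ := ((m + 1 : ℕ) : ℝ) with hnn
  have hnn0 : 0 < nn := by positivity
  set A : ℝ := (2 * nn) ^ (m + 1) *
    volume.real (ball (0 : EuclideanSpace ℝ (Fin (m + 1))) 1) with hA
  have hA0 : 0 ≤ A := by positivity
  have h1θ : 0 < 1 - θ := by linarith
  set b : ℝ := 1 / ((1 - θ) * θ ^ (1 / nn)) with hb
  have hb0 : 0 ≤ b := by positivity
  have hC0 : 0 ≤ C := by linarith
  have hs0 := Real.sqrt_nonneg A
  refine ⟨C * (1 + Real.sqrt A + b), by nlinarith, ?_⟩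
  intro x₀ R hR v hvW hv hv0 f hf M₁ M₂ k₀ hM₁ hM₂ hk₀ hcac y hy
  obtain ⟨hv2, g, hg, hg2⟩ := hvW
  have hM0 : 0 < M₁ := by linarith
  by_cases hL : lorentzNorm (ball x₀ R) f = ⊤
  · rw [hL, ENNReal.mul_top (ENNReal.ofReal_pos.2 (by positivity)).ne', add_top]
    exact le_top
  set S : ℝ := R / (2 * nn) with hSdef
  have hS : 0 < S := by positivity
  have hT : ∀ z : Fin (m + 1) → ℝ, ‖z‖ ≤ 1 → cubeMap y S z ∈ ball x₀ R := fun z hz =>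
    cubeMap_mem_ball hR hS.le (by rw [← hnn, hSdef]; field_simp; exact le_rfl) hy hz
  have hcube := caccioppoliOnCube_of_hasWeakGradient isOpen_ball hS hT hv hg hg2 hcac
  obtain ⟨F, hF0, hFm, hFv, hFs⟩ := exists_dyadic_levels (by omega) hS measurableSet_ball hT hf
    hθ0 hθ1 hL
  have hw : MemLp (fun x => max (v x - k₀) 0) 2 (volume.restrict (ball x₀ R)) := by
    refine hv2.mono (ContinuousOn.aestronglyMeasurable
      ((hv.sub continuousOn_const).sup continuousOn_const) measurableSet_ball) ?_
    filter_upwards [ae_restrict_mem measurableSet_ball] with x hx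
    rw [Real.norm_of_nonneg (le_max_right _ _), Real.norm_of_nonneg (hv0 x hx)]
    exact max_le (by linarith) (hv0 x hx)
  set avg := ⨍ x in ball x₀ R, (max (v x - k₀) 0) ^ 2 with havg
  have havg0 : 0 ≤ avg := by
    rw [havg, setAverage_eq, smul_eq_mul]
    exact mul_nonneg (by positivity) (integral_nonneg fun x => sq_nonneg _)
  have hI : ∫⁻ z in ball 0 1, ‖max (v (cubeMap y S (cubeClip z)) - k₀) 0‖ₑ ^ 2
      ≤ ENNReal.ofReal (Real.sqrt (A * avg) ^ 2) := by
    rw [Real.sq_sqrt (by positivity)]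
    exact lintegral_cube_sq_le (by omega) hR hSdef hT hw
      fun z hz => by rw [cubeClip_of_mem_ball hz]
  have hfm : AEMeasurable
      ((ball (0 : Fin (m + 1) → ℝ) 1).indicator fun z => S * f (cubeMap y S z)) volume :=
    (((memLp_comp_cubeMap hS hf).const_mul S).indicator
      measurableSet_ball).aestronglyMeasurable.aemeasurable
  have hFs' : ∀ N, ∑ i ∈ Finset.range N, F (i + 1) * (θ ^ (1 / ((m : ℝ) + 1))) ^ i ≤
      (lorentzNorm (ball x₀ R) f).toReal * b := by
    intro N
    have e : (m : ℝ) + 1 = nn := by rw [hnn]; push_cast; ring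
    rw [hb, mul_one_div, e]
    exact hFs N
  have key := hmain hM₁ hM₂.le hcube hfm hF0 hFm hFv hFs' (Real.sqrt_nonneg _) hI
  have h0 : cubeMap y S (cubeClip 0) = y := by
    rw [cubeClip_of_mem_ball (mem_ball_self one_pos)]
    simp [cubeMap]
  simp only [h0] at key
  set Λ := (lorentzNorm (ball x₀ R) f).toReal with hΛ
  have hΛ0 : 0 ≤ Λ := ENNReal.toReal_nonneg
  have hMσ : 0 < M₁ ^ σ := by positivity
  have hbound : v y ≤ k₀ + C * (1 + Real.sqrt A + b) * M₁ ^ (1 + σ) * avg ^ (1 / 2 : ℝ) +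
      C * (1 + Real.sqrt A + b) * M₁ ^ σ * M₂ * Λ := by
    have h1 : M₁ ^ (1 + σ) = M₁ * M₁ ^ σ := by rw [Real.rpow_add hM0, Real.rpow_one]
    rw [Real.sqrt_mul hA0, Real.sqrt_eq_rpow avg] at key
    set q := avg ^ (1 / 2 : ℝ) with hq
    have hq0 : 0 ≤ q := by positivity
    have h2 : 0 ≤ C * M₁ ^ σ * M₁ * q * (1 + b) := by positivity
    have h3 : 0 ≤ C * M₁ ^ σ * M₂ * Λ * (1 + Real.sqrt A) := by positivity
    rw [h1]
    nlinarith [key, h2, h3]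
  rw [← ENNReal.ofReal_toReal hL, ← ENNReal.ofReal_mul (by positivity),
    ← ENNReal.ofReal_add hk₀ (by positivity), ← ENNReal.ofReal_add (by positivity) (by positivity)]
  exact ENNReal.ofReal_le_ofReal hbound

end LocalBoundedness

theorem lemma3 (n : ℕ) (hn : 3 ≤ n) (cm : ℝ) (hcm : 0 < cm) :
    -- the constant `c` as a function of `κ`; it is independent of `κ` if `n ≥ 4`
    ∃ c : ℝ → ℝ,
      (∀ κ ∈ Ioo (0 : ℝ) (1 / 2), 1 ≤ c κ) ∧
      (4 ≤ n → ∀ κ ∈ Ioo (0 : ℝ) (1 / 2), ∀ κ' ∈ Ioo (0 : ℝ) (1 / 2), c κ = c κ') ∧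
      ∀ κ ∈ Ioo (0 : ℝ) (1 / 2),
      ∀ (x₀ : EuclideanSpace ℝ (Fin n)) (R : ℝ), 0 < R →
      ∀ v : EuclideanSpace ℝ (Fin n) → ℝ,
        MemW12 (Metric.ball x₀ R) v → ContinuousOn v (Metric.ball x₀ R) →
        (∀ x ∈ Metric.ball x₀ R, 0 ≤ v x) →
      ∀ f : EuclideanSpace ℝ (Fin n) → ℝ, MemLp f 2 volume →
      ∀ M₁ M₂ k₀ : ℝ, 1 ≤ M₁ → 0 < M₂ → 0 ≤ k₀ →
        -- the Caccioppoli inequality; `g` is the weak gradient of `(v - k)₊`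
        (∀ k : ℝ, k₀ ≤ k →
          ∀ g : EuclideanSpace ℝ (Fin n) → EuclideanSpace ℝ (Fin n),
            HasWeakGradient (Metric.ball x₀ R) (fun x => max (v x - k) 0) g →
          ∀ η : EuclideanSpace ℝ (Fin n) → ℝ, ContDiff ℝ 1 η → HasCompactSupport η →
            tsupport η ⊆ Metric.ball x₀ R → (∀ x, 0 ≤ η x) →
            (∫ x in Metric.ball x₀ R, ‖g x‖ ^ 2 * η x ^ 2) ≤
              cm ^ 2 * M₁ ^ 2 *
                  (∫ x in Metric.ball x₀ R, (max (v x - k) 0) ^ 2 * ‖∇ η x‖ ^ 2) +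
                cm ^ 2 * M₂ ^ 2 *
                  (∫ x in Metric.ball x₀ R ∩ {x | k < v x}, η x ^ 2 * |f x| ^ 2)) →
        eLpNorm (fun x => max (v x) 0) ∞ (volume.restrict (Metric.ball x₀ (R / 4))) ≤
          ENNReal.ofReal k₀ +
            ENNReal.ofReal (c κ * M₁ ^ (1 + max κ (((n : ℝ) - 3) / 2)) *
              (⨍ x in Metric.ball x₀ R, (max (v x - k₀) 0) ^ 2) ^ (1 / 2 : ℝ)) +
            ENNReal.ofReal (c κ * M₁ ^ (max κ (((n : ℝ) - 3) / 2)) * M₂) *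
              lorentzNorm (Metric.ball x₀ R) f := by
  -- the constant is a function of the exponent `σ = max κ ((n - 3) / 2)`, which is `(n - 3) / 2` for
  -- `n ≥ 4` because `κ < 1 / 2`
  have H : ∀ σ : ℝ, ∃ c : ℝ, ∀ (hσ : 0 < σ) (hσn : ((n : ℝ) - 3) / 2 ≤ σ),
      1 ≤ c ∧ _ := fun σ => by
    by_cases h : 0 < σ ∧ ((n : ℝ) - 3) / 2 ≤ σ
    · obtain ⟨c, hc⟩ := exists_pointwise_const hn h.1 h.2 cm
      exact ⟨c, fun _ _ => hc⟩
    · exact ⟨1, fun h1 h2 => absurd ⟨h1, h2⟩ h⟩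
  choose D hD using H
  have hpos : ∀ κ ∈ Ioo (0 : ℝ) (1 / 2), 0 < max κ (((n : ℝ) - 3) / 2) :=
    fun κ hκ => lt_max_of_lt_left hκ.1
  refine ⟨fun κ => D (max κ (((n : ℝ) - 3) / 2)),
    fun κ hκ => (hD _ (hpos κ hκ) (le_max_right _ _)).1, ?_, ?_⟩
  · intro h4 κ hκ κ' hκ'
    have h4' : (4:ℝ) ≤ n := by exact_mod_cast h4
    have h5 : (1:ℝ) / 2 ≤ ((n : ℝ) - 3) / 2 := by linarith
    simp only [max_eq_right (hκ.2.le.trans h5), max_eq_right (hκ'.2.le.trans h5)]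
  · intro κ hκ x₀ R hR v hvW hv hv0 f hf M₁ M₂ k₀ hM₁ hM₂ hk₀ hcac
    rw [eLpNorm_exponent_top]
    refine eLpNormEssSup_le_of_ae_enorm_bound ?_
    filter_upwards [ae_restrict_mem Metric.isOpen_ball.measurableSet] with y hy
    have hyR : y ∈ Metric.ball x₀ R := Metric.ball_subset_ball (by linarith) hy
    rw [max_eq_left (hv0 y hyR), Real.enorm_of_nonneg (hv0 y hyR)]
    exact (hD _ (hpos κ hκ) (le_max_right _ _)).2 x₀ R hR v hvW hv hv0 f hf M₁ M₂ k₀ hM₁ hM₂ hk₀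
      hcac y hy
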